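/- For a permutation $\sigma\in S_4$ and a permutation $\pi\in S_n$, let $\#\sigma(\pi)$ be the number of occurrences of $\sigma$ in $\pi$, that is, of sequences of positions $i_1<i_2<i_3<i_4$ in $\{1,\dots,n\}$ such that $\sigma(j)<\sigma(j')$ whenever $\pi(i_j)<\pi(i_{j'})$. Write $\tilde O(f(n))$ for $O(f(n)\log^c n)$ with some constant $c$. **Theorem 3.** For every $\sigma\in S_4$ there is an algorithm that, given any $n$ and any $\pi\in S_n$ in one-line notation, computes $\#\sigma(\pi)$ in $\tilde O(n^{3/2})$ time and $\tilde O(n^{3/2})$ space. Here an algorithm is a single deterministic program, the same for all $n$, of a random-access machine with words of $O(\log n)$ bits: for some constant $c>0$ the program is correct, within the same time and space bounds, for every word length that is at least $c(\lfloor\log_2 n\rfloor+1)$. Time is the number of elementary operations on words in the worst case (arithmetic modulo $2^w$ for words of $w$ bits, division with remainder, comparison, reading or writing a memory cell), and space is the number of cells of the memory $0,1,2,\dots$ that the machine has, where the input occupies the first $n$ cells and $n$ is held in a register; all addresses that the program accesses are smaller than this number. -/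

import Mathlib

/-- The number `#σ(π)` of occurrences of the pattern `σ ∈ S_k` in `π ∈ S_n`: the number of choices of
positions `i 0 < i 1 < ⋯ < i (k - 1)` such that `σ j < σ j'` whenever `π (i j) < π (i j')`. -/
noncomputable def patternCount {k : ℕ} (σ : Equiv.Perm (Fin k)) {n : ℕ}
    (π : Equiv.Perm (Fin n)) : ℕ :=
  Nat.card {i : Fin k ↪o Fin n // ∀ j j' : Fin k, π (i j) < π (i j') → σ j < σ j'}

/-- `f(n) = Õ(g(n))`: for some constant `c`, `f(n) = O(g(n) (log n)^c)` as `n → ∞`. -/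
def SoftO (f : ℕ → ℕ) (g : ℕ → ℝ) : Prop :=
  ∃ c : ℕ, (fun n : ℕ => (f n : ℝ)) =O[Filter.atTop] (fun n : ℕ => g n * Real.log (n : ℝ) ^ c)

namespace WordRAM

/-- The arithmetic operations and tests on words. -/
inductive BinOp : Type
  | add | sub | mul | div | mod | lt | eq

/-- Operations on `w`-bit words (numbers below `2 ^ w`): addition, subtraction and multiplication are
modulo `2 ^ w`, division rounds down, and a test returns `1` or `0`. -/
def BinOp.eval (w : ℕ) : BinOp → ℕ → ℕ → ℕ
  | .add, a, b => (a + b) % 2 ^ w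
  | .sub, a, b => (a + (2 ^ w - b)) % 2 ^ w
  | .mul, a, b => (a * b) % 2 ^ w
  | .div, a, b => a / b
  | .mod, a, b => a % b
  | .lt, a, b => if a < b then 1 else 0
  | .eq, a, b => if a = b then 1 else 0

/-- Expressions over constants and registers. They do not access the memory. -/
inductive Expr : Type
  | const (k : ℕ)
  | reg (x : ℕ)
  | op (o : BinOp) (e₁ e₂ : Expr)

/-- A state of the machine: the contents of the registers and of the random-access memory. A program
mentions only finitely many registers, so these serve as its local variables. -/
structure State : Type where
  reg : ℕ → ℕ
  mem : ℕ → ℕ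

/-- The value of an expression on a machine with `w`-bit words. -/
def Expr.eval (w : ℕ) (s : State) : Expr → ℕ
  | .const k => k % 2 ^ w
  | .reg x => s.reg x
  | .op o e₁ e₂ => o.eval w (e₁.eval w s) (e₂.eval w s)

/-- The time for evaluating an expression: one unit for each constant, register access and
operation. -/
def Expr.cost : Expr → ℕ
  | .const _ => 1
  | .reg _ => 1
  | .op _ e₁ e₂ => e₁.cost + e₂.cost + 1

/-- Programs of the random-access machine. -/
inductive Prog : Type
  | skip
  /-- register `x` receives the value of `e` -/
  | assign (x : ℕ) (e : Expr)
  /-- register `x` receives the content of the memory cell with address `a` -/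
  | load (x : ℕ) (a : Expr)
  /-- the memory cell with address `a` receives the value of `e` -/
  | store (a e : Expr)
  | seq (p q : Prog)
  /-- run `p` if `e` is nonzero, and `q` otherwise -/
  | ite (e : Expr) (p q : Prog)
  /-- run `p` as long as `e` is nonzero -/
  | while (e : Expr) (p : Prog)

/-- `Exec w S p s t s'`: on the machine with `w`-bit words and the `S` memory cells `0, …, S - 1`,
the program `p`, started in the state `s`, halts after `t` steps in the state `s'`. A program that
accesses an address outside the memory gets stuck, and does not halt in this sense. The machine is
deterministic: there is at most one rule for each program and state. -/
inductive Exec (w S : ℕ) : Prog → State → ℕ → State → Prop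
  | skip (s : State) : Exec w S .skip s 1 s
  | assign (x : ℕ) (e : Expr) (s : State) :
      Exec w S (.assign x e) s (e.cost + 1)
        { s with reg := Function.update s.reg x (e.eval w s) }
  | load (x : ℕ) (a : Expr) (s : State) (ha : a.eval w s < S) :
      Exec w S (.load x a) s (a.cost + 1)
        { s with reg := Function.update s.reg x (s.mem (a.eval w s)) }
  | store (a e : Expr) (s : State) (ha : a.eval w s < S) :
      Exec w S (.store a e) s (a.cost + e.cost + 1)
        { s with mem := Function.update s.mem (a.eval w s) (e.eval w s) }
  | seq {p q : Prog} {s s₁ s₂ : State} {t₁ t₂ : ℕ} (hp : Exec w S p s t₁ s₁)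
      (hq : Exec w S q s₁ t₂ s₂) : Exec w S (.seq p q) s (t₁ + t₂) s₂
  | ite_true {e : Expr} {p q : Prog} {s s' : State} {t : ℕ} (he : e.eval w s ≠ 0)
      (hp : Exec w S p s t s') : Exec w S (.ite e p q) s (e.cost + 1 + t) s'
  | ite_false {e : Expr} {p q : Prog} {s s' : State} {t : ℕ} (he : e.eval w s = 0)
      (hq : Exec w S q s t s') : Exec w S (.ite e p q) s (e.cost + 1 + t) s'
  | while_true {e : Expr} {p : Prog} {s s₁ s₂ : State} {t₁ t₂ : ℕ} (he : e.eval w s ≠ 0)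
      (hp : Exec w S p s t₁ s₁) (hq : Exec w S (.while e p) s₁ t₂ s₂) :
      Exec w S (.while e p) s (e.cost + 1 + t₁ + t₂) s₂
  | while_false {e : Expr} {p : Prog} {s : State} (he : e.eval w s = 0) :
      Exec w S (.while e p) s (e.cost + 1) s

/-- The initial state for the input `π ∈ S_n`: register `0` holds `n`, the memory cells
`0, …, n - 1` hold the one-line notation of `π` (with values counted from `0`), and all the other
registers and memory cells hold `0`. -/
def input {n : ℕ} (π : Equiv.Perm (Fin n)) : State where
  reg := fun x => if x = 0 then n else 0
  mem := fun i => if h : i < n then (π ⟨i, h⟩ : ℕ) else 0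

/-- The permutation statistic `f` is computable in time `T` and space `S`: there are a single program
`p` and a positive constant `c` such that, for all `n` and all `π ∈ S_n`, on every machine whose word
length is at least `c (⌊log₂ n⌋ + 1)` and whose memory consists of `S n` words, the program `p`
halts on the input `π` after at most `T n` steps, with `f π` in register `0`. As `c` is positive, the
numbers in the input fit into words. -/
def Computes (f : ∀ n : ℕ, Equiv.Perm (Fin n) → ℕ) (T S : ℕ → ℕ) : Prop :=
  ∃ (p : Prog) (c : ℕ), 0 < c ∧
    ∀ (n w : ℕ), c * (Nat.log 2 n + 1) ≤ w → ∀ π : Equiv.Perm (Fin n),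
      ∃ (t : ℕ) (s : State), Exec w (S n) p (input π) t s ∧ t ≤ T n ∧ s.reg 0 = f n π

end WordRAM

/-! Twelve times the number of occurrences of a pattern is an integral combination of statistics
that count quadruples of points, repetitions allowed, of a few shapes: paths and stars built from
five binary relations, and one four-cycle. Both sides are sums over all quadruples of functions of
the relative position. After symmetrization over the 24 rearrangements, the identity only has to be
checked on the 49 relative positions of four possibly equal points sorted from left to right.
`patternFormulas` is the certificate for this (`exists_tupleCount_formula`); 12 is a common
denominator of the rational coefficients.

A relation acts on vectors as a linear operator. A path is a composition of three operators applied
to the all-ones vector and then summed; a star is a sum over its centre of a product of three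
degrees (`tupleCount_path`, `tupleCount_star`). Each operator takes time O(n log n): prefix sums by
position or by value, the total sum, the identity, and for `D` a sweep with a binary tree of
weights.

The cycle counts a, b, c, d with a left of b, b below c, c left of d and d below a. Positions are
cut into blocks of length m, about √n, and "left of" splits into "in an earlier block" and "to the
left in the same block". If a and b are in different blocks, then for each block of b the count is
again a composition of prefix sums, so all blocks take time O(nm). If only c and d are in different
blocks, the rotation (a, b, c, d) ↦ (c, d, a, b) leads back to this case. If both pairs lie within
blocks, a sweep over c by increasing value maintains a tree of the pairs (a, b) with b below c,
indexed by the value of a; each c causes at most m queries and m insertions (`cycleSum_eq`,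
`fineProg_ends`). The total is O(n^{3/2} log n) time in linear space.

The machine computes modulo 2^w. Since twelve times the count is below 2^w, its residue determines
it. Correctness, termination and time are proved together in the calculus of `Ends`. -/

/-! ### Pattern counts as combinations of tree sums and one cycle sum -/

/-- Relations between two points of a permutation. -/
inductive Edge : Type
  | D | X | Y | I | J

/-- `e.test p q` says that the point `q` precedes the point `p` in the sense of `e`: to the left and
above (`D`), to the left (`X`), below (`Y`), equal (`I`), or in any way (`J`). -/
def Edge.test : Edge → ℕ × ℕ → ℕ × ℕ → Bool
  | .D, p, q => Nat.blt q.1 p.1 && Nat.blt p.2 q.2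
  | .X, p, q => Nat.blt q.1 p.1
  | .Y, p, q => Nat.blt q.2 p.2
  | .I, p, q => !Nat.blt p.1 q.1 && !Nat.blt q.1 p.1
  | .J, _, _ => true

/-- Shapes of four-point statistics: paths, stars and one cycle. -/
inductive Term : Type
  | path (e₁ e₂ e₃ : Edge)
  | star (e₁ e₂ e₃ : Edge)
  | cyc

/-- The test whether four points form a given shape. -/
def Term.test : Term → ℕ × ℕ → ℕ × ℕ → ℕ × ℕ → ℕ × ℕ → Bool
  | .path e₁ e₂ e₃, p, q, r, s => e₁.test p q && e₂.test q r && e₃.test r s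
  | .star e₁ e₂ e₃, p, q, r, s => e₁.test p q && e₂.test p r && e₃.test p s
  | .cyc, p, q, r, s => Nat.blt p.1 q.1 && Nat.blt q.2 r.2 && Nat.blt r.1 s.1 && Nat.blt s.2 p.2

/-- The test whether four points are, from left to right, an occurrence of the pattern with the values
`k`. -/
def occTest (k : ℕ × ℕ × ℕ × ℕ) (p q r s : ℕ × ℕ) : Bool :=
  Nat.blt p.1 q.1 && Nat.blt q.1 r.1 && Nat.blt r.1 s.1 &&
    (Nat.blt p.2 q.2 == Nat.blt k.1 k.2.1) && (Nat.blt p.2 r.2 == Nat.blt k.1 k.2.2.1) &&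
    (Nat.blt p.2 s.2 == Nat.blt k.1 k.2.2.2) && (Nat.blt q.2 r.2 == Nat.blt k.2.1 k.2.2.1) &&
    (Nat.blt q.2 s.2 == Nat.blt k.2.1 k.2.2.2) && (Nat.blt r.2 s.2 == Nat.blt k.2.2.1 k.2.2.2)

/-- The permutations in `S_4`, in one-line notation. -/
def perms4 : List (Fin 4 × Fin 4 × Fin 4 × Fin 4) :=
  [(0, 1, 2, 3), (0, 1, 3, 2), (0, 2, 1, 3), (0, 2, 3, 1), (0, 3, 1, 2), (0, 3, 2, 1),
   (1, 0, 2, 3), (1, 0, 3, 2), (1, 2, 0, 3), (1, 2, 3, 0), (1, 3, 0, 2), (1, 3, 2, 0),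
   (2, 0, 1, 3), (2, 0, 3, 1), (2, 1, 0, 3), (2, 1, 3, 0), (2, 3, 0, 1), (2, 3, 1, 0),
   (3, 0, 1, 2), (3, 0, 2, 1), (3, 1, 0, 2), (3, 1, 2, 0), (3, 2, 0, 1), (3, 2, 1, 0)]

/-- Links the explicit 24-term `symCount`, suited to evaluation, to a sum over the group, which can
be reindexed. -/
theorem sum_perms4 (F : Fin 4 → Fin 4 → Fin 4 → Fin 4 → ℕ) :
    ∑ g : Equiv.Perm (Fin 4), F (g 0) (g 1) (g 2) (g 3) =
      (perms4.map fun g => F g.1 g.2.1 g.2.2.1 g.2.2.2).sum := by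
  have h : (Finset.univ : Finset (Equiv.Perm (Fin 4))).val.map
      (fun g => (g 0, g 1, g 2, g 3)) = (perms4 : Multiset _) := by decide +kernel
  have h2 := congrArg (fun M => (Multiset.map
    (fun g : Fin 4 × Fin 4 × Fin 4 × Fin 4 => F g.1 g.2.1 g.2.2.1 g.2.2.2) M).sum) h
  rw [Multiset.map_map] at h2
  exact h2

/-- A point of a permutation, given by its position and its value. -/
abbrev Pt := ℕ × ℕ

/-- The number of rearrangements of four points that satisfy a test. -/
def symCount (b : Pt → Pt → Pt → Pt → Bool) (p q r s : Pt) : ℕ :=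
  (b p q r s).toNat + (b p q s r).toNat + (b p r q s).toNat + (b p r s q).toNat +
  (b p s q r).toNat + (b p s r q).toNat +
  ((b q p r s).toNat + (b q p s r).toNat + (b q r p s).toNat + (b q r s p).toNat +
  (b q s p r).toNat + (b q s r p).toNat) +
  ((b r p q s).toNat + (b r p s q).toNat + (b r q p s).toNat + (b r q s p).toNat +
  (b r s p q).toNat + (b r s q p).toNat) +
  ((b s p q r).toNat + (b s p r q).toNat + (b s q p r).toNat + (b s q r p).toNat +
  (b s r p q).toNat + (b s r q p).toNat)

/-- The possible relative positions of four points, not necessarily distinct, that are sorted by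
their first coordinates. -/
def orderTypes : List (Pt × Pt × Pt × Pt) :=
  [((0, 0), (0, 0), (0, 0), (0, 0)), ((0, 0), (0, 0), (0, 0), (3, 3)),
   ((0, 1), (0, 1), (0, 1), (3, 0)), ((0, 0), (0, 0), (2, 2), (2, 2)),
   ((0, 2), (0, 2), (2, 0), (2, 0)), ((0, 0), (0, 0), (2, 2), (3, 3)),
   ((0, 0), (0, 0), (2, 3), (3, 2)), ((0, 1), (0, 1), (2, 0), (3, 3)),
   ((0, 1), (0, 1), (2, 3), (3, 0)), ((0, 2), (0, 2), (2, 0), (3, 1)),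
   ((0, 2), (0, 2), (2, 1), (3, 0)), ((0, 0), (1, 1), (1, 1), (1, 1)),
   ((0, 3), (1, 0), (1, 0), (1, 0)), ((0, 0), (1, 1), (1, 1), (3, 3)),
   ((0, 0), (1, 2), (1, 2), (3, 1)), ((0, 2), (1, 0), (1, 0), (3, 3)),
   ((0, 1), (1, 2), (1, 2), (3, 0)), ((0, 3), (1, 0), (1, 0), (3, 2)),
   ((0, 3), (1, 1), (1, 1), (3, 0)), ((0, 0), (1, 1), (2, 2), (2, 2)),
   ((0, 0), (1, 3), (2, 1), (2, 1)), ((0, 1), (1, 0), (2, 2), (2, 2)),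
   ((0, 2), (1, 3), (2, 0), (2, 0)), ((0, 3), (1, 0), (2, 1), (2, 1)),
   ((0, 3), (1, 2), (2, 0), (2, 0)), ((0, 0), (1, 1), (2, 2), (3, 3)),
   ((0, 0), (1, 1), (2, 3), (3, 2)), ((0, 0), (1, 2), (2, 1), (3, 3)),
   ((0, 0), (1, 2), (2, 3), (3, 1)), ((0, 0), (1, 3), (2, 1), (3, 2)),
   ((0, 0), (1, 3), (2, 2), (3, 1)), ((0, 1), (1, 0), (2, 2), (3, 3)),
   ((0, 1), (1, 0), (2, 3), (3, 2)), ((0, 1), (1, 2), (2, 0), (3, 3)),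
   ((0, 1), (1, 2), (2, 3), (3, 0)), ((0, 1), (1, 3), (2, 0), (3, 2)),
   ((0, 1), (1, 3), (2, 2), (3, 0)), ((0, 2), (1, 0), (2, 1), (3, 3)),
   ((0, 2), (1, 0), (2, 3), (3, 1)), ((0, 2), (1, 1), (2, 0), (3, 3)),
   ((0, 2), (1, 1), (2, 3), (3, 0)), ((0, 2), (1, 3), (2, 0), (3, 1)),
   ((0, 2), (1, 3), (2, 1), (3, 0)), ((0, 3), (1, 0), (2, 1), (3, 2)),
   ((0, 3), (1, 0), (2, 2), (3, 1)), ((0, 3), (1, 1), (2, 0), (3, 2)),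
   ((0, 3), (1, 1), (2, 2), (3, 0)), ((0, 3), (1, 2), (2, 0), (3, 1)),
   ((0, 3), (1, 2), (2, 1), (3, 0))]

/-- The test whether `12` times the number of occurrences of a pattern agrees, on all relative positions
of four points, with a linear combination of shapes. -/
def formulaCheck (k : ℕ × ℕ × ℕ × ℕ) (l : List (ℤ × Term)) : Bool :=
  orderTypes.all fun z => decide (
    (l.map fun c => c.1 * (symCount c.2.test z.1 z.2.1 z.2.2.1 z.2.2.2 : ℤ)).sum =
      12 * (symCount (occTest k) z.1 z.2.1 z.2.2.1 z.2.2.2 : ℤ))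

/-- The possible ranks of four numbers in increasing order. -/
def sortedRanks : List (ℕ × ℕ × ℕ × ℕ) :=
  [(0, 0, 0, 0), (0, 0, 0, 3), (0, 0, 2, 2), (0, 0, 2, 3),
   (0, 1, 1, 1), (0, 1, 1, 3), (0, 1, 2, 2), (0, 1, 2, 3)]

/-- Sorted first coordinates have one of eight tie patterns; the second coordinates have the same
ties and are otherwise in any order, which leaves 1 + 6 + 18 + 24 = 49 cases. The last four
hypotheses make every second coordinate the number of strictly smaller ones, so that each case has
one representative. -/
theorem mem_orderTypes : ∀ x ∈ sortedRanks, ∀ a b c d : Fin 4, (x.1 = x.2.1 ↔ a = b) →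
    (x.2.1 = x.2.2.1 ↔ b = c) → (x.2.2.1 = x.2.2.2 ↔ c = d) → (x.1 = x.2.2.1 ↔ a = c) →
    (x.1 = x.2.2.2 ↔ a = d) → (x.2.1 = x.2.2.2 ↔ b = d) →
    a.val = (decide (b < a)).toNat + (decide (c < a)).toNat + (decide (d < a)).toNat →
    b.val = (decide (a < b)).toNat + (decide (c < b)).toNat + (decide (d < b)).toNat →
    c.val = (decide (a < c)).toNat + (decide (b < c)).toNat + (decide (d < c)).toNat →
    d.val = (decide (a < d)).toNat + (decide (b < d)).toNat + (decide (c < d)).toNat →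
    ((x.1, a.val), (x.2.1, b.val), (x.2.2.1, c.val), (x.2.2.2, d.val)) ∈ orderTypes := by
  decide +kernel

/-! ### Certificates for the 24 patterns -/

/-- For each pattern, a linear combination of shapes that yields `12` times the number of its
occurrences. -/
def patternFormulas : List ((ℕ × ℕ × ℕ × ℕ) × List (ℤ × Term)) := [
  ((0, 1, 2, 3), [
    (-12, .path .D .D .D), (12, .path .D .D .X), (12, .path .D .X .D), (-12, .path .D .X .X),
    (12, .path .X .D .D), (-12, .path .X .D .X), (-12, .path .X .X .D), (12, .path .X .X .X)]),
  ((0, 1, 3, 2), [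
    (-6, .star .D .D .D), (6, .star .D .D .X), (-12, .star .D .D .Y), (12, .star .D .X .Y),
    (-6, .star .X .X .Y), (6, .star .Y .Y .Y), (12, .path .D .D .D), (6, .path .D .D .I),
    (12, .path .D .I .Y), (-12, .path .D .J .D), (12, .path .D .X .Y), (12, .path .D .Y .D),
    (-12, .path .D .Y .J), (6, .path .I .D .Y), (12, .path .X .D .Y)]),
  ((0, 2, 1, 3), [
    (4, .star .D .D .D), (-6, .star .D .D .X), (6, .star .D .D .Y), (-6, .star .D .I .I),
    (6, .star .D .I .J), (6, .star .D .X .X), (-12, .star .D .X .Y), (6, .star .D .Y .Y),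
    (-6, .star .X .X .X), (12, .star .X .X .Y), (-6, .star .X .Y .Y), (-6, .path .D .D .J),
    (2, .path .D .I .I), (-3, .path .I .D .I), (3, .cyc), (6, .path .X .D .X),
    (6, .path .Y .D .Y), (12, .path .Y .X .X), (-12, .path .Y .X .Y)]),
  ((0, 2, 3, 1), [
    (2, .star .D .D .D), (6, .star .D .D .J), (-6, .star .D .D .X), (12, .star .D .D .Y),
    (6, .star .D .I .I), (-12, .star .D .X .Y), (12, .star .D .Y .Y), (-18, .path .D .D .J),
    (6, .path .D .I .D), (-2, .path .D .I .I), (-6, .path .D .I .X), (6, .path .D .I .Y),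
    (6, .path .I .D .D), (-3, .path .I .D .I), (-6, .path .I .D .Y), (-3, .cyc),
    (-6, .path .X .D .X), (-6, .path .X .Y .X), (12, .path .X .Y .Y), (12, .path .Y .D .D),
    (6, .path .Y .D .Y), (-6, .path .Y .X .Y)]),
  ((0, 3, 1, 2), [
    (2, .star .D .D .D), (6, .star .D .D .I), (6, .star .D .D .X), (-6, .star .D .I .I),
    (-6, .star .D .X .X), (12, .star .D .X .Y), (-6, .star .D .Y .Y), (-6, .path .D .D .I),
    (-12, .path .D .D .X), (10, .path .D .I .I), (-6, .path .D .X .J), (6, .path .D .Y .J),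
    (-3, .path .I .D .I), (-6, .path .I .D .X), (12, .path .I .X .X), (-12, .path .I .Y .X),
    (-3, .cyc), (6, .path .X .D .X), (-12, .path .X .Y .Y), (-6, .path .Y .D .Y),
    (12, .path .Y .X .X)]),
  ((0, 3, 2, 1), [
    (-4, .star .D .D .D), (-6, .star .D .D .I), (12, .star .D .D .J), (-12, .star .D .D .Y),
    (6, .star .D .Y .J), (-6, .star .D .Y .Y), (12, .path .D .D .X), (-2, .path .D .I .I),
    (-3, .path .I .D .I), (-6, .path .I .D .X), (-6, .path .I .X .D), (3, .cyc),
    (6, .path .X .D .J), (-6, .path .X .D .X), (-12, .path .Y .D .D), (-6, .path .Y .D .I),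
    (-6, .path .Y .D .Y), (-12, .path .Y .Y .D)]),
  ((1, 0, 2, 3), [
    (-6, .star .D .D .D), (6, .star .D .D .J), (12, .star .D .D .X), (-6, .star .D .D .Y),
    (12, .star .D .X .I), (-12, .star .D .X .J), (12, .star .D .X .Y), (12, .path .D .D .D),
    (-6, .path .D .D .I), (-12, .path .D .D .X), (-6, .path .D .J .D), (-12, .path .X .D .D),
    (6, .path .X .D .I), (12, .path .X .D .X), (12, .path .Y .X .D)]),
  ((1, 0, 3, 2), [
    (8, .star .D .D .D), (-12, .star .D .D .X), (12, .star .D .D .Y), (-12, .star .D .X .I),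
    (12, .star .D .X .J), (-24, .star .D .X .Y), (-12, .star .D .Y .I), (12, .star .D .Y .J),
    (-12, .path .D .D .D), (-8, .path .D .I .I), (6, .path .D .J .D), (12, .path .D .X .D),
    (-12, .path .D .Y .D), (6, .path .I .D .I), (-12, .path .X .D .Y), (12, .path .X .X .Y),
    (-12, .path .Y .D .X), (-12, .path .Y .Y .X)]),
  ((1, 2, 0, 3), [
    (2, .star .D .D .D), (-12, .star .D .D .X), (6, .star .D .D .Y), (6, .star .D .I .I),
    (-6, .star .D .I .J), (12, .star .D .X .X), (-12, .star .D .X .Y), (6, .path .D .D .J),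
    (-2, .path .D .I .I), (-6, .path .I .D .D), (3, .path .I .D .I), (6, .path .I .D .X),
    (-3, .cyc), (-12, .path .X .D .D), (6, .path .X .D .X), (-6, .path .Y .D .Y),
    (-12, .path .Y .X .X), (12, .path .Y .X .Y)]),
  ((1, 2, 3, 0), [
    (4, .star .D .D .D), (6, .star .D .D .I), (6, .star .D .Y .J), (-6, .star .D .Y .Y),
    (2, .path .D .I .I), (-3, .path .I .D .I), (-6, .path .I .D .X), (-6, .path .I .X .D),
    (3, .cyc), (12, .path .X .D .D), (6, .path .X .D .J), (-6, .path .X .D .X),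
    (-12, .path .X .X .D), (-12, .path .Y .D .D), (-6, .path .Y .D .I), (-6, .path .Y .D .Y)]),
  ((1, 3, 0, 2), [
    (-6, .star .D .X .X), (12, .star .D .X .Y), (12, .star .D .Y .I), (6, .star .D .Y .Y),
    (-6, .star .X .X .Y), (6, .star .X .Y .Y), (-6, .path .D .X .J), (-6, .path .D .Y .J),
    (-3, .path .I .D .I), (-6, .path .I .X .X), (6, .path .I .X .Y), (3, .cyc),
    (-6, .path .X .D .I), (-6, .path .X .D .X), (6, .path .Y .D .I), (12, .path .Y .D .X),
    (6, .path .Y .D .Y)]),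
  ((1, 3, 2, 0), [
    (-2, .star .D .D .D), (-12, .star .D .D .J), (6, .star .D .D .X), (6, .star .D .D .Y),
    (6, .star .D .X .I), (6, .star .D .X .J), (-18, .star .D .Y .J), (12, .star .D .Y .Y),
    (6, .path .D .I .D), (2, .path .D .I .I), (6, .path .I .D .D), (3, .path .I .D .I),
    (6, .path .I .D .X), (-3, .cyc), (6, .path .X .D .I), (6, .path .X .D .X),
    (12, .path .Y .D .D), (6, .path .Y .D .Y), (-6, .path .Y .I .D)]),
  ((2, 0, 1, 3), [
    (2, .star .D .D .D), (-6, .star .D .D .Y), (-6, .star .D .I .J), (-6, .star .D .X .X),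
    (12, .star .D .X .Y), (-6, .star .D .Y .Y), (-6, .star .X .X .Y), (6, .star .X .Y .Y),
    (6, .path .D .D .I), (-6, .path .D .D .J), (12, .path .D .D .Y), (4, .path .D .I .I),
    (3, .path .I .D .I), (6, .path .I .D .Y), (-6, .path .I .X .X), (6, .path .I .Y .Y),
    (-3, .cyc), (-6, .path .X .D .X), (6, .path .Y .D .Y)]),
  ((2, 0, 3, 1), [
    (18, .star .D .X .I), (-6, .star .D .X .J), (6, .star .D .X .X), (12, .star .D .X .Y),
    (-6, .star .D .Y .J), (-6, .star .D .Y .Y), (6, .path .D .I .I), (-9, .path .I .D .I),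
    (-6, .path .I .D .X), (3, .cyc), (6, .path .X .D .X), (12, .path .X .D .Y),
    (6, .path .X .I .D), (-12, .path .X .X .Y), (-6, .path .Y .D .I), (-6, .path .Y .D .Y),
    (12, .path .Y .Y .X)]),
  ((2, 1, 0, 3), [
    (-4, .star .D .D .D), (6, .star .D .D .I), (12, .star .D .D .X), (-6, .star .D .X .X),
    (6, .star .D .Y .J), (-12, .path .D .D .Y), (-2, .path .D .I .I), (-3, .path .I .D .I),
    (-6, .path .I .D .X), (-6, .path .I .Y .D), (3, .cyc), (12, .path .X .D .D),
    (-12, .path .X .D .I), (6, .path .X .D .J), (-6, .path .X .D .X), (-12, .path .X .X .D),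
    (6, .path .Y .D .I), (-6, .path .Y .D .Y)]),
  ((2, 1, 3, 0), [
    (-2, .star .D .D .D), (-6, .star .D .D .I), (-6, .star .D .D .X), (-6, .star .D .D .Y),
    (6, .star .D .I .I), (12, .star .D .X .I), (-6, .star .D .X .J), (12, .star .D .X .X),
    (-6, .star .D .Y .J), (12, .path .D .D .J), (2, .path .D .I .I), (-6, .path .I .D .D),
    (-3, .path .I .D .I), (-3, .cyc), (-12, .path .X .D .D), (6, .path .X .D .X),
    (6, .path .X .X .I), (-6, .path .X .Y .I), (6, .path .Y .D .Y)]),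
  ((2, 3, 0, 1), [
    (-8, .star .D .D .D), (-6, .star .D .D .I), (12, .star .D .D .X), (-12, .star .D .D .Y),
    (-12, .star .D .X .I), (12, .star .D .X .J), (-12, .star .D .X .X), (12, .path .D .D .D),
    (-4, .path .D .I .I), (12, .path .I .D .D), (6, .path .I .D .I), (-12, .path .X .D .Y),
    (12, .path .X .X .D), (-12, .path .X .X .X), (12, .path .X .X .Y), (-12, .path .Y .Y .D)]),
  ((2, 3, 1, 0), [
    (6, .star .D .D .D), (-6, .star .D .D .X), (6, .star .D .D .Y), (-12, .path .D .D .D),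
    (-6, .path .D .D .I)]),
  ((3, 0, 1, 2), [
    (4, .star .D .D .D), (6, .star .D .D .I), (-12, .star .D .D .X), (12, .star .D .D .Y),
    (-24, .star .D .X .I), (18, .star .D .X .J), (-24, .star .D .X .Y), (6, .star .D .Y .Y),
    (12, .path .D .D .X), (-12, .path .D .D .Y), (-10, .path .D .I .I), (9, .path .I .D .I),
    (6, .path .I .D .X), (6, .path .I .X .D), (3, .cyc), (-6, .path .X .D .X),
    (12, .path .X .X .D), (12, .path .X .X .Y), (6, .path .Y .D .I), (-6, .path .Y .D .J),
    (-6, .path .Y .D .Y), (-12, .path .Y .Y .X)]),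
  ((3, 0, 2, 1), [
    (-2, .star .D .D .D), (6, .star .D .D .I), (12, .star .D .D .X), (-6, .star .D .X .J),
    (-6, .star .D .X .X), (12, .star .D .X .Y), (-12, .path .D .D .X), (2, .path .D .I .I),
    (-6, .path .I .D .D), (3, .path .I .D .I), (6, .path .I .D .X), (6, .path .I .X .D),
    (-3, .cyc), (6, .path .X .D .X), (6, .path .Y .D .I), (-6, .path .Y .D .J),
    (6, .path .Y .D .Y), (12, .path .Y .Y .D)]),
  ((3, 1, 0, 2), [
    (-2, .star .D .D .D), (-6, .star .D .D .I), (-12, .star .D .D .Y), (12, .star .D .X .Y),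
    (-6, .star .D .Y .J), (-6, .star .D .Y .Y), (6, .path .D .D .I), (12, .path .D .D .Y),
    (2, .path .D .I .I), (3, .path .I .D .I), (6, .path .I .D .X), (6, .path .I .X .D),
    (-3, .cyc), (6, .path .X .D .I), (-6, .path .X .D .J), (6, .path .X .D .X),
    (12, .path .X .X .D), (6, .path .Y .D .Y)]),
  ((3, 1, 2, 0), [
    (-4, .star .D .D .D), (-6, .star .D .D .I), (6, .star .D .D .X), (-6, .star .D .D .Y),
    (6, .star .D .X .J), (-6, .star .D .X .X), (-2, .path .D .I .I), (-3, .path .I .D .I),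
    (-6, .path .I .D .X), (-6, .path .I .Y .D), (3, .cyc), (-6, .path .X .D .I),
    (-6, .path .X .D .X), (6, .path .Y .D .J), (-6, .path .Y .D .Y), (-12, .path .Y .Y .D)]),
  ((3, 2, 0, 1), [
    (6, .star .D .D .D), (-12, .star .D .D .X), (12, .star .D .D .Y), (6, .star .D .X .X),
    (-12, .star .D .X .Y), (6, .star .D .Y .Y), (-12, .path .D .D .D), (-6, .path .I .D .D)]),
  -- The decreasing pattern is itself a path of `D` steps, read from right to left.
  ((3, 2, 1, 0), [
    (12, .path .D .D .D)])]

theorem patternFormulas_check : patternFormulas.all (fun f => formulaCheck f.1 f.2) = true := by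
  decide +kernel

theorem exists_patternFormula (σ : Equiv.Perm (Fin 4)) :
    ∃ l, (((σ 0 : ℕ), (σ 1 : ℕ), (σ 2 : ℕ), (σ 3 : ℕ)), l) ∈ patternFormulas := by
  have h : ∀ g ∈ perms4, ∃ f ∈ patternFormulas,
      f.1 = ((g.1 : ℕ), (g.2.1 : ℕ), (g.2.2.1 : ℕ), (g.2.2.2 : ℕ)) := by decide +kernel
  have h' : (σ 0, σ 1, σ 2, σ 3) ∈ perms4 := by
    have : ∀ g : Equiv.Perm (Fin 4), (g 0, g 1, g 2, g 3) ∈ perms4 := by decide +kernel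
    exact this σ
  obtain ⟨f, hf, hk⟩ := h _ h'
  exact ⟨f.2, by rw [← hk]; exact hf⟩

/-! ### Symmetrization and reduction to relative positions -/

theorem symCount_eq (b : Pt → Pt → Pt → Pt → Bool) (z : Fin 4 → Pt) :
    symCount b (z 0) (z 1) (z 2) (z 3) =
      ∑ g : Equiv.Perm (Fin 4), (b (z (g 0)) (z (g 1)) (z (g 2)) (z (g 3))).toNat := by
  rw [sum_perms4 fun i j k l => (b (z i) (z j) (z k) (z l)).toNat]
  simp only [perms4, List.map_cons, List.map_nil, List.sum_cons, List.sum_nil, symCount]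
  ring

/-- Translation by `h` permutes the rearrangements. This allows a quadruple to be sorted before the
certificate is applied to it. -/
theorem symCount_comp (b : Pt → Pt → Pt → Pt → Bool) (z : Fin 4 → Pt) (h : Equiv.Perm (Fin 4)) :
    symCount b (z (h 0)) (z (h 1)) (z (h 2)) (z (h 3)) = symCount b (z 0) (z 1) (z 2) (z 3) := by
  rw [symCount_eq b (fun i => z (h i)), symCount_eq b z]
  exact Equiv.sum_comp (Equiv.mulLeft h) fun g => (b (z (g 0)) (z (g 1)) (z (g 2)) (z (g 3))).toNat

/-- Permuting the four indices is a bijection of the quadruples, so each of the 24 rearrangements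
contributes the same total. -/
theorem sum_symCount {α : Type*} [Fintype α] (b : Pt → Pt → Pt → Pt → Bool) (z : α → Pt) :
    ∑ t : Fin 4 → α, symCount b (z (t 0)) (z (t 1)) (z (t 2)) (z (t 3)) =
      24 * ∑ t : Fin 4 → α, (b (z (t 0)) (z (t 1)) (z (t 2)) (z (t 3))).toNat := by
  simp_rw [fun t : Fin 4 → α => symCount_eq b fun i => z (t i)]
  rw [Finset.sum_comm]
  have h : ∀ g : Equiv.Perm (Fin 4), ∑ t : Fin 4 → α,
      (b (z (t (g 0))) (z (t (g 1))) (z (t (g 2))) (z (t (g 3)))).toNat =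
      ∑ t : Fin 4 → α, (b (z (t 0)) (z (t 1)) (z (t 2)) (z (t 3))).toNat := fun g =>
    Equiv.sum_comp (Equiv.arrowCongr g.symm (Equiv.refl α))
      fun t => (b (z (t 0)) (z (t 1)) (z (t 2)) (z (t 3))).toNat
  rw [Finset.sum_congr rfl fun g _ => h g, Finset.sum_const, Finset.card_univ,
    Fintype.card_perm, Fintype.card_fin, smul_eq_mul]
  rfl

/-- Two quadruples of points are in the same relative position. -/
def SameOrder (z z' : Fin 4 → Pt) : Prop :=
  ∀ i j, Nat.blt (z i).1 (z j).1 = Nat.blt (z' i).1 (z' j).1 ∧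
    Nat.blt (z i).2 (z j).2 = Nat.blt (z' i).2 (z' j).2

/-- All tests are made of strict comparisons of coordinates. Even the equality in `I` is expressed
by two failed comparisons, so it too is determined by the relative position. -/
theorem SameOrder.edge {z z' : Fin 4 → Pt} (h : SameOrder z z') (e : Edge) (i j : Fin 4) :
    e.test (z i) (z j) = e.test (z' i) (z' j) := by
  cases e <;> simp only [Edge.test, (h _ _).1, (h _ _).2]

theorem SameOrder.symCount_term {z z' : Fin 4 → Pt} (h : SameOrder z z') (T : Term) :
    symCount T.test (z 0) (z 1) (z 2) (z 3) = symCount T.test (z' 0) (z' 1) (z' 2) (z' 3) := by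
  rw [symCount_eq, symCount_eq]
  refine Finset.sum_congr rfl fun g _ => ?_
  cases T <;> simp only [Term.test, h.edge, (h _ _).1, (h _ _).2]

theorem SameOrder.symCount_occ {z z' : Fin 4 → Pt} (h : SameOrder z z') (k : ℕ × ℕ × ℕ × ℕ) :
    symCount (occTest k) (z 0) (z 1) (z 2) (z 3) =
      symCount (occTest k) (z' 0) (z' 1) (z' 2) (z' 3) := by
  rw [symCount_eq, symCount_eq]
  refine Finset.sum_congr rfl fun g _ => ?_
  simp only [occTest, (h _ _).1, (h _ _).2]

/-- Coordinates are replaced by their ranks, the numbers of strictly smaller entries. The hypothesis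
on ties, which holds for points of a permutation, makes the ties of the two rank vectors agree. -/
theorem exists_orderType (x y : Fin 4 → ℕ) (hx : Monotone x) (hxy : ∀ i j, x i = x j ↔ y i = y j) :
    ∃ z' : Fin 4 → Pt, SameOrder (fun i => (x i, y i)) z' ∧ (z' 0, z' 1, z' 2, z' 3) ∈ orderTypes := by
  have h01 : x 0 ≤ x 1 := hx (by decide)
  have h12 : x 1 ≤ x 2 := hx (by decide)
  have h23 : x 2 ≤ x 3 := hx (by decide)
  obtain ⟨r, hr, hrx⟩ : ∃ r : Fin 4 → ℕ, (r 0, r 1, r 2, r 3) ∈ sortedRanks ∧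
      ∀ i j, x i < x j ↔ r i < r j := by
    rcases h01.eq_or_lt with e1 | e1 <;> rcases h12.eq_or_lt with e2 | e2 <;>
      rcases h23.eq_or_lt with e3 | e3
    · refine ⟨![0, 0, 0, 0], by decide, fun i j => ?_⟩
      fin_cases i <;> fin_cases j <;> simp <;> omega
    · refine ⟨![0, 0, 0, 3], by decide, fun i j => ?_⟩
      fin_cases i <;> fin_cases j <;> simp <;> omega
    · refine ⟨![0, 0, 2, 2], by decide, fun i j => ?_⟩
      fin_cases i <;> fin_cases j <;> simp <;> omega
    · refine ⟨![0, 0, 2, 3], by decide, fun i j => ?_⟩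
      fin_cases i <;> fin_cases j <;> simp <;> omega
    · refine ⟨![0, 1, 1, 1], by decide, fun i j => ?_⟩
      fin_cases i <;> fin_cases j <;> simp <;> omega
    · refine ⟨![0, 1, 1, 3], by decide, fun i j => ?_⟩
      fin_cases i <;> fin_cases j <;> simp <;> omega
    · refine ⟨![0, 1, 2, 2], by decide, fun i j => ?_⟩
      fin_cases i <;> fin_cases j <;> simp <;> omega
    · refine ⟨![0, 1, 2, 3], by decide, fun i j => ?_⟩
      fin_cases i <;> fin_cases j <;> simp <;> omega
  let c : Fin 4 → Finset (Fin 4) := fun i => Finset.univ.filter fun j => y j < y i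
  have hc : ∀ i, (c i).card < 4 := fun i => by
    have : c i ⊂ Finset.univ := by
      rw [Finset.ssubset_univ_iff]
      intro h
      have : i ∈ c i := h ▸ Finset.mem_univ i
      simp [c] at this
    simpa using Finset.card_lt_card this
  have hlt : ∀ i j, y i < y j → (c i).card < (c j).card := fun i j hij => by
    refine Finset.card_lt_card ⟨fun k hk => ?_, fun h => ?_⟩
    · simp only [c, Finset.mem_filter, Finset.mem_univ, true_and] at hk ⊢
      omega
    · have : i ∈ c i := h (by simp [c, hij])
      simp [c] at this
  let s : Fin 4 → Fin 4 := fun i => ⟨(c i).card, hc i⟩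
  have hs : ∀ i j, y i < y j ↔ s i < s j := fun i j => by
    refine ⟨hlt i j, fun h => ?_⟩
    by_contra h'
    rcases (not_lt.1 h').eq_or_lt with h1 | h1
    · have : c i = c j := by simp only [c, h1]
      simp [s, this] at h
    · exact absurd h (not_lt.2 (hlt j i h1).le)
  have hes : ∀ i j, y i = y j ↔ s i = s j := fun i j => by
    have h1 := hs i j
    have h2 := hs j i
    constructor
    · intro h
      rw [h] at h1 h2
      have a1 : ¬ s i < s j := fun h => lt_irrefl _ (h1.2 h)
      have a2 : ¬ s j < s i := fun h => lt_irrefl _ (h2.2 h)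
      exact le_antisymm (not_lt.1 a2) (not_lt.1 a1)
    · intro h
      rw [h] at h1 h2
      have a1 : ¬ y i < y j := fun h => lt_irrefl _ (h1.1 h)
      have a2 : ¬ y j < y i := fun h => lt_irrefl _ (h2.1 h)
      omega
  have her : ∀ i j, x i = x j ↔ r i = r j := fun i j => by
    have h1 := hrx i j
    have h2 := hrx j i
    omega
  have hes' : ∀ i j, r i = r j ↔ s i = s j := fun i j => by rw [← her, hxy, hes]
  have hcard : ∀ i, (s i).val = ∑ j, (decide (s j < s i)).toNat := fun i => by
    change (c i).card = _
    rw [Finset.card_filter]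
    refine Finset.sum_congr rfl fun j _ => ?_
    by_cases h : y j < y i
    · rw [if_pos h, decide_eq_true ((hs j i).1 h), Bool.toNat_true]
    · rw [if_neg h, decide_eq_false fun h' => h ((hs j i).2 h'), Bool.toNat_false]
  refine ⟨fun i => (r i, s i), fun i j => ⟨?_, ?_⟩, ?_⟩
  · rw [Bool.eq_iff_iff, Nat.blt_eq, Nat.blt_eq]
    exact hrx i j
  · rw [Bool.eq_iff_iff, Nat.blt_eq, Nat.blt_eq]
    exact hs i j
  · have h0 := hcard 0
    have h1 := hcard 1
    have h2 := hcard 2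
    have h3 := hcard 3
    simp only [Fin.sum_univ_four, lt_self_iff_false, decide_false, Bool.toNat_false] at h0 h1 h2 h3
    exact mem_orderTypes _ hr (s 0) (s 1) (s 2) (s 3) (hes' 0 1) (hes' 1 2) (hes' 2 3) (hes' 0 2)
      (hes' 0 3) (hes' 1 3) (by omega) (by omega) (by omega) (by omega)

/-! ### From the pointwise identity to pattern counts -/

/-- The point of a permutation at a position. -/
def permPt {n : ℕ} (π : Equiv.Perm (Fin n)) (i : Fin n) : Pt := (i, π i)

/-- The number of quadruples of points of a permutation that satisfy a test. -/
def tupleCount (b : Pt → Pt → Pt → Pt → Bool) {n : ℕ} (π : Equiv.Perm (Fin n)) : ℕ :=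
  ∑ t : Fin 4 → Fin n,
    (b (permPt π (t 0)) (permPt π (t 1)) (permPt π (t 2)) (permPt π (t 3))).toNat

/-- The definition of an occurrence asks only for implications. As `π` and `σ` are injective, the
implications for both orders of a pair amount to an equivalence, and six comparisons test all of
them. -/
theorem patternCount_eq_tupleCount (σ : Equiv.Perm (Fin 4)) {n : ℕ} (π : Equiv.Perm (Fin n)) :
    patternCount σ π = tupleCount (occTest (σ 0, σ 1, σ 2, σ 3)) π := by
  have key : ∀ t : Fin 4 → Fin n, occTest (σ 0, σ 1, σ 2, σ 3) (permPt π (t 0)) (permPt π (t 1))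
      (permPt π (t 2)) (permPt π (t 3)) = true ↔
      StrictMono t ∧ ∀ j j', π (t j) < π (t j') → σ j < σ j' := by
    intro t
    have hmono : StrictMono t ↔ t 0 < t 1 ∧ t 1 < t 2 ∧ t 2 < t 3 := by
      rw [Fin.strictMono_iff_lt_succ]
      constructor
      · intro h
        exact ⟨h 0, h 1, h 2⟩
      · rintro ⟨h0, h1, h2⟩ i
        fin_cases i
        exacts [h0, h1, h2]
    have hval : ∀ j j', StrictMono t → j ≠ j' → π (t j) ≠ π (t j') := fun j j' h hj he =>
      hj (h.injective (π.injective he))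
    have hσ : ∀ j j', j ≠ j' → σ j ≠ σ j' := fun j j' hj he => hj (σ.injective he)
    have hpair : ∀ a b : ℕ, ∀ c d : ℕ, (Nat.blt a b == Nat.blt c d) = true ↔ (a < b ↔ c < d) := by
      intro a b c d
      rw [beq_iff_eq, Bool.eq_iff_iff, Nat.blt_eq, Nat.blt_eq]
    simp only [occTest, permPt, Bool.and_eq_true, hpair, Nat.blt_eq, Fin.val_fin_lt]
    constructor
    · rintro ⟨⟨⟨⟨⟨⟨⟨⟨a1, a2⟩, a3⟩, b1⟩, b2⟩, b3⟩, b4⟩, b5⟩, b6⟩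
      have hm := hmono.2 ⟨a1, a2, a3⟩
      have main : ∀ j j', j < j' → (π (t j) < π (t j') ↔ σ j < σ j') := by
        intro j j' h
        fin_cases j <;> fin_cases j' <;> first | exact absurd h (by decide) | assumption
      refine ⟨hm, fun j j' h => ?_⟩
      rcases lt_trichotomy j j' with hj | hj | hj
      · exact (main j j' hj).1 h
      · exact absurd h (by rw [hj]; exact lt_irrefl _)
      · have h1 : ¬ σ j' < σ j := fun h' => lt_asymm h ((main j' j hj).2 h')
        exact lt_of_le_of_ne (not_lt.1 h1) (hσ _ _ hj.ne')
    · rintro ⟨hm, h⟩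
      have main : ∀ j j', j ≠ j' → (π (t j) < π (t j') ↔ σ j < σ j') := fun j j' hj =>
        ⟨h j j', fun h' => by
          by_contra h2
          have := lt_of_le_of_ne (not_lt.1 h2) (hval j' j hm hj.symm)
          exact lt_asymm h' (h j' j this)⟩
      have hm' := hmono.1 hm
      exact ⟨⟨⟨⟨⟨⟨⟨⟨hm'.1, hm'.2.1⟩, hm'.2.2⟩, main 0 1 (by decide)⟩, main 0 2 (by decide)⟩,
        main 0 3 (by decide)⟩, main 1 2 (by decide)⟩, main 1 3 (by decide)⟩, main 2 3 (by decide)⟩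
  have e : {i : Fin 4 ↪o Fin n // ∀ j j' : Fin 4, π (i j) < π (i j') → σ j < σ j'} ≃
      {t : Fin 4 → Fin n // occTest (σ 0, σ 1, σ 2, σ 3) (permPt π (t 0)) (permPt π (t 1))
        (permPt π (t 2)) (permPt π (t 3)) = true} :=
    { toFun := fun i => ⟨i.1, (key _).2 ⟨i.1.strictMono, i.2⟩⟩
      invFun := fun t => ⟨OrderEmbedding.ofStrictMono t.1 ((key _).1 t.2).1, ((key _).1 t.2).2⟩
      left_inv := fun i => by ext; rfl
      right_inv := fun t => by ext; rfl }
  rw [patternCount, Nat.card_congr e, Nat.card_eq_fintype_card, Fintype.card_subtype,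
    Finset.card_filter, tupleCount]
  refine Finset.sum_congr rfl fun t _ => ?_
  cases occTest (σ 0, σ 1, σ 2, σ 3) (permPt π (t 0)) (permPt π (t 1)) (permPt π (t 2))
    (permPt π (t 3)) <;> rfl

/-- Each quadruple is sorted by position and matched with its relative position, where the
certificate applies. Summation over all quadruples gives a factor 24 on both sides, which cancels.
-/
theorem exists_tupleCount_formula (σ : Equiv.Perm (Fin 4)) :
    ∃ l : List (ℤ × Term), ∀ (n : ℕ) (π : Equiv.Perm (Fin n)),
      (12 * patternCount σ π : ℤ) = (l.map fun c => c.1 * (tupleCount c.2.test π : ℤ)).sum := by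
  obtain ⟨l, hl⟩ := exists_patternFormula σ
  refine ⟨l, fun n π => ?_⟩
  have hcheck := List.all_eq_true.1 patternFormulas_check _ hl
  simp only [formulaCheck, List.all_eq_true, decide_eq_true_eq] at hcheck
  have point : ∀ t : Fin 4 → Fin n,
      (l.map fun c => c.1 * (symCount c.2.test (permPt π (t 0)) (permPt π (t 1)) (permPt π (t 2))
        (permPt π (t 3)) : ℤ)).sum = 12 * (symCount (occTest (σ 0, σ 1, σ 2, σ 3))
        (permPt π (t 0)) (permPt π (t 1)) (permPt π (t 2)) (permPt π (t 3)) : ℤ) := by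
    intro t
    have hx : Monotone fun i => ((t (Tuple.sort t i) : Fin n) : ℕ) := fun i j h =>
      Tuple.monotone_sort t h
    obtain ⟨z', hz, hmem⟩ := exists_orderType (fun i => ((t (Tuple.sort t i) : Fin n) : ℕ))
      (fun i => ((π (t (Tuple.sort t i)) : Fin n) : ℕ)) hx fun i j => by
        simp only [Fin.val_inj, EmbeddingLike.apply_eq_iff_eq]
    have h1 := hcheck _ hmem
    rw [← hz.symCount_occ] at h1
    simp only [← hz.symCount_term] at h1
    have h2 := fun b => symCount_comp b (fun i => permPt π (t i)) (Tuple.sort t)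
    simp only [permPt] at h2 ⊢
    simp only [h2] at h1
    exact h1
  have h24 : ∀ b, (∑ t : Fin 4 → Fin n, (symCount b (permPt π (t 0)) (permPt π (t 1))
      (permPt π (t 2)) (permPt π (t 3)) : ℤ)) = 24 * (tupleCount b π : ℤ) := fun b => by
    rw [tupleCount, ← Nat.cast_sum, sum_symCount b (permPt π)]
    push_cast
    rfl
  have hsum := Finset.sum_congr (rfl : (Finset.univ : Finset (Fin 4 → Fin n)) = Finset.univ)
    fun t _ => point t
  rw [← Finset.mul_sum, h24, ← patternCount_eq_tupleCount] at hsum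
  have hlist : ∀ l : List (ℤ × Term), ∑ t : Fin 4 → Fin n, (l.map fun c => c.1 * (symCount c.2.test
      (permPt π (t 0)) (permPt π (t 1)) (permPt π (t 2)) (permPt π (t 3)) : ℤ)).sum =
      24 * (l.map fun c => c.1 * (tupleCount c.2.test π : ℤ)).sum := by
    intro l
    induction l with
    | nil => simp
    | cons a l ih =>
      simp only [List.map_cons, List.sum_cons, Finset.sum_add_distrib, ih, ← Finset.mul_sum, h24]
      ring
  rw [hlist] at hsum
  linarith

/-! ### Tree sums and the cycle sum by linear operators -/

section

open Finset

/-- The functions `p` and `q` restrict to mutually inverse permutations of the numbers below `n`. -/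
structure InvPair (n : ℕ) (p q : ℕ → ℕ) : Prop where
  p_lt : ∀ i < n, p i < n
  q_lt : ∀ i < n, q i < n
  pq : ∀ i < n, p (q i) = i
  qp : ∀ i < n, q (p i) = i

theorem InvPair.sum_q {n : ℕ} {p q : ℕ → ℕ} (h : InvPair n p q) {M : Type*} [AddCommMonoid M]
    (g : ℕ → M) : ∑ y ∈ range n, g (q y) = ∑ c ∈ range n, g c :=
  Finset.sum_nbij' q p (fun y hy => mem_range.2 (h.q_lt y (mem_range.1 hy)))
    (fun y hy => mem_range.2 (h.p_lt y (mem_range.1 hy))) (fun y hy => h.pq y (mem_range.1 hy))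
    (fun y hy => h.qp y (mem_range.1 hy)) fun _ _ => rfl

theorem InvPair.p_inj {n : ℕ} {p q : ℕ → ℕ} (h : InvPair n p q) {i j : ℕ} (hi : i < n) (hj : j < n)
    (e : p i = p j) : i = j := by
  rw [← h.qp i hi, e, h.qp j hj]

theorem InvPair.q_inj {n : ℕ} {p q : ℕ → ℕ} (h : InvPair n p q) {i j : ℕ} (hi : i < n) (hj : j < n)
    (e : q i = q j) : i = j := by
  rw [← h.pq i hi, e, h.pq j hj]

section Operators

variable {R : Type*} [CommRing R]

/-- The linear operator that sums a vector over all the points in relation `e` to a point. -/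
def Edge.app (n : ℕ) (p : ℕ → ℕ) (e : Edge) (v : ℕ → R) (i : ℕ) : R :=
  ∑ j ∈ range n, if e.test (i, p i) (j, p j) then v j else 0

theorem sum_fin_four {n : ℕ} (f : Fin n → Fin n → Fin n → Fin n → R) :
    ∑ t : Fin 4 → Fin n, f (t 0) (t 1) (t 2) (t 3) =
      ∑ a, ∑ b, ∑ c, ∑ d, f a b c d := by
  rw [← (Fin.consEquiv fun _ : Fin 4 => Fin n).sum_comp, Fintype.sum_prod_type]
  refine sum_congr rfl fun a _ => ?_
  rw [← (Fin.consEquiv fun _ : Fin 3 => Fin n).sum_comp, Fintype.sum_prod_type]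
  refine sum_congr rfl fun b _ => ?_
  rw [← (Fin.consEquiv fun _ : Fin 2 => Fin n).sum_comp, Fintype.sum_prod_type]
  refine sum_congr rfl fun c _ => ?_
  rw [← (Fin.consEquiv fun _ : Fin 1 => Fin n).sum_comp, Fintype.sum_prod_type]
  refine sum_congr rfl fun d _ => ?_
  rw [Fintype.sum_unique]
  rfl

/-- Stated over an arbitrary commutative ring because the machine works in `ZMod (2 ^ w)`. -/
theorem tupleCount_cast (b : Pt → Pt → Pt → Pt → Bool) {n : ℕ} (π : Equiv.Perm (Fin n))
    {p : ℕ → ℕ} (hp : ∀ i : Fin n, p i = π i) :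
    (tupleCount b π : R) = ∑ i ∈ range n, ∑ j ∈ range n, ∑ k ∈ range n, ∑ l ∈ range n,
      if b (i, p i) (j, p j) (k, p k) (l, p l) then 1 else 0 := by
  rw [tupleCount, Nat.cast_sum, sum_fin_four fun i j k l => (((b (permPt π i) (permPt π j)
    (permPt π k) (permPt π l)).toNat : ℕ) : R)]
  simp only [Finset.sum_range, hp, permPt]
  refine sum_congr rfl fun i _ => sum_congr rfl fun j _ => sum_congr rfl fun k _ =>
    sum_congr rfl fun l _ => ?_
  cases b (i, π i) (j, π j) (k, π k) (l, π l) <;> simp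

/-- A path is evaluated from its far end: each relation passes to a point the sum of what has
accumulated at its predecessors. -/
theorem tupleCount_path (e₁ e₂ e₃ : Edge) {n : ℕ} (π : Equiv.Perm (Fin n))
    {p : ℕ → ℕ} (hp : ∀ i : Fin n, p i = π i) :
    (tupleCount (Term.path e₁ e₂ e₃).test π : R) =
      ∑ i ∈ range n, e₁.app n p (e₂.app n p (e₃.app n p fun _ => 1)) i := by
  rw [tupleCount_cast _ π hp]
  refine sum_congr rfl fun i _ => sum_congr rfl fun j _ => ?_
  simp only [Edge.app, Term.test, Bool.and_eq_true]
  by_cases h1 : e₁.test (i, p i) (j, p j) = true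
  · simp only [h1, true_and, if_true]
    refine sum_congr rfl fun k _ => ?_
    by_cases h2 : e₂.test (j, p j) (k, p k) = true <;> simp [h2]
  · simp [h1]

/-- Once the centre is fixed, the three leaves are chosen independently. -/
theorem tupleCount_star (e₁ e₂ e₃ : Edge) {n : ℕ} (π : Equiv.Perm (Fin n))
    {p : ℕ → ℕ} (hp : ∀ i : Fin n, p i = π i) :
    (tupleCount (Term.star e₁ e₂ e₃).test π : R) =
      ∑ i ∈ range n, e₁.app n p (fun _ => 1) i * e₂.app n p (fun _ => 1) i *
        e₃.app n p (fun _ => 1) i := by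
  rw [tupleCount_cast _ π hp]
  refine sum_congr rfl fun i _ => ?_
  simp only [Edge.app, Term.test, Bool.and_eq_true]
  rw [sum_mul_sum, sum_mul]
  refine sum_congr rfl fun j _ => ?_
  rw [sum_mul]
  refine sum_congr rfl fun k _ => ?_
  rw [mul_sum]
  refine sum_congr rfl fun l _ => ?_
  by_cases h1 : e₁.test (i, p i) (j, p j) = true <;>
  by_cases h2 : e₂.test (i, p i) (k, p k) = true <;>
  by_cases h3 : e₃.test (i, p i) (l, p l) = true <;> simp [h1, h2, h3]

/-! ### Block decomposition of the cycle sum -/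

/-- Sums over the earlier positions, where the positions in the same block of length `m` count
twice if `α = 1`. -/
def blockScan (m : ℕ) (α : R) (v : ℕ → R) (i : ℕ) : R :=
  ∑ j ∈ range i, (1 + if j / m = i / m then α else 0) * v j

/-- The contribution to the cycle sum of the quadruples whose second point is in the block `β` and
whose first point is in an earlier block. -/
def coarseSum (n : ℕ) (p : ℕ → ℕ) (m β : ℕ) : R :=
  ∑ a ∈ range n, if a / m < β then
    Edge.Y.app n p (blockScan m 1 (Edge.Y.app n p fun b => if b / m = β then 1 else 0)) a else 0

/-- The number of pairs of positions `u < q y'` in a block with `y' < y` and the value at `u` being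
larger than `x`. -/
def fineWeight (n : ℕ) (p q : ℕ → ℕ) (m y x : ℕ) : R :=
  ∑ y' ∈ range y, ∑ u ∈ range n, if u / m = q y' / m ∧ u < q y' ∧ x < p u then 1 else 0

/-- The weight of the positions in a block to the right of the one with value `y`. -/
def fineSum (n : ℕ) (p q : ℕ → ℕ) (m y : ℕ) : R :=
  ∑ d ∈ range n, if d / m = q y / m ∧ q y < d then fineWeight n p q m y (p d) else 0

theorem sum_range_eq_ite {n i : ℕ} (hi : i ≤ n) (f : ℕ → R) :
    ∑ j ∈ range i, f j = ∑ j ∈ range n, if j < i then f j else 0 := by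
  rw [← sum_filter]
  refine sum_congr ?_ fun _ _ => rfl
  ext j
  simp only [mem_range, mem_filter]
  omega

/-- Write `X = F + C`, where `F` compares within a block and `C` between blocks. Then `X a b * X c
d` is `C a b * X c d + F a b * C c d + F a b * F c d`. Rotating the cycle turns the middle sum into
that of `C a b * F c d`, so the first two terms combine to `C a b * (X c d + F c d)`: positions in
the same block count twice, as in `blockScan` with `α = 1`. The bound on `n` ensures that the block
indices are below `m`. -/
theorem cycleSum_eq {n m : ℕ} {p q : ℕ → ℕ} (h : InvPair n p q) (hm : n ≤ m * m) :
    (∑ a ∈ range n, ∑ b ∈ range n, ∑ c ∈ range n, ∑ d ∈ range n,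
      if Term.cyc.test (a, p a) (b, p b) (c, p c) (d, p d) then (1 : R) else 0) =
    ∑ β ∈ range m, coarseSum n p m β + ∑ y ∈ range n, fineSum n p q m y := by
  let Y : ℕ → ℕ → R := fun a b => if p a < p b then 1 else 0
  let X : ℕ → ℕ → R := fun a b => if a < b then 1 else 0
  let F : ℕ → ℕ → R := fun a b => if a / m = b / m ∧ a < b then 1 else 0
  let C : ℕ → ℕ → R := fun a b => if a / m < b / m then 1 else 0
  have hX : ∀ a b, X a b = F a b + C a b := fun a b => by
    simp only [X, F, C]
    have := @Nat.div_le_div_right a b m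
    have := @Nat.div_le_div_right b a m
    split_ifs <;> first | simp; done | omega
  have hS : (∑ a ∈ range n, ∑ b ∈ range n, ∑ c ∈ range n, ∑ d ∈ range n,
      if Term.cyc.test (a, p a) (b, p b) (c, p c) (d, p d) then (1 : R) else 0) =
      ∑ a ∈ range n, ∑ b ∈ range n, ∑ c ∈ range n, ∑ d ∈ range n,
        X a b * Y b c * X c d * Y d a := by
    refine sum_congr rfl fun a _ => sum_congr rfl fun b _ => sum_congr rfl fun c _ =>
      sum_congr rfl fun d _ => ?_
    simp only [Term.test, Bool.and_eq_true, Nat.blt_eq, X, Y]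
    split_ifs <;> first | simp; done | tauto
  have hsplit : ∀ a b c d, X a b * Y b c * X c d * Y d a =
      C a b * Y b c * X c d * Y d a + C c d * Y d a * F a b * Y b c +
        F a b * Y b c * F c d * Y d a := fun a b c d => by
    rw [hX a b, hX c d]
    ring
  -- Rotation by two steps, carried out by exchanging sums.
  have hswap : (∑ a ∈ range n, ∑ b ∈ range n, ∑ c ∈ range n, ∑ d ∈ range n,
      C c d * Y d a * F a b * Y b c) = ∑ a ∈ range n, ∑ b ∈ range n, ∑ c ∈ range n,
        ∑ d ∈ range n, C a b * Y b c * F c d * Y d a := by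
    rw [sum_congr rfl fun a _ => sum_comm, sum_comm]
    refine sum_congr rfl fun c _ => ?_
    rw [sum_congr rfl fun a _ => sum_comm, sum_comm]
  have hcoarse : (∑ β ∈ range m, coarseSum n p m β : R) = ∑ a ∈ range n, ∑ b ∈ range n,
      ∑ c ∈ range n, ∑ d ∈ range n,
        (C a b * Y b c * X c d * Y d a + C a b * Y b c * F c d * Y d a) := by
    have h1 : ∀ β a : ℕ, (if a / m < β then
        Edge.Y.app n p (blockScan m 1 (Edge.Y.app n p fun b => if b / m = β then 1 else 0)) a
        else (0 : R)) = ∑ b ∈ range n, ∑ c ∈ range n, ∑ d ∈ range n,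
          (if a / m < β then (if b / m = β then 1 else 0) else 0) *
            (Y b c * (X c d + F c d) * Y d a) := by
      intro β a
      rw [sum_comm, sum_congr rfl fun c _ => sum_comm, sum_comm]
      split_ifs with hβ
      · refine sum_congr rfl fun d hd => ?_
        simp only [Edge.test, Nat.blt_eq]
        by_cases hda : p d < p a
        · simp only [hda, if_true, Y, mul_one]
          rw [blockScan, sum_range_eq_ite (mem_range.1 hd).le]
          refine sum_congr rfl fun c _ => ?_
          simp only [Edge.app, Edge.test, Nat.blt_eq, mul_sum, X, F]
          by_cases hcd : c < d
          · simp only [hcd, if_true, and_true]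
            refine sum_congr rfl fun b _ => ?_
            split_ifs <;> ring
          · simp [hcd]
        · simp [hda, Y]
      · simp
    simp only [coarseSum, h1]
    rw [sum_comm]
    refine sum_congr rfl fun a _ => ?_
    rw [sum_comm]
    refine sum_congr rfl fun b hb => ?_
    rw [sum_comm]
    refine sum_congr rfl fun c _ => ?_
    rw [sum_comm]
    refine sum_congr rfl fun d _ => ?_
    rw [← sum_mul]
    have hbm : b / m ∈ range m := mem_range.2
      (Nat.div_lt_of_lt_mul (lt_of_lt_of_le (mem_range.1 hb) hm))
    -- Only the block `β` that contains `b` contributes.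
    have h2 : (∑ β ∈ range m, if a / m < β then (if b / m = β then (1 : R) else 0) else 0) =
        C a b := by
      rw [sum_eq_single_of_mem (b / m) hbm]
      · simp [C]
      · intro β _ hβ
        simp [hβ.symm]
    rw [h2]
    ring
  have hfine : (∑ y ∈ range n, fineSum n p q m y : R) = ∑ a ∈ range n, ∑ b ∈ range n,
      ∑ c ∈ range n, ∑ d ∈ range n, F a b * Y b c * F c d * Y d a := by
    -- The substitution `b = q y'` turns the smaller values `y'` into the positions `b` of points
    -- below `q y`.
    have h1 : ∀ y ∈ range n, ∀ x, (fineWeight n p q m y x : R) =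
        ∑ b ∈ range n, ∑ a ∈ range n, F a b * (if p b < p (q y) then 1 else 0) *
          (if x < p a then 1 else 0) := by
      intro y hy x
      rw [fineWeight, sum_range_eq_ite (mem_range.1 hy).le,
        ← h.sum_q fun b => ∑ a ∈ range n, F a b * (if p b < p (q y) then (1 : R) else 0) *
          (if x < p a then 1 else 0)]
      refine sum_congr rfl fun y' hy' => ?_
      rw [h.pq _ (mem_range.1 hy), h.pq _ (mem_range.1 hy')]
      split_ifs with hlt
      · refine sum_congr rfl fun a _ => ?_
        simp only [F]
        split_ifs <;> first | simp; done | tauto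
      · simp
    have h2 : ∀ y ∈ range n, (fineSum n p q m y : R) = (fun c => ∑ d ∈ range n, ∑ b ∈ range n,
        ∑ a ∈ range n, F a b * Y b c * F c d * Y d a) (q y) := by
      intro y hy
      refine sum_congr rfl fun d _ => ?_
      rw [h1 y hy]
      split_ifs with hd
      · refine sum_congr rfl fun b _ => sum_congr rfl fun a _ => ?_
        have : F (q y) d = 1 := if_pos ⟨hd.1.symm, hd.2⟩
        rw [this]
        simp only [Y, mul_one]
      · have : F (q y) d = 0 := if_neg fun h' => hd ⟨h'.1.symm, h'.2⟩
        simp [this]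
    rw [sum_congr rfl h2]
    refine (h.sum_q fun c => ∑ d ∈ range n, ∑ b ∈ range n, ∑ a ∈ range n,
      F a b * Y b c * F c d * Y d a).trans ?_
    rw [sum_congr rfl fun c _ => sum_comm, sum_comm,
      sum_congr rfl fun b _ => sum_congr rfl fun c _ => sum_comm,
      sum_congr rfl fun b _ => sum_comm, sum_comm]
  rw [hS]
  simp only [hsplit, sum_add_distrib]
  rw [hswap, hcoarse, hfine]
  simp only [sum_add_distrib]

end Operators

end

/-! ### Rules for reasoning about programs -/

namespace WordRAM

/-- The state after a register has been set. -/
def State.setReg (s : State) (x v : ℕ) : State := { s with reg := Function.update s.reg x v }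

/-- The state after a memory cell has been set. -/
def State.setMem (s : State) (a v : ℕ) : State := { s with mem := Function.update s.mem a v }

@[simp] theorem State.reg_setReg (s : State) (x v y : ℕ) :
    (s.setReg x v).reg y = if y = x then v else s.reg y := by
  simp [State.setReg, Function.update_apply]

@[simp] theorem State.mem_setReg (s : State) (x v : ℕ) : (s.setReg x v).mem = s.mem := rfl

@[simp] theorem State.reg_setMem (s : State) (a v : ℕ) : (s.setMem a v).reg = s.reg := rfl

@[simp] theorem State.mem_setMem (s : State) (a v b : ℕ) :
    (s.setMem a v).mem b = if b = a then v else s.mem b := by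
  simp [State.setMem, Function.update_apply]

instance : Add Expr := ⟨Expr.op .add⟩
instance : Mul Expr := ⟨Expr.op .mul⟩
instance : Div Expr := ⟨Expr.op .div⟩
instance : Mod Expr := ⟨Expr.op .mod⟩

/-- The test whether the first expression has the smaller value. -/
def Expr.less (a b : Expr) : Expr := .op .lt a b

/-- The test whether two expressions have the same value. -/
def Expr.same (a b : Expr) : Expr := .op .eq a b

section Eval

variable (w : ℕ) (s : State)

@[simp] theorem Expr.eval_add (a b : Expr) :
    (a + b).eval w s = (a.eval w s + b.eval w s) % 2 ^ w := rfl
@[simp] theorem Expr.eval_mul (a b : Expr) :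
    (a * b).eval w s = (a.eval w s * b.eval w s) % 2 ^ w := rfl
@[simp] theorem Expr.eval_div (a b : Expr) : (a / b).eval w s = a.eval w s / b.eval w s := rfl
@[simp] theorem Expr.eval_mod (a b : Expr) : (a % b).eval w s = a.eval w s % b.eval w s := rfl
@[simp] theorem Expr.eval_less (a b : Expr) :
    (a.less b).eval w s = if a.eval w s < b.eval w s then 1 else 0 := rfl
@[simp] theorem Expr.eval_same (a b : Expr) :
    (a.same b).eval w s = if a.eval w s = b.eval w s then 1 else 0 := rfl
@[simp] theorem Expr.eval_reg (x : ℕ) : (Expr.reg x).eval w s = s.reg x := rfl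
@[simp] theorem Expr.eval_const (c : ℕ) : (Expr.const c).eval w s = c % 2 ^ w := rfl
@[simp] theorem Expr.cost_add (a b : Expr) : (a + b).cost = a.cost + b.cost + 1 := rfl
@[simp] theorem Expr.cost_mul (a b : Expr) : (a * b).cost = a.cost + b.cost + 1 := rfl
@[simp] theorem Expr.cost_div (a b : Expr) : (a / b).cost = a.cost + b.cost + 1 := rfl
@[simp] theorem Expr.cost_mod (a b : Expr) : (a % b).cost = a.cost + b.cost + 1 := rfl
@[simp] theorem Expr.cost_less (a b : Expr) : (a.less b).cost = a.cost + b.cost + 1 := rfl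
@[simp] theorem Expr.cost_same (a b : Expr) : (a.same b).cost = a.cost + b.cost + 1 := rfl
@[simp] theorem Expr.cost_reg (x : ℕ) : (Expr.reg x).cost = 1 := rfl
@[simp] theorem Expr.cost_const (c : ℕ) : (Expr.const c).cost = 1 := rfl

end Eval

/-- Started in the state `s`, the program `p` halts after at most `T` steps in a state that
satisfies `Q`. -/
def Ends (w S : ℕ) (p : Prog) (s : State) (T : ℕ) (Q : State → Prop) : Prop :=
  ∃ t s', Exec w S p s t s' ∧ t ≤ T ∧ Q s'

section Rules

variable {w S : ℕ} {p p' : Prog} {s : State} {T T' : ℕ} {Q Q' : State → Prop}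

theorem Ends.mono (h : Ends w S p s T Q) (hT : T ≤ T') (hQ : ∀ s, Q s → Q' s) :
    Ends w S p s T' Q' := by
  obtain ⟨t, s', he, ht, hq⟩ := h
  exact ⟨t, s', he, ht.trans hT, hQ _ hq⟩

theorem Ends.le (h : Ends w S p s T Q) (hT : T ≤ T') : Ends w S p s T' Q := h.mono hT fun _ h => h

theorem Ends.imp (h : Ends w S p s T Q) (hQ : ∀ s, Q s → Q' s) : Ends w S p s T Q' :=
  h.mono le_rfl hQ

theorem Ends.skip (h : Q s) : Ends w S .skip s 1 Q := ⟨_, _, .skip s, le_rfl, h⟩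

theorem Ends.assign {x : ℕ} {e : Expr} (h : Q (s.setReg x (e.eval w s))) :
    Ends w S (.assign x e) s (e.cost + 1) Q := ⟨_, _, .assign x e s, le_rfl, h⟩

theorem Ends.load {x : ℕ} {a : Expr} (ha : a.eval w s < S)
    (h : Q (s.setReg x (s.mem (a.eval w s)))) :
    Ends w S (.load x a) s (a.cost + 1) Q := ⟨_, _, .load x a s ha, le_rfl, h⟩

theorem Ends.store {a e : Expr} (ha : a.eval w s < S)
    (h : Q (s.setMem (a.eval w s) (e.eval w s))) :
    Ends w S (.store a e) s (a.cost + e.cost + 1) Q := ⟨_, _, .store a e s ha, le_rfl, h⟩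

theorem Ends.seq (h : Ends w S p s T fun s' => Ends w S p' s' T' Q) :
    Ends w S (.seq p p') s (T + T') Q := by
  obtain ⟨t, s', he, ht, t', s'', he', ht', hq⟩ := h
  exact ⟨_, _, .seq he he', Nat.add_le_add ht ht', hq⟩

theorem Ends.ite {e : Expr} (h1 : e.eval w s ≠ 0 → Ends w S p s T Q)
    (h2 : e.eval w s = 0 → Ends w S p' s T Q) : Ends w S (.ite e p p') s (e.cost + 1 + T) Q := by
  by_cases h : e.eval w s = 0
  · obtain ⟨t, s', he, ht, hq⟩ := h2 h
    exact ⟨_, _, .ite_false h he, Nat.add_le_add_left ht _, hq⟩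
  · obtain ⟨t, s', he, ht, hq⟩ := h1 h
    exact ⟨_, _, .ite_true h he, Nat.add_le_add_left ht _, hq⟩

/-- Indexing the invariant by the number of completed rounds yields termination, the exact number of
rounds and the time bound in one induction. -/
theorem Ends.while {e : Expr} (I : ℕ → State → Prop) (K : ℕ) (h0 : I 0 s)
    (hstep : ∀ k < K, ∀ s, I k s → e.eval w s ≠ 0 ∧ Ends w S p s T (I (k + 1)))
    (hend : ∀ s, I K s → e.eval w s = 0) :
    Ends w S (.while e p) s (K * (e.cost + 1 + T) + (e.cost + 1)) (I K) := by
  have main : ∀ d k, k + d = K → ∀ s, I k s →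
      Ends w S (.while e p) s (d * (e.cost + 1 + T) + (e.cost + 1)) (I K) := by
    intro d
    induction d with
    | zero =>
      intro k hk s hs
      obtain rfl : k = K := by omega
      exact ⟨_, _, .while_false (hend s hs), by omega, hs⟩
    | succ d ih =>
      intro k hk s hs
      obtain ⟨he, t, s', hexec, ht, hI⟩ := hstep k (by omega) s hs
      obtain ⟨t', s'', hexec', ht', hI'⟩ := ih (k + 1) (by omega) s' hI
      refine ⟨_, _, .while_true he hexec hexec', ?_, hI'⟩
      rw [Nat.add_mul]
      omega
  exact main K 0 (Nat.zero_add K) s h0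

/-- Run `p` for the values `0, 1, …` of the register `x` that are below `e`. -/
def Prog.forLoop (x : ℕ) (e : Expr) (p : Prog) : Prog :=
  .seq (.assign x (.const 0))
    (.while ((Expr.reg x).less e) (.seq p (.assign x (.reg x + .const 1))))

/-- The body has to preserve the counter, and the next invariant is required after the increment.
The bound on `K` prevents the counter from wrapping around. -/
theorem Ends.forLoop {x : ℕ} {e : Expr} (I : ℕ → State → Prop) (K : ℕ) (hK : K < 2 ^ w)
    (he : ∀ k s, I k s → e.eval w s = K) (h0 : I 0 (s.setReg x 0))
    (hx : ∀ k s, I k s → s.reg x = k)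
    (hstep : ∀ k < K, ∀ s, I k s → Ends w S p s T fun s' => s'.reg x = k ∧
      I (k + 1) (s'.setReg x (k + 1))) :
    Ends w S (.forLoop x e p) s (K * (e.cost + T + 8) + (e.cost + 5)) (I K) := by
  have h := Ends.while (w := w) (S := S) (s := s.setReg x 0) (e := (Expr.reg x).less e)
    (p := .seq p (.assign x (.reg x + .const 1))) (T := T + 4) I K h0 (fun k hk s hs => by
      constructor
      · rw [Expr.eval_less, he k s hs, Expr.eval_reg, hx k s hs, if_pos hk]
        exact one_ne_zero
      · refine Ends.seq ((hstep k hk s hs).imp fun s' hs' => ?_)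
        refine Ends.assign ?_
        rw [Expr.eval_add, Expr.eval_reg, Expr.eval_const, hs'.1, Nat.add_mod_mod,
          Nat.mod_eq_of_lt (by omega)]
        exact hs'.2) (fun s hs => by
      rw [Expr.eval_less, he K s hs, Expr.eval_reg, hx K s hs, if_neg (lt_irrefl K)])
  refine Ends.le (Ends.seq (T' := K * (((Expr.reg x).less e).cost + 1 + (T + 4)) +
    (((Expr.reg x).less e).cost + 1)) (Ends.assign ?_)) ?_
  · rwa [Expr.eval_const, Nat.zero_mod]
  · simp only [Expr.cost_const, Expr.cost_less, Expr.cost_reg]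
    have : 1 + e.cost + 1 + 1 + (T + 4) ≤ e.cost + T + 8 := by omega
    have := Nat.mul_le_mul_left K this
    omega

end Rules

/-! ### A binary tree for suffix sums -/

/-- Add register `13` to the weight of the leaf given by register `10`. -/
def treeUpdate : Prog :=
  .seq (.assign 7 (.reg 2 + .reg 10))
    (.while (.reg 7)
      (.seq (.load 9 (.const 2 * .reg 1 + .reg 7))
      (.seq (.store (.const 2 * .reg 1 + .reg 7) (.reg 9 + .reg 13))
      (.assign 7 (.reg 7 / .const 2)))))

/-- Put the total weight of the leaves to the right of the one given by register `10` into
register `8`. -/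
def treeQuery : Prog :=
  .seq (.assign 7 (.reg 2 + .reg 10))
    (.seq (.assign 8 (.const 0))
    (.while ((Expr.const 1).less (.reg 7))
      (.seq (.load 9 (.const 2 * .reg 1 + (.reg 7 + .const 1)))
      (.seq (.assign 8 (.reg 8 + .reg 9 * (.same (.reg 7 % .const 2) (.const 0))))
      (.assign 7 (.reg 7 / .const 2))))))

/-- The memory cells from `B` on represent a complete binary tree with `2 ^ l` leaves of weights
`A`. -/
def IsTree (w l B : ℕ) (A : ℕ → ZMod (2 ^ w)) (mem : ℕ → ℕ) : Prop :=
  ∀ h ≤ l, ∀ k < 2 ^ l, (mem (B + (2 ^ l + k) / 2 ^ h) : ZMod (2 ^ w)) =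
    ∑ j ∈ Finset.range (2 ^ l), if (2 ^ l + j) / 2 ^ h = (2 ^ l + k) / 2 ^ h then A j else 0

/-- The tree is laid out as a heap: leaf `k` is node `2 ^ l + k`, halving leads to the parent, and
the nodes at height `h` occupy the interval from `2 ^ (l - h)` to `2 ^ (l - h + 1) - 1`. -/
theorem ancestor_bounds {l k h : ℕ} (hk : k < 2 ^ l) (hh : h ≤ l) :
    2 ^ (l - h) ≤ (2 ^ l + k) / 2 ^ h ∧ (2 ^ l + k) / 2 ^ h < 2 ^ (l - h + 1) := by
  have e : 2 ^ (l - h) * 2 ^ h = 2 ^ l := by rw [← pow_add, Nat.sub_add_cancel hh]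
  constructor
  · rw [Nat.le_div_iff_mul_le (by positivity), e]
    omega
  · rw [Nat.div_lt_iff_lt_mul (by positivity), pow_succ, mul_right_comm, e]
    omega

/-- The intervals of node numbers at different heights are disjoint. Hence changing a node affects
the sums at one height only. -/
theorem ancestor_level {l k k' h h' : ℕ} (hk : k < 2 ^ l) (hk' : k' < 2 ^ l) (hh : h ≤ l)
    (hh' : h' ≤ l) (e : (2 ^ l + k) / 2 ^ h = (2 ^ l + k') / 2 ^ h') : h = h' := by
  have b := ancestor_bounds hk hh
  have b' := ancestor_bounds hk' hh'
  have h1 : l - h < l - h' + 1 :=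
    (Nat.pow_lt_pow_iff_right (by norm_num : 1 < 2)).1 (b.1.trans_lt (e ▸ b'.2))
  have h2 : l - h' < l - h + 1 :=
    (Nat.pow_lt_pow_iff_right (by norm_num : 1 < 2)).1 (b'.1.trans_lt (e ▸ b.2))
  omega

/-- The registers and sizes on which the tree programs depend. -/
structure TreeRegs (w S l : ℕ) (s : State) : Prop where
  reg1 : s.reg 1 = 2 * 2 ^ l
  reg2 : s.reg 2 = 2 ^ l
  word : 12 * 2 ^ l < 2 ^ w
  space : 12 * 2 ^ l ≤ S

theorem two_mod_two_pow {w l : ℕ} (h : 12 * 2 ^ l < 2 ^ w) (c : ℕ) (hc : c ≤ 12) :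
    c % 2 ^ w = c := by
  have := Nat.one_le_two_pow (n := l)
  exact Nat.mod_eq_of_lt (by omega)

/-- Round `t` of the walk from the leaf to the root corrects the ancestor at height `t`; the
invariant says that exactly the heights below `t` include the new weight. Halving the root gives
`0`, which stops the walk after `l + 1` rounds. -/
theorem treeUpdate_ends {w S l k : ℕ} {A : ℕ → ZMod (2 ^ w)} {s : State} (hs : TreeRegs w S l s)
    (hk : k < 2 ^ l) (h10 : s.reg 10 = k) (hA : IsTree w l (4 * 2 ^ l) A s.mem) :
    Ends w S treeUpdate s (22 * (l + 1) + 6) fun s' =>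
      IsTree w l (4 * 2 ^ l) (fun j => A j + if j = k then (s.reg 13 : ZMod (2 ^ w)) else 0) s'.mem ∧
      (∀ x, x ≠ 7 → x ≠ 9 → s'.reg x = s.reg x) ∧
      (∀ a, a < 4 * 2 ^ l ∨ 6 * 2 ^ l ≤ a → s'.mem a = s.mem a) := by
  have hw := hs.word
  have hS := hs.space
  have hc := two_mod_two_pow hw
  have hN := Nat.one_le_two_pow (n := l)
  let I : ℕ → State → Prop := fun t s' =>
    s'.reg 7 = (2 ^ l + k) / 2 ^ t ∧ (∀ x, x ≠ 7 → x ≠ 9 → s'.reg x = s.reg x) ∧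
    (∀ a, a < 4 * 2 ^ l ∨ 6 * 2 ^ l ≤ a → s'.mem a = s.mem a) ∧
    ∀ h ≤ l, ∀ j < 2 ^ l, (s'.mem (4 * 2 ^ l + (2 ^ l + j) / 2 ^ h) : ZMod (2 ^ w)) =
      s.mem (4 * 2 ^ l + (2 ^ l + j) / 2 ^ h) +
        if h < t ∧ (2 ^ l + j) / 2 ^ h = (2 ^ l + k) / 2 ^ h then (s.reg 13 : ZMod (2 ^ w)) else 0
  have hloop : ∀ s', I 0 s' → Ends w S (.while (.reg 7)
      (.seq (.load 9 (.const 2 * .reg 1 + .reg 7))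
      (.seq (.store (.const 2 * .reg 1 + .reg 7) (.reg 9 + .reg 13))
      (.assign 7 (.reg 7 / .const 2))))) s' ((l + 1) * ((Expr.reg 7).cost + 1 + 20) + 2)
        (I (l + 1)) := by
    intro s' h0
    refine Ends.while I (l + 1) h0 ?_ ?_
    · rintro t ht s' ⟨h7, hr, hm, hv⟩
      have hb := ancestor_bounds hk (Nat.lt_succ_iff.1 ht)
      have hle : (2 ^ l + k) / 2 ^ t < 2 * 2 ^ l := (Nat.div_le_self _ _).trans_lt (by omega)
      have hpos : 0 < 2 ^ (l - t) := by positivity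
      constructor
      · rw [Expr.eval_reg, h7]
        omega
      have haddr : ∀ s'' : State, s''.reg 1 = 2 * 2 ^ l → s''.reg 7 = (2 ^ l + k) / 2 ^ t →
          (Expr.const 2 * .reg 1 + .reg 7).eval w s'' = 4 * 2 ^ l + (2 ^ l + k) / 2 ^ t := by
        intro s'' h1 h7
        simp only [Expr.eval_add, Expr.eval_mul, Expr.eval_const, Expr.eval_reg, h1, h7,
          hc 2 (by norm_num)]
        rw [Nat.mod_eq_of_lt (a := 2 * (2 * 2 ^ l)) (by omega), Nat.mod_eq_of_lt (by omega)]
        ring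
      have h1 : s'.reg 1 = 2 * 2 ^ l := (hr 1 (by decide) (by decide)).trans hs.reg1
      have a1 := haddr s' h1 h7
      refine Ends.le (Ends.seq (Ends.load (by rw [a1]; omega) (Ends.seq (Ends.store ?_
        (Ends.assign ?_))))) ?_
      · rw [haddr _ (by simpa using h1) (by simpa using h7)]
        omega
      · rw [a1, haddr _ (by simpa using h1) (by simpa using h7)]
        refine ⟨?_, ?_, ?_, ?_⟩
        · simp [h7, hc 2, Nat.div_div_eq_div_mul, pow_succ]
        · intro x hx7 hx9
          simp [hx7, hx9, hr]
        · intro a ha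
          have : a ≠ 4 * 2 ^ l + (2 ^ l + k) / 2 ^ t := by omega
          simp [this, hm a ha]
        · intro h hh j hj
          by_cases e : (2 ^ l + j) / 2 ^ h = (2 ^ l + k) / 2 ^ t
          · obtain rfl := ancestor_level hj hk hh (Nat.lt_succ_iff.1 ht) e
            have := hv h hh j hj
            simp only [lt_irrefl, false_and, if_false, add_zero, e] at this
            simp [e, this, hr 13]
          · have e2 : ¬ (h = t ∧ (2 ^ l + j) / 2 ^ h = (2 ^ l + k) / 2 ^ h) := by
              rintro ⟨rfl, e'⟩
              exact e e'
            have e3 : (h < t + 1 ∧ (2 ^ l + j) / 2 ^ h = (2 ^ l + k) / 2 ^ h) ↔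
                (h < t ∧ (2 ^ l + j) / 2 ^ h = (2 ^ l + k) / 2 ^ h) := by
              constructor
              · rintro ⟨a, b⟩
                exact ⟨by have : h ≠ t := fun c => e2 ⟨c, b⟩
                          omega, b⟩
              · rintro ⟨a, b⟩
                exact ⟨by omega, b⟩
            have := hv h hh j hj
            simp only [← e3] at this
            simp [e, this]
      · simp
    · rintro s' ⟨h7, -⟩
      rw [Expr.eval_reg, h7, Nat.div_eq_of_lt]
      rw [pow_succ]
      omega
  refine Ends.le (Ends.seq (Ends.assign ((hloop _ ?_).imp ?_))) ?_
  · refine ⟨?_, ?_, ?_, ?_⟩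
    · simp only [Expr.eval_add, Expr.eval_reg, State.reg_setReg, hs.reg2, h10, if_true, pow_zero,
        Nat.div_one]
      exact Nat.mod_eq_of_lt (by omega)
    · intro x hx7 hx9
      simp [hx7]
    · intro a _
      simp
    · intro h hh j hj
      simp
  · rintro s' ⟨-, hr, hm, hv⟩
    refine ⟨?_, hr, hm⟩
    intro h hh j hj
    rw [hv h hh j hj, hA h hh j hj]
    have e : ∀ i, (if (2 ^ l + i) / 2 ^ h = (2 ^ l + j) / 2 ^ h then
        A i + (if i = k then (s.reg 13 : ZMod (2 ^ w)) else 0) else 0) =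
        (if (2 ^ l + i) / 2 ^ h = (2 ^ l + j) / 2 ^ h then A i else 0) +
        if i = k then (if (2 ^ l + j) / 2 ^ h = (2 ^ l + k) / 2 ^ h then
          (s.reg 13 : ZMod (2 ^ w)) else 0) else 0 := by
      intro i
      by_cases hik : i = k
      · subst hik
        by_cases hij : (2 ^ l + i) / 2 ^ h = (2 ^ l + j) / 2 ^ h
        · simp [hij]
        · simp [hij, Ne.symm hij]
      · simp [hik]
    simp only [e, Finset.sum_add_distrib, Finset.sum_ite_eq', Finset.mem_range, hk, if_true,
      Nat.lt_succ_iff.2 hh, true_and]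
  · simp
    omega

/-- At height `t`, register `8` holds the weight of the leaves below the current node and to the
right of leaf `k`. Leaving an even node, a left child, adds the weight of its right sibling; leaving
a right child adds nothing. At the root all leaves are covered. -/
theorem treeQuery_ends {w S l k : ℕ} {A : ℕ → ZMod (2 ^ w)} {s : State} (hs : TreeRegs w S l s)
    (hk : k < 2 ^ l) (h10 : s.reg 10 = k) (hA : IsTree w l (4 * 2 ^ l) A s.mem) :
    Ends w S treeQuery s (30 * (l + 1) + 6) fun s' =>
      (s'.reg 8 : ZMod (2 ^ w)) = ∑ j ∈ Finset.range (2 ^ l), (if k < j then A j else 0) ∧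
      (∀ x, x ≠ 7 → x ≠ 8 → x ≠ 9 → s'.reg x = s.reg x) ∧ s'.mem = s.mem := by
  have hw := hs.word
  have hS := hs.space
  have hc := two_mod_two_pow hw
  have hN := Nat.one_le_two_pow (n := l)
  let I : ℕ → State → Prop := fun t s' =>
    s'.reg 7 = (2 ^ l + k) / 2 ^ t ∧ (∀ x, x ≠ 7 → x ≠ 8 → x ≠ 9 → s'.reg x = s.reg x) ∧
    s'.mem = s.mem ∧ (s'.reg 8 : ZMod (2 ^ w)) = ∑ j ∈ Finset.range (2 ^ l),
      if k < j ∧ (2 ^ l + j) / 2 ^ t = (2 ^ l + k) / 2 ^ t then A j else 0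
  have hloop : ∀ s', I 0 s' → Ends w S (.while ((Expr.const 1).less (.reg 7))
      (.seq (.load 9 (.const 2 * .reg 1 + (.reg 7 + .const 1)))
      (.seq (.assign 8 (.reg 8 + .reg 9 * (.same (.reg 7 % .const 2) (.const 0))))
      (.assign 7 (.reg 7 / .const 2))))) s'
        (l * (((Expr.const 1).less (.reg 7)).cost + 1 + 26) + 4) (I l) := by
    intro s' h0
    refine Ends.while I l h0 ?_ ?_
    · rintro t ht s' ⟨h7, hr, hm, hv⟩
      have hb := ancestor_bounds hk ht.le
      have hle : (2 ^ l + k) / 2 ^ t < 2 * 2 ^ l := (Nat.div_le_self _ _).trans_lt (by omega)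
      have hpos : 2 ≤ 2 ^ (l - t) := by
        obtain ⟨d, hd⟩ : ∃ d, l - t = d + 1 := ⟨l - t - 1, by omega⟩
        rw [hd, pow_succ]
        have := Nat.one_le_two_pow (n := d)
        omega
      constructor
      · simp only [Expr.eval_less, Expr.eval_const, Expr.eval_reg, h7, hc 1 (by norm_num)]
        rw [if_pos (by omega)]
        exact one_ne_zero
      have h1 : s'.reg 1 = 2 * 2 ^ l :=
        (hr 1 (by decide) (by decide) (by decide)).trans hs.reg1
      have a1 : (Expr.const 2 * .reg 1 + (.reg 7 + .const 1)).eval w s' =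
          4 * 2 ^ l + ((2 ^ l + k) / 2 ^ t + 1) := by
        simp only [Expr.eval_add, Expr.eval_mul, Expr.eval_const, Expr.eval_reg, h1, h7,
          hc 2 (by norm_num), hc 1 (by norm_num)]
        rw [Nat.mod_eq_of_lt (a := 2 * (2 * 2 ^ l)) (by omega),
          Nat.mod_eq_of_lt (a := _ + 1) (by omega), Nat.mod_eq_of_lt (by omega)]
        ring
      refine Ends.le (Ends.seq (Ends.load (by rw [a1]; omega) (Ends.seq (Ends.assign
        (Ends.assign ?_))))) ?_
      · rw [a1]
        refine ⟨?_, ?_, ?_, ?_⟩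
        · simp [h7, hc 2, Nat.div_div_eq_div_mul, pow_succ]
        · intro x hx7 hx8 hx9
          simp [hx7, hx8, hx9, hr]
        · simp [hm]
        · set x := (2 ^ l + k) / 2 ^ t with hx
          have hdiv : ∀ j, (2 ^ l + j) / 2 ^ (t + 1) = (2 ^ l + j) / 2 ^ t / 2 := fun j => by
            rw [pow_succ, Nat.div_div_eq_div_mul]
          -- Leaves below the parent to the right of `k` lie below the current node, or below its
          -- right sibling if the node is even.
          have hsplit : ∀ j, (if k < j ∧ (2 ^ l + j) / 2 ^ (t + 1) = (2 ^ l + k) / 2 ^ (t + 1)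
              then A j else 0) = (if k < j ∧ (2 ^ l + j) / 2 ^ t = x then A j else 0) +
              (if (2 ^ l + j) / 2 ^ t = x + 1 then A j else 0) * if x % 2 = 0 then 1 else 0 := by
            intro j
            rw [hdiv j, hdiv k, ← hx]
            have m1 : k < j → x ≤ (2 ^ l + j) / 2 ^ t := fun h =>
              Nat.div_le_div_right (by omega)
            have m2 : j ≤ k → (2 ^ l + j) / 2 ^ t ≤ x := fun h =>
              Nat.div_le_div_right (by omega)
            generalize (2 ^ l + j) / 2 ^ t = y at m1 m2 ⊢
            rcases Nat.lt_or_ge k j with hkj | hkj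
            · have := m1 hkj
              by_cases c1 : y = x
              · have : ¬ y = x + 1 := by omega
                simp [hkj, c1]
              · by_cases c2 : y = x + 1
                · subst c2
                  have c3 : (x + 1) / 2 = x / 2 ↔ x % 2 = 0 := by omega
                  simp [hkj, c3]
                · have : ¬ y / 2 = x / 2 := by omega
                  simp [c1, c2, this]
            · have := m2 hkj
              have c2 : ¬ y = x + 1 := by omega
              simp [not_lt.2 hkj, c2]
          have hnext : x % 2 = 0 → (s.mem (4 * 2 ^ l + (x + 1)) : ZMod (2 ^ w)) =
              ∑ j ∈ Finset.range (2 ^ l), if (2 ^ l + j) / 2 ^ t = x + 1 then A j else 0 := by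
            intro hx2
            have hlt : x + 1 < 2 ^ (l - t + 1) := by
              rcases Nat.lt_or_ge (x + 1) (2 ^ (l - t + 1)) with h | h
              · exact h
              · have : x + 1 = 2 * 2 ^ (l - t) := by rw [← pow_succ']; omega
                omega
            have e : 2 ^ (l - t) * 2 ^ t = 2 ^ l := by rw [← pow_add, Nat.sub_add_cancel ht.le]
            have b1 : 2 ^ l ≤ (x + 1) * 2 ^ t := by
              rw [← e]
              exact Nat.mul_le_mul_right _ (by omega)
            have b2 : (x + 1) * 2 ^ t < 2 * 2 ^ l := by
              rw [← e, ← mul_assoc, ← pow_succ']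
              exact Nat.mul_lt_mul_of_pos_right hlt (by positivity)
            -- The leftmost leaf below the node `x + 1` represents this node in `IsTree`.
            have := hA t ht.le ((x + 1) * 2 ^ t - 2 ^ l) (by omega)
            rw [Nat.add_sub_cancel' b1, Nat.mul_div_cancel _ (by positivity)] at this
            exact this
          simp only [hsplit, Finset.sum_add_distrib, ← Finset.sum_mul]
          rw [← hv]
          by_cases hx2 : x % 2 = 0
          · simp [h7, hx2, hc 2, hm, hnext hx2]
          · simp [h7, hx2, hc 2]
      · simp
    · rintro s' ⟨h7, -⟩
      have hb := ancestor_bounds hk le_rfl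
      simp only [Expr.eval_less, Expr.eval_const, Expr.eval_reg, h7, hc 1 (by norm_num)]
      rw [if_neg]
      simp only [Nat.sub_self, pow_zero, zero_add, pow_one] at hb
      omega
  refine Ends.le (Ends.seq (Ends.assign (Ends.seq (Ends.assign ((hloop _ ?_).imp ?_))))) ?_
  · refine ⟨?_, ?_, ?_, ?_⟩
    · simp only [Expr.eval_add, Expr.eval_reg, State.reg_setReg, hs.reg2, h10, if_true, pow_zero,
        Nat.div_one]
      exact Nat.mod_eq_of_lt (by omega)
    · intro x hx7 hx8 hx9
      simp [hx7, hx8]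
    · simp
    · rw [Finset.sum_eq_zero]
      · simp
      · intro j _
        rw [if_neg]
        simp only [pow_zero, Nat.div_one]
        omega
  · rintro s' ⟨-, hr, hm, hv⟩
    refine ⟨?_, hr, hm⟩
    rw [hv]
    refine Finset.sum_congr rfl fun j hj => ?_
    have hb := ancestor_bounds hk le_rfl
    have hb' := ancestor_bounds (Finset.mem_range.1 hj) le_rfl
    simp only [Nat.sub_self, pow_zero, zero_add, pow_one] at hb hb'
    have : (2 ^ l + j) / 2 ^ l = (2 ^ l + k) / 2 ^ l := by omega
    simp [this]
  · simp
    omega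

end WordRAM

/-! ### Vector operations -/

namespace WordRAM

open Finset

/-- The sizes of the data structures for a permutation `p` with inverse `q`. -/
structure Setting (w S n l m : ℕ) (p q : ℕ → ℕ) : Prop where
  inv : InvPair n p q
  n_le : n ≤ 2 ^ l
  le_n : 2 ^ l ≤ 2 * (n + 1)
  m_pos : 0 < m
  n_le_m : n ≤ m * m
  word : 12 * 2 ^ l + m < 2 ^ w
  space : 12 * 2 ^ l ≤ S

/-- The state holds the sizes, the permutation, its inverse and the identity, the two vectors `v` and
`u`, the number `b` in register `5`, and the number `acc` in register `4`. -/
structure Holds {w : ℕ} (n l m : ℕ) (p q : ℕ → ℕ) (b : ℕ) (v u : ℕ → ZMod (2 ^ w))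
    (acc : ZMod (2 ^ w)) (s : State) : Prop where
  reg0 : s.reg 0 = n
  reg1 : s.reg 1 = 2 * 2 ^ l
  reg2 : s.reg 2 = 2 ^ l
  reg3 : s.reg 3 = m
  reg4 : (s.reg 4 : ZMod (2 ^ w)) = acc
  reg5 : s.reg 5 = b
  perm : ∀ i < n, s.mem i = p i
  perm_inv : ∀ i < n, s.mem (2 * 2 ^ l + i) = q i
  ident : ∀ i < n, s.mem (6 * 2 ^ l + i) = i
  vec : ∀ i < n, (s.mem (8 * 2 ^ l + i) : ZMod (2 ^ w)) = v i
  aux : ∀ i < n, (s.mem (10 * 2 ^ l + i) : ZMod (2 ^ w)) = u i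

/-- The address of an entry of an array, given by a register. -/
def cell (k i : ℕ) : Expr := .const k * .reg 1 + .reg i

@[simp] theorem cost_cell (k i : ℕ) : (cell k i).cost = 5 := rfl

section

variable {w S n l m : ℕ} {p q : ℕ → ℕ} {b : ℕ} {v u : ℕ → ZMod (2 ^ w)} {acc : ZMod (2 ^ w)}

theorem Setting.const_mod (hS : Setting w S n l m p q) (c : ℕ) (hc : c ≤ 12) : c % 2 ^ w = c :=
  two_mod_two_pow (l := l) (by have := hS.word; omega) c hc

/-- Register `1` is the common length of six consecutive arrays: for `k = 0, …, 5` the permutation,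
its inverse, the tree, the identity and the two vectors. All addresses are below `12 * 2 ^ l`, so
nothing wraps around. -/
theorem Setting.eval_cell (hS : Setting w S n l m p q) {s : State} (h1 : s.reg 1 = 2 * 2 ^ l)
    {k i j : ℕ} (hk : k ≤ 5) (hi : s.reg i = j) (hj : j < 2 * 2 ^ l) :
    (cell k i).eval w s = 2 * k * 2 ^ l + j := by
  have hw := hS.word
  have hk2 : k * (2 * 2 ^ l) ≤ 5 * (2 * 2 ^ l) := Nat.mul_le_mul_right _ hk
  simp only [cell, Expr.eval_add, Expr.eval_mul, Expr.eval_const, Expr.eval_reg, h1, hi,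
    hS.const_mod k (by omega)]
  rw [Nat.mod_eq_of_lt (a := k * _) (by omega), Nat.mod_eq_of_lt (by omega)]
  ring

theorem Holds.treeRegs (hS : Setting w S n l m p q) {s : State} (h1 : s.reg 1 = 2 * 2 ^ l)
    (h2 : s.reg 2 = 2 ^ l) : TreeRegs w S l s :=
  ⟨h1, h2, by have := hS.word; omega, hS.space⟩

/-- The tree cells and the registers from `6` on are scratch space: a program may change them
without invalidating `Holds`. -/
theorem Holds.frame {s s' : State} {v' u' : ℕ → ZMod (2 ^ w)} (h : Holds n l m p q b v u acc s)
    (hn : n ≤ 2 ^ l) (hr : ∀ x ≤ 5, s'.reg x = s.reg x)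
    (hm : ∀ a, a < 4 * 2 ^ l ∨ (6 * 2 ^ l ≤ a ∧ a < 8 * 2 ^ l) → s'.mem a = s.mem a)
    (hv : ∀ i < n, (s'.mem (8 * 2 ^ l + i) : ZMod (2 ^ w)) = v' i)
    (hu : ∀ i < n, (s'.mem (10 * 2 ^ l + i) : ZMod (2 ^ w)) = u' i) :
    Holds n l m p q b v' u' acc s' where
  reg0 := (hr 0 (by decide)).trans h.reg0
  reg1 := (hr 1 (by decide)).trans h.reg1
  reg2 := (hr 2 (by decide)).trans h.reg2
  reg3 := (hr 3 (by decide)).trans h.reg3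
  reg4 := by rw [hr 4 (by decide)]; exact h.reg4
  reg5 := (hr 5 (by decide)).trans h.reg5
  perm i hi := (hm i (by omega)).trans (h.perm i hi)
  perm_inv i hi := (hm _ (by omega)).trans (h.perm_inv i hi)
  ident i hi := (hm _ (by omega)).trans (h.ident i hi)
  vec := hv
  aux := hu

theorem Holds.congr {s : State} {v' u' : ℕ → ZMod (2 ^ w)} (h : Holds n l m p q b v u acc s)
    (hv : ∀ i < n, v i = v' i) (hu : ∀ i < n, u i = u' i) : Holds n l m p q b v' u' acc s :=
  { h with
    vec := fun i hi => (h.vec i hi).trans (hv i hi)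
    aux := fun i hi => (h.aux i hi).trans (hu i hi) }

/-- Set all entries of the array `k` to the values of `e`, in which the registers `8` and `9` stand for
the entries of the two vectors. -/
def mapProg (k : ℕ) (e : Expr) : Prog :=
  .forLoop 6 (.reg 0) (.seq (.load 8 (cell 4 6)) (.seq (.load 9 (cell 5 6)) (.store (cell k 6) e)))

/-- The array is overwritten in place. Round `t` reads both vectors at `t` before writing there,
when the cells from `t` on still have their old contents. In `e`, registers other than `6`, `8` and
`9` act as constants. -/
theorem mapProg_ends (hS : Setting w S n l m p q) {s : State} (hs : Holds n l m p q b v u acc s)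
    {k : ℕ} (hk : k = 4 ∨ k = 5) {e : Expr} {g : ℕ → ZMod (2 ^ w)}
    (he : ∀ i < n, ∀ s' : State, (∀ x, x ≠ 6 → x ≠ 8 → x ≠ 9 → s'.reg x = s.reg x) →
      s'.reg 6 = i → (s'.reg 8 : ZMod (2 ^ w)) = v i → (s'.reg 9 : ZMod (2 ^ w)) = u i →
      (e.eval w s' : ZMod (2 ^ w)) = g i) :
    Ends w S (mapProg k e) s ((n + 1) * (e.cost + 30)) fun s' =>
      Holds n l m p q b (if k = 4 then g else v) (if k = 4 then u else g) acc s' := by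
  have hw := hS.word
  have hsp := hS.space
  have hn := hS.n_le
  let I : ℕ → State → Prop := fun t s' => s'.reg 6 = t ∧
    (∀ x, x ≠ 6 → x ≠ 8 → x ≠ 9 → s'.reg x = s.reg x) ∧
    (∀ a, a < 2 * k * 2 ^ l ∨ 2 * k * 2 ^ l + t ≤ a → s'.mem a = s.mem a) ∧
    ∀ i < t, (s'.mem (2 * k * 2 ^ l + i) : ZMod (2 ^ w)) = g i
  have hk5 : k ≤ 5 := by omega
  have hloop := Ends.forLoop (w := w) (S := S) (s := s) (x := 6) (e := .reg 0)
    (p := .seq (.load 8 (cell 4 6)) (.seq (.load 9 (cell 5 6)) (.store (cell k 6) e)))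
    (T := e.cost + 18) I n (by omega) ?_ ?_ ?_ ?_
  · refine Ends.mono hloop ?_ ?_
    · simp only [Expr.cost_reg]
      ring_nf
      omega
    · rintro s' ⟨-, hr, hm, hg⟩
      refine hs.frame hn (fun x hx => hr x (by omega) (by omega) (by omega)) (fun a ha => hm a ?_)
        ?_ ?_
      · rcases hk with rfl | rfl <;> omega
      · intro i hi
        rcases hk with rfl | rfl
        · simpa using hg i hi
        · rw [hm _ (by omega), hs.vec i hi]
          simp
      · intro i hi
        rcases hk with rfl | rfl
        · rw [hm _ (by omega), hs.aux i hi]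
          simp
        · simpa using hg i hi
  · rintro t s' ⟨-, hr, -⟩
    exact (hr 0 (by decide) (by decide) (by decide)).trans hs.reg0
  · refine ⟨by simp, ?_, ?_, ?_⟩
    · intro x h6 _ _
      simp [h6]
    · simp
    · simp
  · rintro t s' ⟨h6, -⟩
    exact h6
  · rintro t ht s' ⟨h6, hr, hm, hg⟩
    have h1 : s'.reg 1 = 2 * 2 ^ l :=
      (hr 1 (by decide) (by decide) (by decide)).trans hs.reg1
    have e1 := hS.eval_cell h1 (k := 4) (by norm_num) h6 (by omega)
    have e2 := hS.eval_cell (s := s'.setReg 8 (s'.mem (2 * 4 * 2 ^ l + t))) (k := 5) (i := 6) (j := t)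
      (by simpa using h1) (by norm_num) (by simpa using h6) (by omega)
    have e3 := hS.eval_cell (s := (s'.setReg 8 (s'.mem (2 * 4 * 2 ^ l + t))).setReg 9
      (s'.mem (2 * 5 * 2 ^ l + t))) (k := k) (i := 6) (j := t)
      (by simpa using h1) (by omega) (by simpa using h6) (by omega)
    refine Ends.le (Ends.seq (Ends.load (by rw [e1]; omega) (Ends.seq (Ends.load ?_
      (Ends.store ?_ ?_))))) ?_
    · rw [e1, e2]
      omega
    · rw [e1, e2, State.mem_setReg, e3]
      rcases hk with rfl | rfl <;> omega
    · rw [e1, e2, State.mem_setReg, e3]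
      have hev := he t ht ((s'.setReg 8 (s'.mem (2 * 4 * 2 ^ l + t))).setReg 9
        (s'.mem (2 * 5 * 2 ^ l + t))) (fun x h6 h8 h9 => by simp [h8, h9, hr x h6 h8 h9])
        (by simpa using h6) ?_ ?_
      · refine ⟨by simpa using h6, by simp, ?_, ?_, ?_⟩
        · intro x h6 h8 h9
          simp [h6, h8, h9, hr]
        · intro a ha
          have : a ≠ 2 * k * 2 ^ l + t := by omega
          simp only [State.mem_setReg, State.mem_setMem, this, if_false]
          exact hm a (by omega)
        · intro i hi
          by_cases hit : i = t
          · subst hit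
            simpa using hev
          · simp only [State.mem_setReg, State.mem_setMem, Nat.add_left_cancel_iff, hit, if_false]
            exact hg i (by omega)
      · rw [State.reg_setReg, if_neg (by decide), State.reg_setReg, if_pos rfl, ← hs.vec t ht,
          hm _ (by rcases hk with rfl | rfl <;> omega)]
      · rw [State.reg_setReg, if_pos rfl, ← hs.aux t ht,
          hm _ (by rcases hk with rfl | rfl <;> omega)]
    · simp
      omega

/-- Put the sum of the values of `e` into register `11`, where the registers `8` and `9` stand for the
entries of the two vectors. -/
def sumProg (e : Expr) : Prog :=
  .seq (.assign 11 (.const 0)) (.forLoop 6 (.reg 0)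
    (.seq (.load 8 (cell 4 6)) (.seq (.load 9 (cell 5 6)) (.assign 11 (.reg 11 + e)))))

theorem sumProg_ends (hS : Setting w S n l m p q) {s : State} (hs : Holds n l m p q b v u acc s)
    {e : Expr} {g : ℕ → ZMod (2 ^ w)}
    (he : ∀ i < n, ∀ s' : State, (∀ x ≤ 5, s'.reg x = s.reg x) →
      s'.reg 6 = i → (s'.reg 8 : ZMod (2 ^ w)) = v i → (s'.reg 9 : ZMod (2 ^ w)) = u i →
      (e.eval w s' : ZMod (2 ^ w)) = g i) :
    Ends w S (sumProg e) s ((n + 1) * (e.cost + 32)) fun s' =>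
      Holds n l m p q b v u acc s' ∧ (s'.reg 11 : ZMod (2 ^ w)) = ∑ i ∈ range n, g i := by
  have hw := hS.word
  have hsp := hS.space
  have hn := hS.n_le
  let I : ℕ → State → Prop := fun t s' => s'.reg 6 = t ∧
    (∀ x ≤ 5, s'.reg x = s.reg x) ∧ s'.mem = s.mem ∧
    (s'.reg 11 : ZMod (2 ^ w)) = ∑ i ∈ range t, g i
  have hloop : ∀ s₀, I 0 (s₀.setReg 6 0) → Ends w S (.forLoop 6 (.reg 0)
    (.seq (.load 8 (cell 4 6)) (.seq (.load 9 (cell 5 6)) (.assign 11 (.reg 11 + e))))) s₀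
      (n * (1 + (e.cost + 16) + 8) + (1 + 5)) (I n) := by
    intro s₀ h0
    refine Ends.forLoop I n (by omega) ?_ h0 ?_ ?_
    · rintro t s' ⟨-, hr, -⟩
      exact (hr 0 (by decide)).trans hs.reg0
    · rintro t s' ⟨h6, -⟩
      exact h6
    · rintro t ht s' ⟨h6, hr, hm, hg⟩
      have h1 : s'.reg 1 = 2 * 2 ^ l := (hr 1 (by decide)).trans hs.reg1
      have e1 := hS.eval_cell h1 (k := 4) (by norm_num) h6 (by omega)
      have e2 := hS.eval_cell (s := s'.setReg 8 (s'.mem (2 * 4 * 2 ^ l + t))) (k := 5) (i := 6)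
        (j := t) (by simpa using h1) (by norm_num) (by simpa using h6) (by omega)
      refine Ends.le (Ends.seq (Ends.load (by rw [e1]; omega) (Ends.seq (Ends.load ?_
        (Ends.assign ?_))))) ?_
      · rw [e1, e2]
        omega
      · rw [e1, e2, State.mem_setReg]
        have hev := he t ht ((s'.setReg 8 (s'.mem (2 * 4 * 2 ^ l + t))).setReg 9
          (s'.mem (2 * 5 * 2 ^ l + t))) (fun x hx => by
            simp [show x ≠ 8 by omega, show x ≠ 9 by omega, hr x hx]) (by simpa using h6) ?_ ?_
        · refine ⟨by simpa using h6, by simp, ?_, ?_, ?_⟩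
          · intro x hx
            simp [show x ≠ 6 by omega, show x ≠ 8 by omega, show x ≠ 9 by omega,
              show x ≠ 11 by omega, hr x hx]
          · simpa using hm
          · rw [sum_range_succ, ← hev, ← hg]
            simp
        · rw [State.reg_setReg, if_neg (by decide), State.reg_setReg, if_pos rfl, ← hs.vec t ht, hm]
        · rw [State.reg_setReg, if_pos rfl, ← hs.aux t ht, hm]
      · simp
        omega
  refine Ends.le (Ends.seq (Ends.assign ((hloop _ ?_).imp ?_))) ?_
  · refine ⟨by simp, fun x hx => ?_, rfl, by simp⟩
    simp [show x ≠ 6 by omega, show x ≠ 11 by omega]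
  · rintro s' ⟨-, hr, hm, hg⟩
    refine ⟨hs.frame hn hr (fun a _ => by rw [hm]) ?_ ?_, hg⟩
    · rw [hm]
      exact hs.vec
    · rw [hm]
      exact hs.aux
  · simp only [Expr.cost_const]
    ring_nf
    omega

/-- Replace the first vector by its exclusive prefix sums in the order given by the array `k`, where
the entries in the same block are multiplied by `1 + α`. -/
def scanProg (k α : ℕ) : Prog :=
  .seq (.assign 11 (.const 0)) (.seq (.assign 12 (.const 0)) (.forLoop 6 (.reg 0)
    (.seq (.load 7 (cell k 6))
    (.seq (.load 8 (cell 4 7))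
    (.seq (.assign 12 (.reg 12 * (Expr.const 0).less (.reg 6 % .reg 3)))
    (.seq (.store (cell 4 7) (.reg 11 + .const α * .reg 12))
    (.seq (.assign 11 (.reg 11 + .reg 8))
    (.assign 12 (.reg 12 + .reg 8)))))))))

/-- The running sum of a block survives the step to the next index unless that index begins a new
block. -/
theorem sum_block_succ {m : ℕ} (t : ℕ) (f : ℕ → ZMod (2 ^ w)) :
    (∑ y ∈ range (t + 1), if y / m = (t + 1) / m then f y else 0) =
      (∑ y ∈ range (t + 1), if y / m = t / m then f y else 0) *
        if 0 < (t + 1) % m then 1 else 0 := by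
  split_ifs with h
  · have e : (t + 1) / m = t / m := by
      rw [Nat.succ_div, if_neg (fun hd => h.ne' (Nat.mod_eq_zero_of_dvd hd)), add_zero]
    rw [e, mul_one]
  · rw [mul_zero]
    refine sum_eq_zero fun y hy => if_neg fun e => ?_
    have hd : m ∣ t + 1 := Nat.dvd_of_mod_eq_zero (by omega)
    have : y / m ≤ t / m := Nat.div_le_div_right (Nat.lt_succ_iff.1 (mem_range.1 hy))
    rw [e, Nat.succ_div, if_pos hd] at this
    omega

/-- Here `ρ` lists the entries in the order of traversal. Register `11` accumulates everything and
register `12` the current block. The latter is reset only in the round that begins a new block, by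
multiplication with a test, so the invariant carries the same factor. -/
theorem scanProg_ends (hS : Setting w S n l m p q) {s : State} (hs : Holds n l m p q b v u acc s)
    {k α : ℕ} {ρ ρ' : ℕ → ℕ} (hk : k = 1 ∨ k = 3) (hρ : InvPair n ρ' ρ)
    (hmem : ∀ i < n, s.mem (2 * k * 2 ^ l + i) = ρ i) {v' : ℕ → ZMod (2 ^ w)}
    (hv' : ∀ t < n, v' (ρ t) =
      ∑ y ∈ range t, (1 + if y / m = t / m then (α : ZMod (2 ^ w)) else 0) * v (ρ y)) :
    Ends w S (scanProg k α) s ((n + 1) * 60) fun s' => Holds n l m p q b v' u acc s' := by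
  have hw := hS.word
  have hsp := hS.space
  have hn := hS.n_le
  let I : ℕ → State → Prop := fun t s' => s'.reg 6 = t ∧
    (∀ x ≤ 5, s'.reg x = s.reg x) ∧
    (∀ a, a < 8 * 2 ^ l ∨ 10 * 2 ^ l ≤ a → s'.mem a = s.mem a) ∧
    (∀ y < n, (s'.mem (8 * 2 ^ l + ρ y) : ZMod (2 ^ w)) = if y < t then v' (ρ y) else v (ρ y)) ∧
    (s'.reg 11 : ZMod (2 ^ w)) = ∑ y ∈ range t, v (ρ y) ∧
    ((s'.reg 12 : ZMod (2 ^ w)) * if 0 < t % m then 1 else 0) =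
      ∑ y ∈ range t, if y / m = t / m then v (ρ y) else 0
  have hloop : ∀ s₀, I 0 (s₀.setReg 6 0) → Ends w S (.forLoop 6 (.reg 0)
      (.seq (.load 7 (cell k 6))
      (.seq (.load 8 (cell 4 7))
      (.seq (.assign 12 (.reg 12 * (Expr.const 0).less (.reg 6 % .reg 3)))
      (.seq (.store (cell 4 7) (.reg 11 + .const α * .reg 12))
      (.seq (.assign 11 (.reg 11 + .reg 8))
      (.assign 12 (.reg 12 + .reg 8)))))))) s₀ (n * (1 + 40 + 8) + (1 + 5)) (I n) := by
    intro s₀ h0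
    refine Ends.forLoop I n (by omega) ?_ h0 ?_ ?_
    · rintro t s' ⟨-, hr, -⟩
      exact (hr 0 (by decide)).trans hs.reg0
    · rintro t s' ⟨h6, -⟩
      exact h6
    · rintro t ht s' ⟨h6, hr, hm, hv, h11, h12⟩
      have h1 : s'.reg 1 = 2 * 2 ^ l := (hr 1 (by decide)).trans hs.reg1
      have h3 : s'.reg 3 = m := (hr 3 (by decide)).trans hs.reg3
      have hρt := hρ.q_lt t ht
      have e1 := hS.eval_cell h1 (k := k) (by omega) h6 (by omega)
      have hm1 : s'.mem (2 * k * 2 ^ l + t) = ρ t := by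
        rw [hm _ (by rcases hk with rfl | rfl <;> omega), hmem t ht]
      have e2 : ∀ s'' : State, s''.reg 1 = 2 * 2 ^ l → s''.reg 7 = ρ t →
          (cell 4 7).eval w s'' = 8 * 2 ^ l + ρ t := fun s'' a1 a2 =>
        hS.eval_cell (k := 4) a1 (by norm_num) a2 (by omega)
      refine Ends.le (Ends.seq (Ends.load ?_ (Ends.seq (Ends.load ?_ (Ends.seq (Ends.assign
        (Ends.seq (Ends.store ?_ (Ends.seq (Ends.assign (Ends.assign ?_))))))))))) ?_
      · rw [e1]
        rcases hk with rfl | rfl <;> omega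
      · rw [e1, hm1, e2 _ (by simpa using h1) (by simp)]
        omega
      · rw [e1, hm1, e2 _ (by simpa using h1) (by simp)]
        omega
      · rw [e1, hm1, e2 _ (by simpa using h1) (by simp), e2 _ (by simpa using h1) (by simp)]
        have hb : ((s'.reg 12 * if 0 < t % m then 1 else 0 : ℕ) : ZMod (2 ^ w)) =
            ∑ y ∈ range t, if y / m = t / m then v (ρ y) else 0 := by
          rw [← h12]
          push_cast
          rfl
        refine ⟨by simpa using h6, by simp, ?_, ?_, ?_, ?_, ?_⟩
        · intro x hx
          simp [show x ≠ 6 by omega, show x ≠ 8 by omega, show x ≠ 7 by omega,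
            show x ≠ 11 by omega, show x ≠ 12 by omega, hr x hx]
        · intro a ha
          have : a ≠ 8 * 2 ^ l + ρ t := by omega
          simp [this, hm a ha]
        · intro y hy
          by_cases hyt : y = t
          · subst hyt
            have hsum : v' (ρ y) = (∑ i ∈ range y, v (ρ i)) +
                α * ∑ i ∈ range y, if i / m = y / m then v (ρ i) else 0 := by
              rw [hv' y hy, mul_sum, ← sum_add_distrib]
              refine sum_congr rfl fun i _ => ?_
              split_ifs <;> ring
            rw [if_pos (Nat.lt_succ_self y), hsum, ← h11, ← hb]
            simp [h6, h3]
          · have hne : ρ y ≠ ρ t := fun h => hyt (hρ.q_inj hy ht h)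
            have := hv y hy
            simp only [State.mem_setReg, State.mem_setMem, Nat.add_left_cancel_iff, hne, if_false,
              this]
            have : y < t + 1 ↔ y < t := by omega
            simp only [this]
        · rw [sum_range_succ, ← h11]
          have := hv t ht
          simp only [lt_irrefl, if_false] at this
          simp [this]
        · rw [sum_block_succ, sum_range_succ, ← hb]
          have := hv t ht
          simp only [lt_irrefl, if_false] at this
          simp [this, h6, h3]
      · simp
  refine Ends.le (Ends.seq (Ends.assign (Ends.seq (Ends.assign ((hloop _ ?_).imp ?_))))) ?_
  · refine ⟨by simp, fun x hx => ?_, fun _ _ => rfl, ?_, by simp, by simp⟩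
    · simp [show x ≠ 6 by omega, show x ≠ 11 by omega, show x ≠ 12 by omega]
    · intro y hy
      simpa using hs.vec _ (hρ.q_lt y hy)
  · rintro s' ⟨-, hr, hm, hg, -⟩
    refine hs.frame hn hr (fun a _ => hm a (by omega)) ?_ ?_
    · intro i hi
      have := hg (ρ' i) (hρ.p_lt i hi)
      rwa [hρ.qp i hi, if_pos (hρ.p_lt i hi)] at this
    · intro i hi
      rw [hm _ (by omega), hs.aux i hi]
  · simp only [Expr.cost_const]
    ring_nf
    omega

/-- Set all weights of the tree to zero. -/
def clearTree : Prog := .forLoop 6 (.reg 1) (.store (cell 2 6) (.const 0))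

/-- The tree has `2 * 2 ^ l ≤ 4 * (n + 1)` cells and each round costs 16, which explains the
constant `70 = 4 * 16 + 6`. -/
theorem clearTree_ends (hS : Setting w S n l m p q) {s : State} (h1 : s.reg 1 = 2 * 2 ^ l) :
    Ends w S clearTree s ((n + 1) * 70) fun s' =>
      IsTree w l (4 * 2 ^ l) (fun _ => 0) s'.mem ∧ (∀ x, x ≠ 6 → s'.reg x = s.reg x) ∧
      (∀ a, a < 4 * 2 ^ l ∨ 6 * 2 ^ l ≤ a → s'.mem a = s.mem a) := by
  have hw := hS.word
  have hsp := hS.space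
  have hn := hS.le_n
  let I : ℕ → State → Prop := fun t s' => s'.reg 6 = t ∧
    (∀ x, x ≠ 6 → s'.reg x = s.reg x) ∧
    (∀ a, a < 4 * 2 ^ l ∨ 6 * 2 ^ l ≤ a → s'.mem a = s.mem a) ∧
    ∀ j < t, s'.mem (4 * 2 ^ l + j) = 0
  have hloop := Ends.forLoop (w := w) (S := S) (s := s) (x := 6) (e := .reg 1)
    (p := .store (cell 2 6) (.const 0)) (T := 7) I (2 * 2 ^ l) (by omega) ?_ ?_ ?_ ?_
  · refine Ends.mono hloop ?_ ?_
    · simp only [Expr.cost_reg]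
      omega
    · rintro s' ⟨-, hr, hm, h0⟩
      refine ⟨fun h hh k hk => ?_, hr, hm⟩
      rw [h0 _ ((Nat.div_le_self _ _).trans_lt (by omega))]
      simp
  · rintro t s' ⟨-, hr, -⟩
    exact (hr 1 (by decide)).trans h1
  · exact ⟨by simp, fun x hx => by simp [hx], fun _ _ => rfl, by simp⟩
  · rintro t s' ⟨h6, -⟩
    exact h6
  · rintro t ht s' ⟨h6, hr, hm, hg⟩
    have e1 := hS.eval_cell ((hr 1 (by decide)).trans h1) (k := 2) (by norm_num) h6 (by omega)
    refine Ends.le (Ends.store (by rw [e1]; omega) ?_) (by simp)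
    rw [e1]
    refine ⟨by simpa using h6, by simp, fun x hx => by simp [hx, hr], ?_, ?_⟩
    · intro a ha
      have : a ≠ 4 * 2 ^ l + t := by omega
      simp [this, hm a ha]
    · intro j hj
      by_cases hjt : j = t
      · simp [hjt]
      · simpa [hjt] using hg j (by omega)

/-- Replace every entry of the first vector by the sum over the entries to the left and above. -/
def cornerProg : Prog :=
  .seq clearTree (.forLoop 6 (.reg 0)
    (.seq (.load 10 (cell 0 6))
    (.seq treeQuery
    (.seq (.load 13 (cell 4 6))
    (.seq (.store (cell 4 6) (.reg 8))
    treeUpdate)))))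

/-- In a sweep from left to right, the tree holds `v j` at the leaf `p j` for all earlier positions
`j`. The weight to the right of the leaf `p t` is then the sum over the points to the left and
above. The old entry is kept in register `13` and inserted after the query. -/
theorem cornerProg_ends (hS : Setting w S n l m p q) {s : State}
    (hs : Holds n l m p q b v u acc s) :
    Ends w S cornerProg s ((n + 1) * (52 * (l + 1) + 120)) fun s' =>
      Holds n l m p q b (Edge.D.app n p v) u acc s' := by
  have hw := hS.word
  have hsp := hS.space
  have hn := hS.n_le
  let A : ℕ → ℕ → ZMod (2 ^ w) := fun t x => ∑ j ∈ range t, if p j = x then v j else 0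
  let I : ℕ → State → Prop := fun t s' => s'.reg 6 = t ∧
    (∀ x ≤ 5, s'.reg x = s.reg x) ∧
    (∀ a, a < 4 * 2 ^ l ∨ (6 * 2 ^ l ≤ a ∧ a < 8 * 2 ^ l) ∨ 8 * 2 ^ l + t ≤ a →
      s'.mem a = s.mem a) ∧
    (∀ i < t, (s'.mem (8 * 2 ^ l + i) : ZMod (2 ^ w)) = Edge.D.app n p v i) ∧
    IsTree w l (4 * 2 ^ l) (A t) s'.mem
  have hloop : ∀ s₀, I 0 (s₀.setReg 6 0) → Ends w S (.forLoop 6 (.reg 0)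
      (.seq (.load 10 (cell 0 6))
      (.seq treeQuery
      (.seq (.load 13 (cell 4 6))
      (.seq (.store (cell 4 6) (.reg 8))
      treeUpdate))))) s₀ (n * (1 + (52 * (l + 1) + 37) + 8) + (1 + 5)) (I n) := by
    intro s₀ h0
    refine Ends.forLoop I n (by omega) ?_ h0 ?_ ?_
    · rintro t s' ⟨-, hr, -⟩
      exact (hr 0 (by decide)).trans hs.reg0
    · rintro t s' ⟨h6, -⟩
      exact h6
    · rintro t ht s' ⟨h6, hr, hm, hv, hA⟩
      have h1 : s'.reg 1 = 2 * 2 ^ l := (hr 1 (by decide)).trans hs.reg1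
      have h2 : s'.reg 2 = 2 ^ l := (hr 2 (by decide)).trans hs.reg2
      have hpt := hS.inv.p_lt t ht
      have e1 : (cell 0 6).eval w s' = t := by
        have := hS.eval_cell h1 (k := 0) (by norm_num) h6 (by omega)
        omega
      have hpt' : s'.mem t = p t := by rw [hm _ (by omega), hs.perm t ht]
      refine Ends.le (Ends.seq (Ends.load (by rw [e1]; omega) (Ends.seq
        (T' := 22 * (l + 1) + 6 + 19) ((treeQuery_ends
        (k := p t) (A := A t) (Holds.treeRegs hS ?_ ?_) (by omega) ?_ ?_).imp ?_)))) ?_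
      · simpa using h1
      · simpa using h2
      · simp [e1, hpt']
      · simpa using hA
      · rintro s₁ ⟨g8, gr, gm⟩
        have k1 : s₁.reg 1 = 2 * 2 ^ l := by
          rw [gr 1 (by decide) (by decide) (by decide)]
          simpa using h1
        have k2 : s₁.reg 2 = 2 ^ l := by
          rw [gr 2 (by decide) (by decide) (by decide)]
          simpa using h2
        have k6 : s₁.reg 6 = t := by
          rw [gr 6 (by decide) (by decide) (by decide)]
          simpa using h6
        have k10 : s₁.reg 10 = p t := by
          rw [gr 10 (by decide) (by decide) (by decide)]
          simp [e1, hpt']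
        have e2 := hS.eval_cell k1 (k := 4) (by norm_num) k6 (by omega)
        have e3 := hS.eval_cell (s := s₁.setReg 13 (s₁.mem (2 * 4 * 2 ^ l + t))) (k := 4) (i := 6)
          (j := t) (by simpa using k1) (by norm_num) (by simpa using k6) (by omega)
        refine Ends.le (Ends.seq (Ends.load (by rw [e2]; omega) (Ends.seq (Ends.store ?_
          ((treeUpdate_ends (k := p t) (A := A t) (Holds.treeRegs hS ?_ ?_) (by omega) ?_ ?_).imp
          ?_))))) ?_
        · rw [e2, e3]
          omega
        · simpa using k1
        · simpa using k2
        · simpa using k10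
        · rw [e2, e3]
          intro h hh j hj
          have hlt : (2 ^ l + j) / 2 ^ h < 2 * 2 ^ l := (Nat.div_le_self _ _).trans_lt (by omega)
          have : 4 * 2 ^ l + (2 ^ l + j) / 2 ^ h ≠ 2 * 4 * 2 ^ l + t := by omega
          simp only [State.mem_setMem, this, if_false, State.mem_setReg, gm]
          exact hA h hh j hj
        · rw [e2, e3]
          rintro s₂ ⟨fA, fr, fm⟩
          refine ⟨?_, by simp, ?_, ?_, ?_, ?_⟩
          · rw [fr 6 (by decide) (by decide)]
            simpa using k6
          · intro x hx
            have q6 : x ≠ 6 := by omega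
            have q7 : x ≠ 7 := by omega
            have q8 : x ≠ 8 := by omega
            have q9 : x ≠ 9 := by omega
            have q10 : x ≠ 10 := by omega
            have q13 : x ≠ 13 := by omega
            simp [q6, fr x q7 q9, q13, gr x q7 q8 q9, q10, hr x hx]
          · intro a ha
            rw [State.mem_setReg, fm a (by omega)]
            have : a ≠ 2 * 4 * 2 ^ l + t := by omega
            simp only [State.mem_setMem, this, if_false, State.mem_setReg, gm]
            exact hm a (by omega)
          · intro i hi
            rw [State.mem_setReg, fm _ (by omega)]
            by_cases hit : i = t
            · subst hit
              simp only [State.mem_setMem, State.mem_setReg, Expr.eval_reg, State.reg_setReg]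
              rw [if_pos trivial, if_neg (by decide), g8]
              simp only [A]
              -- Each earlier point sits at exactly one leaf; this form lets the sum over leaves
              -- collapse after the sums are exchanged.
              have hswap : ∀ x, (if p i < x then ∑ j ∈ range i, (if p j = x then v j else 0) else 0) =
                  ∑ j ∈ range i, if p j = x then (if p i < p j then v j else 0) else 0 := by
                intro x
                by_cases hx : p i < x
                · rw [if_pos hx]
                  refine sum_congr rfl fun j _ => ?_
                  split_ifs <;> first | rfl | omega
                · rw [if_neg hx]
                  symm
                  refine sum_eq_zero fun j _ => ?_
                  split_ifs <;> first | rfl | omega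
              simp only [hswap]
              rw [sum_comm, Edge.app, ← sum_filter_add_sum_filter_not (range n) (fun j => j < i)]
              rw [sum_eq_zero (s := (range n).filter fun j => ¬ j < i), add_zero]
              · have : (range n).filter (fun j => j < i) = range i := by
                  ext j
                  simp only [mem_filter, mem_range]
                  omega
                rw [this]
                refine sum_congr rfl fun j hj => ?_
                have hj := mem_range.1 hj
                have hpj := hS.inv.p_lt j (by omega)
                rw [sum_ite_eq, if_pos (mem_range.2 (by omega))]
                simp [Edge.test, hj]
              · intro j hj
                have := (mem_filter.1 hj).2
                simp [Edge.test, this]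
            · have : 8 * 2 ^ l + i ≠ 2 * 4 * 2 ^ l + t := by omega
              simp only [State.mem_setMem, this, if_false, State.mem_setReg, gm]
              exact hv i (by omega)
          · rw [State.mem_setReg]
            convert fA using 2 with x
            simp only [A, sum_range_succ]
            congr 1
            have : (((s₁.setReg 13 (s₁.mem (2 * 4 * 2 ^ l + t))).setMem (2 * 4 * 2 ^ l + t)
              (Expr.eval w (s₁.setReg 13 (s₁.mem (2 * 4 * 2 ^ l + t))) (Expr.reg 8))).reg 13 :
                ZMod (2 ^ w)) = v t := by
              rw [← hs.vec t ht, State.reg_setMem, State.reg_setReg, if_pos rfl, gm,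
                State.mem_setReg, hm _ (by omega)]
            rw [this]
            simp only [eq_comm]
        · simp
          omega
      · simp
        omega
  refine Ends.le (Ends.seq (T' := n * (1 + (52 * (l + 1) + 37) + 8) + (1 + 5))
    ((clearTree_ends hS hs.reg1).imp ?_)) ?_
  · rintro s₀ ⟨hA, hr, hm⟩
    refine (hloop s₀ ?_).imp ?_
    · refine ⟨by simp, fun x hx => ?_, ?_, by simp, ?_⟩
      · simp [show x ≠ 6 by omega, hr]
      · intro a ha
        exact hm a (by omega)
      · simpa [A] using hA
    · rintro s' ⟨-, hr, hm, hv, -⟩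
      refine hs.frame hn hr (fun a ha => hm a (by omega)) hv ?_
      intro i hi
      rw [hm _ (by omega), hs.aux i hi]
  · ring_nf
    omega

end

end WordRAM

/-! ### The fine part of the cycle sum -/

namespace WordRAM

open Finset

/-- Add the tree sum for the position given by registers `15` and `12` to register `11` if it lies to the
right of register `14`. -/
def fineQuery : Prog :=
  .seq (.assign 16 (.reg 15 + .reg 12))
    (.ite ((Expr.reg 16).less (.reg 0) * (Expr.reg 14).less (.reg 16))
      (.seq (.load 10 (cell 0 16)) (.seq treeQuery (.assign 11 (.reg 11 + .reg 8)))) .skip)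

/-- Insert the value at the position given by registers `15` and `12` into the tree if it lies to the left
of register `14`. -/
def fineInsert : Prog :=
  .seq (.assign 16 (.reg 15 + .reg 12))
    (.ite ((Expr.reg 16).less (.reg 14)) (.seq (.load 10 (cell 0 16)) treeUpdate) .skip)

/-- Put the sum of all `fineSum` into register `11`. -/
def fineProg : Prog :=
  .seq clearTree (.seq (.assign 11 (.const 0)) (.forLoop 6 (.reg 0)
    (.seq (.load 14 (cell 1 6))
    (.seq (.assign 15 (.reg 14 / .reg 3 * .reg 3))
    (.seq (.forLoop 12 (.reg 3) fineQuery)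
    (.seq (.assign 13 (.const 1))
    (.forLoop 12 (.reg 3) fineInsert)))))))

/-- The offsets below `m` run through a block. The last block may be incomplete, hence the
comparison with `n`. -/
theorem sum_block {n m z : ℕ} {M : Type*} [AddCommMonoid M] (hm : 0 < m) (C : ℕ → Prop)
    [DecidablePred C] (f : ℕ → M) :
    (∑ k ∈ range m, if z / m * m + k < n ∧ C (z / m * m + k) then f (z / m * m + k) else 0) =
      ∑ d ∈ range n, if d / m = z / m ∧ C d then f d else 0 := by
  rw [← sum_filter, ← sum_filter]
  have hdiv : ∀ d, d / m = z / m ↔ z / m * m ≤ d ∧ d < z / m * m + m := fun d => by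
    rw [Nat.div_eq_iff hm]
    omega
  refine sum_nbij' (fun k => z / m * m + k) (fun d => d - z / m * m) ?_ ?_ ?_ ?_ fun _ _ => rfl
  · intro k hk
    simp only [mem_filter, mem_range, hdiv] at hk ⊢
    exact ⟨hk.2.1, ⟨by omega, by omega⟩, hk.2.2⟩
  · intro d hd
    simp only [mem_filter, mem_range, hdiv] at hd ⊢
    rw [Nat.add_sub_cancel' hd.2.1.1]
    exact ⟨by omega, hd.1, hd.2.2⟩
  · intro k _
    simp
  · intro d hd
    simp only [mem_filter, mem_range, hdiv] at hd
    exact Nat.add_sub_cancel' hd.2.1.1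

section

variable {w S n l m : ℕ} {p q : ℕ → ℕ} {b : ℕ} {v u : ℕ → ZMod (2 ^ w)} {acc : ZMod (2 ^ w)}

/-- The position `z` is the point `c` of the cycle, and the loop runs over the candidates for `d` in
its block. A product of two tests serves as their conjunction. -/
theorem fineQuery_loop (hS : Setting w S n l m p q) {s : State} {z : ℕ} (h0 : s.reg 0 = n)
    (h1 : s.reg 1 = 2 * 2 ^ l) (h2 : s.reg 2 = 2 ^ l) (h3 : s.reg 3 = m) (h14 : s.reg 14 = z)
    (h15 : s.reg 15 = z / m * m) (hz : z < n) (hp : ∀ i < n, s.mem i = p i)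
    {A : ℕ → ZMod (2 ^ w)} (hA : IsTree w l (4 * 2 ^ l) A s.mem) :
    Ends w S (.forLoop 12 (.reg 3) fineQuery) s (m * (30 * (l + 1) + 43) + 6) fun s' =>
      s'.mem = s.mem ∧ (∀ x ≤ 6, s'.reg x = s.reg x) ∧ (∀ x, 13 ≤ x → x ≤ 15 → s'.reg x = s.reg x) ∧
      (s'.reg 11 : ZMod (2 ^ w)) = s.reg 11 + ∑ d ∈ range n, if d / m = z / m ∧ z < d then
        ∑ x ∈ range (2 ^ l), (if p d < x then A x else 0) else 0 := by
  have hw := hS.word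
  have hsp := hS.space
  have hn := hS.n_le
  let f : ℕ → ZMod (2 ^ w) := fun d => ∑ x ∈ range (2 ^ l), if p d < x then A x else 0
  let I : ℕ → State → Prop := fun t s' => s'.reg 12 = t ∧ s'.mem = s.mem ∧
    (∀ x ≤ 6, s'.reg x = s.reg x) ∧ (∀ x, 13 ≤ x → x ≤ 15 → s'.reg x = s.reg x) ∧
    (s'.reg 11 : ZMod (2 ^ w)) = s.reg 11 + ∑ k ∈ range t,
      if z / m * m + k < n ∧ z < z / m * m + k then f (z / m * m + k) else 0
  have hloop := Ends.forLoop (w := w) (S := S) (s := s) (x := 12) (e := .reg 3)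
    (p := fineQuery) (T := 30 * (l + 1) + 34) I m (by omega) ?_ ?_ ?_ ?_
  · refine Ends.mono hloop ?_ ?_
    · simp only [Expr.cost_reg]
      ring_nf
      omega
    · rintro s' ⟨-, hm, hr, hr', h11⟩
      refine ⟨hm, hr, hr', ?_⟩
      rw [h11, sum_block hS.m_pos (fun d => z < d) f]
  · rintro t s' ⟨-, -, hr, -⟩
    exact (hr 3 (by decide)).trans h3
  · refine ⟨by simp, rfl, fun x hx => ?_, fun x hx hx' => ?_, by simp⟩
    · simp [show x ≠ 12 by omega]
    · simp [show x ≠ 12 by omega]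
  · rintro t s' ⟨h, -⟩
    exact h
  · rintro t ht s' ⟨h12, hm, hr, hr', h11⟩
    have k0 : s'.reg 0 = n := (hr 0 (by decide)).trans h0
    have k1 : s'.reg 1 = 2 * 2 ^ l := (hr 1 (by decide)).trans h1
    have k2 : s'.reg 2 = 2 ^ l := (hr 2 (by decide)).trans h2
    have k14 : s'.reg 14 = z := (hr' 14 (by decide) (by decide)).trans h14
    have k15 : s'.reg 15 = z / m * m := (hr' 15 (by decide) (by decide)).trans h15
    have hzm : z / m * m ≤ z := Nat.div_mul_le_self z m
    have e16 : (Expr.reg 15 + .reg 12).eval w s' = z / m * m + t := by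
      simp only [Expr.eval_add, Expr.eval_reg, k15, h12]
      exact Nat.mod_eq_of_lt (by omega)
    set d := z / m * m + t with hd
    have cond : ∀ s'' : State, s''.reg 16 = d → s''.reg 0 = n → s''.reg 14 = z →
        (((Expr.reg 16).less (.reg 0) * (Expr.reg 14).less (.reg 16)).eval w s'' ≠ 0 ↔
          (d < n ∧ z < d)) := by
      intro s'' a1 a2 a3
      simp only [Expr.eval_mul, Expr.eval_less, Expr.eval_reg, a1, a2, a3]
      have h1 := hS.const_mod 1 (by norm_num)
      by_cases c1 : d < n <;> by_cases c2 : z < d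
      · simp only [c1, c2, if_true, mul_one, h1]
        simp
      all_goals simp [c1, c2]
    refine Ends.le (Ends.seq (Ends.assign (Ends.ite (T := 30 * (l + 1) + 16) ?_ ?_))) ?_
    · intro hc
      rw [e16, cond _ (by simp) (by simpa using k0) (by simpa using k14)] at hc
      have e1 : (cell 0 16).eval w (s'.setReg 16 d) = d := by
        have := hS.eval_cell (s := s'.setReg 16 d) (k := 0) (i := 16) (j := d) (by simpa using k1)
          (by norm_num) (by simp) (by omega)
        omega
      have hpd := hS.inv.p_lt d hc.1
      rw [e16]
      refine Ends.le (Ends.seq (Ends.load (by rw [e1]; omega) (Ends.seq (T' := 4) ((treeQuery_ends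
        (k := p d) (A := A) (Holds.treeRegs hS ?_ ?_) (by omega) ?_ ?_).imp ?_)))) ?_
      · simpa using k1
      · simpa using k2
      · simp [e1, hm, hp d hc.1]
      · simpa [hm] using hA
      · rintro s₁ ⟨g8, gr, gm⟩
        refine Ends.le (Ends.assign ⟨?_, ?_, ?_, ?_, ?_, ?_⟩) ?_
        · rw [State.reg_setReg, if_neg (by decide), gr 12 (by decide) (by decide) (by decide)]
          simpa using h12
        · simp
        · simp [gm, hm]
        · intro x hx
          have q7 : x ≠ 7 := by omega
          have q8 : x ≠ 8 := by omega
          have q9 : x ≠ 9 := by omega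
          simp [show x ≠ 12 by omega, show x ≠ 11 by omega, gr x q7 q8 q9, show x ≠ 10 by omega,
            show x ≠ 16 by omega, hr x hx]
        · intro x hx hx'
          have q7 : x ≠ 7 := by omega
          have q8 : x ≠ 8 := by omega
          have q9 : x ≠ 9 := by omega
          simp [show x ≠ 12 by omega, show x ≠ 11 by omega, gr x q7 q8 q9, show x ≠ 10 by omega,
            show x ≠ 16 by omega, hr' x hx hx']
        · have k11 : s₁.reg 11 = s'.reg 11 := by
            rw [gr 11 (by decide) (by decide) (by decide)]
            simp
          rw [sum_range_succ, ← hd, if_pos hc, ← add_assoc, ← h11]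
          simp [k11, g8, f]
        · simp
      · simp
        omega
    · intro hc
      rw [e16] at hc ⊢
      have hc' : ¬ (d < n ∧ z < d) := fun h => (cond _ (by simp) (by simpa using k0)
        (by simpa using k14)).2 h hc
      refine Ends.le (Ends.skip ⟨?_, ?_, ?_, ?_, ?_, ?_⟩) (by omega)
      · simpa using h12
      · simp
      · simp [hm]
      · intro x hx
        simp [show x ≠ 12 by omega, show x ≠ 16 by omega, hr x hx]
      · intro x hx hx'
        simp [show x ≠ 12 by omega, show x ≠ 16 by omega, hr' x hx hx']
      · rw [sum_range_succ, ← hd, if_neg hc', add_zero, ← h11]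
        simp
    · simp
      omega

/-- Now `z` takes the role of `b`: each `a` to its left in the block adds weight one at its value.
No comparison with `n` is needed, because `d < z` implies it. -/
theorem fineInsert_loop (hS : Setting w S n l m p q) {s : State} {z : ℕ}
    (h1 : s.reg 1 = 2 * 2 ^ l) (h2 : s.reg 2 = 2 ^ l) (h3 : s.reg 3 = m) (h14 : s.reg 14 = z)
    (h13 : s.reg 13 = 1) (h15 : s.reg 15 = z / m * m) (hz : z < n) (hp : ∀ i < n, s.mem i = p i)
    {A : ℕ → ZMod (2 ^ w)} (hA : IsTree w l (4 * 2 ^ l) A s.mem) :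
    Ends w S (.forLoop 12 (.reg 3) fineInsert) s (m * (22 * (l + 1) + 43) + 6) fun s' =>
      (∀ a, a < 4 * 2 ^ l ∨ 6 * 2 ^ l ≤ a → s'.mem a = s.mem a) ∧
      (∀ x ≤ 6, s'.reg x = s.reg x) ∧ s'.reg 11 = s.reg 11 ∧
      IsTree w l (4 * 2 ^ l) (fun x => A x + ∑ d ∈ range n, if d / m = z / m ∧ d < z ∧ p d = x then
        1 else 0) s'.mem := by
  have hw := hS.word
  have hsp := hS.space
  have hn := hS.n_le
  let B : ℕ → ℕ → ZMod (2 ^ w) := fun t x => A x + ∑ k ∈ range t,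
      if z / m * m + k < n ∧ z / m * m + k < z ∧ p (z / m * m + k) = x then 1 else 0
  let I : ℕ → State → Prop := fun t s' => s'.reg 12 = t ∧
    (∀ a, a < 4 * 2 ^ l ∨ 6 * 2 ^ l ≤ a → s'.mem a = s.mem a) ∧
    (∀ x ≤ 6, s'.reg x = s.reg x) ∧ (∀ x, 13 ≤ x → x ≤ 15 → s'.reg x = s.reg x) ∧
    s'.reg 11 = s.reg 11 ∧ IsTree w l (4 * 2 ^ l) (B t) s'.mem
  have hloop := Ends.forLoop (w := w) (S := S) (s := s) (x := 12) (e := .reg 3)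
    (p := fineInsert) (T := 22 * (l + 1) + 34) I m (by omega) ?_ ?_ ?_ ?_
  · refine Ends.mono hloop ?_ ?_
    · simp only [Expr.cost_reg]
      ring_nf
      omega
    · rintro s' ⟨-, hm, hr, hr', h11, hB⟩
      refine ⟨hm, hr, h11, ?_⟩
      convert hB using 2 with x
      simp only [B]
      rw [sum_block hS.m_pos (fun d => d < z ∧ p d = x) fun _ => (1 : ZMod (2 ^ w))]
  · rintro t s' ⟨-, -, hr, -⟩
    exact (hr 3 (by decide)).trans h3
  · refine ⟨by simp, fun _ _ => rfl, fun x hx => ?_, fun x hx hx' => ?_, by simp, by simpa [B] using hA⟩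
    · simp [show x ≠ 12 by omega]
    · simp [show x ≠ 12 by omega]
  · rintro t s' ⟨h, -⟩
    exact h
  · rintro t ht s' ⟨h12, hm, hr, hr', h11, hB⟩
    have k1 : s'.reg 1 = 2 * 2 ^ l := (hr 1 (by decide)).trans h1
    have k2 : s'.reg 2 = 2 ^ l := (hr 2 (by decide)).trans h2
    have k13 : s'.reg 13 = 1 := (hr' 13 (by decide) (by decide)).trans h13
    have k14 : s'.reg 14 = z := (hr' 14 (by decide) (by decide)).trans h14
    have k15 : s'.reg 15 = z / m * m := (hr' 15 (by decide) (by decide)).trans h15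
    have hzm : z / m * m ≤ z := Nat.div_mul_le_self z m
    have e16 : (Expr.reg 15 + .reg 12).eval w s' = z / m * m + t := by
      simp only [Expr.eval_add, Expr.eval_reg, k15, h12]
      exact Nat.mod_eq_of_lt (by omega)
    set d := z / m * m + t with hd
    have cond : ∀ s'' : State, s''.reg 16 = d → s''.reg 14 = z →
        (((Expr.reg 16).less (.reg 14)).eval w s'' ≠ 0 ↔ d < z) := by
      intro s'' a1 a3
      simp only [Expr.eval_less, Expr.eval_reg, a1, a3]
      by_cases c1 : d < z <;> simp [c1]
    refine Ends.le (Ends.seq (Ends.assign (Ends.ite (T := 22 * (l + 1) + 12) ?_ ?_))) ?_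
    · intro hc
      rw [e16, cond _ (by simp) (by simpa using k14)] at hc
      have e1 : (cell 0 16).eval w (s'.setReg 16 d) = d := by
        have := hS.eval_cell (s := s'.setReg 16 d) (k := 0) (i := 16) (j := d) (by simpa using k1)
          (by norm_num) (by simp) (by omega)
        omega
      have hdn : d < n := by omega
      have hpd := hS.inv.p_lt d hdn
      rw [e16]
      refine Ends.le (Ends.seq (Ends.load (by rw [e1]; omega) ((treeUpdate_ends
        (k := p d) (A := B t) (Holds.treeRegs hS ?_ ?_) (by omega) ?_ ?_).imp ?_))) ?_
      · simpa using k1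
      · simpa using k2
      · simp [e1, hm d (by omega), hp d hdn]
      · simpa using hB
      · rintro s₁ ⟨gA, gr, gm⟩
        refine ⟨?_, ?_, ?_, ?_, ?_, ?_, ?_⟩
        · rw [gr 12 (by decide) (by decide)]
          simpa using h12
        · simp
        · intro a ha
          rw [State.mem_setReg, gm a ha, State.mem_setReg, State.mem_setReg, hm a ha]
        · intro x hx
          have q7 : x ≠ 7 := by omega
          have q9 : x ≠ 9 := by omega
          simp [show x ≠ 12 by omega, gr x q7 q9, show x ≠ 10 by omega,
            show x ≠ 16 by omega, hr x hx]
        · intro x hx hx'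
          have q7 : x ≠ 7 := by omega
          have q9 : x ≠ 9 := by omega
          simp [show x ≠ 12 by omega, gr x q7 q9, show x ≠ 10 by omega,
            show x ≠ 16 by omega, hr' x hx hx']
        · rw [State.reg_setReg, if_neg (by decide), gr 11 (by decide) (by decide)]
          simpa using h11
        · rw [State.mem_setReg]
          convert gA using 2 with x
          simp only [B, sum_range_succ, ← hd, ← add_assoc]
          simp [k13, hc, hdn, eq_comm]
      · simp
        omega
    · intro hc
      rw [e16] at hc ⊢
      have hc' : ¬ d < z := fun h => (cond _ (by simp) (by simpa using k14)).2 h hc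
      refine Ends.le (Ends.skip ⟨?_, ?_, ?_, ?_, ?_, ?_, ?_⟩) (by omega)
      · simpa using h12
      · simp
      · intro a ha
        simpa using hm a ha
      · intro x hx
        simp [show x ≠ 12 by omega, show x ≠ 16 by omega, hr x hx]
      · intro x hx hx'
        simp [show x ≠ 12 by omega, show x ≠ 16 by omega, hr' x hx hx']
      · simpa using h11
      · have e : B (t + 1) = B t := funext fun x => by
          simp only [B, sum_range_succ, ← hd]
          rw [if_neg fun h => hc' h.2.1, add_zero]
        rw [State.mem_setReg, State.mem_setReg, e]
        exact hB
    · simp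
      omega

/-- The values are processed in increasing order. As each position is queried before its own pairs
are inserted, it sees as `c` just the pairs `(a, b)` with `b` below it, and serves as `b` for later
values. -/
theorem fineProg_ends (hS : Setting w S n l m p q) {s : State} (hs : Holds n l m p q b v u acc s) :
    Ends w S fineProg s ((n + 1) * (m * (52 * (l + 1) + 90) + 150)) fun s' =>
      Holds n l m p q b v u acc s' ∧
      (s'.reg 11 : ZMod (2 ^ w)) = ∑ y ∈ range n, fineSum n p q m y := by
  have hw := hS.word
  have hsp := hS.space
  have hn := hS.n_le
  -- The weight of the leaf `x` counts the pairs inserted so far whose left point has the value `x`.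
  let A : ℕ → ℕ → ZMod (2 ^ w) := fun y x => ∑ y' ∈ range y, ∑ d ∈ range n,
    if d / m = q y' / m ∧ d < q y' ∧ p d = x then 1 else 0
  have hweight : ∀ y x, ∑ x' ∈ range (2 ^ l), (if x < x' then A y x' else 0) =
      fineWeight n p q m y x := by
    intro y x
    have e : ∀ x', (if x < x' then A y x' else 0) = ∑ y' ∈ range y, ∑ d ∈ range n,
        if p d = x' then (if d / m = q y' / m ∧ d < q y' ∧ x < p d then 1 else 0) else 0 := by
      intro x'
      by_cases hx : x < x'
      · rw [if_pos hx]
        refine sum_congr rfl fun y' _ => sum_congr rfl fun d _ => ?_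
        by_cases hd : p d = x'
        · simp [hd, hx]
        · simp [hd]
      · rw [if_neg hx]
        symm
        refine sum_eq_zero fun y' _ => sum_eq_zero fun d _ => ?_
        by_cases hd : p d = x'
        · simp [hd, hx]
        · simp [hd]
    simp only [e]
    rw [sum_comm]
    refine sum_congr rfl fun y' _ => ?_
    rw [sum_comm]
    refine sum_congr rfl fun d hd => ?_
    have hpd := hS.inv.p_lt d (mem_range.1 hd)
    rw [sum_ite_eq, if_pos (mem_range.2 (by omega))]
  let I : ℕ → State → Prop := fun t s' => s'.reg 6 = t ∧
    (∀ x ≤ 5, s'.reg x = s.reg x) ∧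
    (∀ a, a < 4 * 2 ^ l ∨ 6 * 2 ^ l ≤ a → s'.mem a = s.mem a) ∧
    (s'.reg 11 : ZMod (2 ^ w)) = ∑ y ∈ range t, fineSum n p q m y ∧
    IsTree w l (4 * 2 ^ l) (A t) s'.mem
  have hloop : ∀ s₀, I 0 (s₀.setReg 6 0) → Ends w S (.forLoop 6 (.reg 0)
    (.seq (.load 14 (cell 1 6))
    (.seq (.assign 15 (.reg 14 / .reg 3 * .reg 3))
    (.seq (.forLoop 12 (.reg 3) fineQuery)
    (.seq (.assign 13 (.const 1))
    (.forLoop 12 (.reg 3) fineInsert)))))) s₀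
      (n * (1 + (m * (30 * (l + 1) + 43) + m * (22 * (l + 1) + 43) + 26) + 8) + (1 + 5)) (I n) := by
    intro s₀ hI0
    refine Ends.forLoop I n (by omega) ?_ hI0 ?_ ?_
    · rintro t s' ⟨-, hr, -⟩
      exact (hr 0 (by decide)).trans hs.reg0
    · rintro t s' ⟨h6, -⟩
      exact h6
    · rintro t ht s' ⟨h6, hr, hm, h11, hA⟩
      have k0 : s'.reg 0 = n := (hr 0 (by decide)).trans hs.reg0
      have k1 : s'.reg 1 = 2 * 2 ^ l := (hr 1 (by decide)).trans hs.reg1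
      have k2 : s'.reg 2 = 2 ^ l := (hr 2 (by decide)).trans hs.reg2
      have k3 : s'.reg 3 = m := (hr 3 (by decide)).trans hs.reg3
      have hqt := hS.inv.q_lt t ht
      have e1 := hS.eval_cell k1 (k := 1) (by norm_num) h6 (by omega)
      have hz : s'.mem (2 * 1 * 2 ^ l + t) = q t := by
        rw [mul_one, hm _ (by omega), hs.perm_inv t ht]
      have e15 : (Expr.reg 14 / .reg 3 * .reg 3).eval w (s'.setReg 14 (q t)) = q t / m * m := by
        simp only [Expr.eval_mul, Expr.eval_div, Expr.eval_reg, State.reg_setReg, k3]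
        have := Nat.div_mul_le_self (q t) m
        exact Nat.mod_eq_of_lt (by simp; omega)
      refine Ends.le (Ends.seq (Ends.load (by rw [e1]; omega) (Ends.seq (Ends.assign (Ends.seq
        (T' := 2 + (m * (22 * (l + 1) + 43) + 6))
        ((fineQuery_loop hS (z := q t) (A := A t) ?_ ?_ ?_ ?_ ?_ ?_ hqt ?_ ?_).imp ?_)))))) ?_
      · simpa using k0
      · simpa using k1
      · simpa using k2
      · simpa using k3
      · simp [e1, hz]
      · rw [e1, hz, e15]
        simp
      · intro i hi
        rw [State.mem_setReg, State.mem_setReg, hm i (by omega), hs.perm i hi]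
      · simpa using hA
      · rw [e1, hz, e15]
        rintro s₁ ⟨gm, gr, gr', g11⟩
        refine Ends.seq (Ends.assign ((fineInsert_loop hS (z := q t) (A := A t) ?_ ?_ ?_ ?_ ?_ ?_ hqt
          ?_ ?_).imp ?_))
        · simpa [gr 1] using k1
        · simpa [gr 2] using k2
        · simpa [gr 3] using k3
        · simp [gr' 14]
        · simp [hS.const_mod 1]
        · simp [gr' 15]
        · intro i hi
          rw [State.mem_setReg, gm, State.mem_setReg, State.mem_setReg, hm i (by omega), hs.perm i hi]
        · simpa [gm] using hA
        · rintro s₂ ⟨fm, fr, f11, fA⟩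
          refine ⟨?_, by simp, ?_, ?_, ?_, ?_⟩
          · rw [fr 6 (by decide)]
            simpa [gr 6] using h6
          · intro x hx
            simp [show x ≠ 6 by omega, fr x (by omega), show x ≠ 13 by omega, gr x (by omega),
              show x ≠ 14 by omega, show x ≠ 15 by omega, hr x hx]
          · intro a ha
            rw [State.mem_setReg, fm a ha, State.mem_setReg, gm, State.mem_setReg, State.mem_setReg,
              hm a ha]
          · rw [State.reg_setReg, if_neg (by decide), f11, State.reg_setReg, if_neg (by decide), g11,
              sum_range_succ, ← h11]
            simp only [hweight]
            simp [fineSum]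
          · rw [State.mem_setReg]
            convert fA using 2 with x
            simp only [A, sum_range_succ]
      · simp
        omega
  refine Ends.le (Ends.seq (T' := 2 + (n * (1 + (m * (30 * (l + 1) + 43) + m * (22 * (l + 1) + 43) +
    26) + 8) + (1 + 5))) ((clearTree_ends hS hs.reg1).imp ?_)) ?_
  · rintro s₀ ⟨hA, hr, hm⟩
    refine Ends.seq (Ends.assign ((hloop _ ?_).imp ?_))
    · refine ⟨by simp, fun x hx => ?_, ?_, by simp, ?_⟩
      · simp [show x ≠ 6 by omega, show x ≠ 11 by omega, hr]
      · intro a ha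
        exact hm a ha
      · simpa [A] using hA
    · rintro s' ⟨-, hr, hm, h11, -⟩
      refine ⟨hs.frame hn hr (fun a ha => hm a (by omega)) ?_ ?_, h11⟩
      · intro i hi
        rw [hm _ (by omega), hs.vec i hi]
      · intro i hi
        rw [hm _ (by omega), hs.aux i hi]
  · ring_nf
    omega

end

end WordRAM

/-! ### Programs for tree sums and the cycle sum -/

namespace WordRAM

open Finset

/-- Apply the operator of a relation to the first vector. -/
def edgeProg : Edge → Prog
  | .D => cornerProg
  | .X => scanProg 3 0
  | .Y => scanProg 1 0
  | .I => .skip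
  | .J => .seq (sumProg (.reg 8)) (mapProg 4 (.reg 11))

/-- The value of an integer modulo `2 ^ w`. -/
def coefExpr : ℤ → Expr
  | .ofNat c => .const c
  | .negSucc c => .op .sub (.const 0) (.const (c + 1))

/-- Add a multiple of register `11` to register `4`. -/
def accProg (z : ℤ) : Prog := .assign 4 (.reg 4 + coefExpr z * .reg 11)

/-- Add a multiple of the coarse sum for the block given by register `5` to register `4`. -/
def coarseBody (z : ℤ) : Prog :=
  .seq (mapProg 4 (.same (.reg 6 / .reg 3) (.reg 5)))
    (.seq (scanProg 1 0)
    (.seq (scanProg 3 1)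
    (.seq (scanProg 1 0)
    (.seq (sumProg (.reg 8 * .less (.reg 6 / .reg 3) (.reg 5)))
    (accProg z)))))

/-- Multiply the second vector by the numbers of points in a relation to the given ones. -/
def starStep (e : Edge) : Prog :=
  .seq (mapProg 4 (.const 1)) (.seq (edgeProg e) (mapProg 5 (.reg 9 * .reg 8)))

/-- Add a multiple of the statistic given by a shape to register `4`. -/
def termProg (z : ℤ) : Term → Prog
  | .path e₁ e₂ e₃ => .seq (mapProg 4 (.const 1)) (.seq (edgeProg e₃) (.seq (edgeProg e₂)
      (.seq (edgeProg e₁) (.seq (sumProg (.reg 8)) (accProg z)))))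
  | .star e₁ e₂ e₃ => .seq (mapProg 5 (.const 1)) (.seq (starStep e₁) (.seq (starStep e₂)
      (.seq (starStep e₃) (.seq (sumProg (.reg 9)) (accProg z)))))
  | .cyc => .seq (.forLoop 5 (.reg 3) (coarseBody z)) (.seq fineProg (accProg z))

/-- Add a linear combination of statistics to register `4`. -/
def termsProg : List (ℤ × Term) → Prog
  | [] => .skip
  | c :: cs => .seq (termProg c.1 c.2) (termsProg cs)

/-- A bound for the time of a vector operation. -/
def opTime (n l : ℕ) : ℕ := (n + 1) * (52 * (l + 1) + 120)

/-- `opTime` is the bound for `cornerProg`. Its factor for `l = 0` is `52 + 120 = 172`, which covers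
the operations of constant time per entry. -/
theorem le_opTime {n l c : ℕ} (hc : c ≤ 172) : (n + 1) * c ≤ opTime n l :=
  Nat.mul_le_mul_left _ (by omega)

theorem one_le_opTime {n l c : ℕ} (hc : c ≤ 172) : c ≤ opTime n l :=
  le_trans (by rw [Nat.add_mul]; omega) (le_opTime (n := n) hc)

theorem cost_coefExpr (z : ℤ) : (coefExpr z).cost ≤ 3 := by
  cases z
  · simp [coefExpr]
  · simp [coefExpr, Expr.cost]

theorem eval_coefExpr (w : ℕ) (s : State) (z : ℤ) :
    ((coefExpr z).eval w s : ZMod (2 ^ w)) = z := by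
  cases z with
  | ofNat c => simp [coefExpr]
  | negSucc c =>
    simp only [coefExpr, Expr.eval, BinOp.eval, Nat.zero_mod, zero_add, ZMod.natCast_mod]
    rw [Nat.cast_sub (Nat.mod_lt _ (by positivity)).le, ZMod.natCast_mod, ZMod.natCast_self]
    simp [Int.negSucc_eq]

section

variable {w S n l m : ℕ} {p q : ℕ → ℕ} {b : ℕ} {v u : ℕ → ZMod (2 ^ w)} {acc : ZMod (2 ^ w)}

theorem scanX_ends (hS : Setting w S n l m p q) {s : State} (hs : Holds n l m p q b v u acc s)
    (α : ℕ) : Ends w S (scanProg 3 α) s (opTime n l) fun s' =>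
      Holds n l m p q b (blockScan m (α : ZMod (2 ^ w)) v) u acc s' :=
  (scanProg_ends hS hs (ρ := id) (ρ' := id) (Or.inr rfl)
    ⟨fun _ h => h, fun _ h => h, fun _ _ => rfl, fun _ _ => rfl⟩ hs.ident
    (v' := blockScan m (α : ZMod (2 ^ w)) v) fun _ _ => rfl).le (le_opTime (by norm_num))

/-- The inverse permutation lists the positions by increasing value, so prefix sums in this order
collect the lower points. -/
theorem scanY_ends (hS : Setting w S n l m p q) {s : State} (hs : Holds n l m p q b v u acc s) :
    Ends w S (scanProg 1 0) s (opTime n l) fun s' =>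
      Holds n l m p q b (Edge.Y.app n p v) u acc s' := by
  refine (scanProg_ends hS hs (ρ := q) (ρ' := p) (Or.inl rfl) hS.inv hs.perm_inv
    fun t ht => ?_).le (le_opTime (by norm_num))
  rw [Edge.app, ← hS.inv.sum_q fun j => if Edge.Y.test (q t, p (q t)) (j, p j) then v j else 0,
    sum_range_eq_ite ht.le]
  refine sum_congr rfl fun y hy => ?_
  simp [Edge.test, hS.inv.pq t ht, hS.inv.pq y (mem_range.1 hy)]

theorem edgeProg_ends (hS : Setting w S n l m p q) {s : State} (hs : Holds n l m p q b v u acc s)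
    (e : Edge) : Ends w S (edgeProg e) s (opTime n l) fun s' =>
      Holds n l m p q b (e.app n p v) u acc s' := by
  cases e with
  | D => exact cornerProg_ends hS hs
  | X =>
    refine (scanX_ends hS hs 0).imp fun s' h => h.congr (fun i hi => ?_) fun _ _ => rfl
    rw [blockScan, Edge.app, sum_range_eq_ite hi.le]
    simp [Edge.test]
  | Y => exact scanY_ends hS hs
  | I =>
    refine Ends.le (Ends.skip (hs.congr (fun i hi => ?_) fun _ _ => rfl)) (one_le_opTime (by norm_num))
    rw [Edge.app, sum_eq_single_of_mem i (mem_range.2 hi)]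
    · simp [Edge.test]
    · intro j _ hj
      rw [if_neg]
      simp only [Edge.test, Bool.and_eq_true, Bool.not_eq_true', Nat.blt_eq, ← Bool.not_eq_true]
      omega
  | J =>
    refine Ends.le (Ends.seq (T' := (n + 1) * (1 + 30)) ((sumProg_ends hS hs (e := .reg 8) (g := v)
      fun i _ s' _ _ h8 _ => h8).imp ?_)) ?_
    · rintro s₁ ⟨h₁, h11⟩
      refine ((mapProg_ends hS h₁ (k := 4) (Or.inl rfl) (e := .reg 11)
        (g := Edge.J.app n p v) fun i _ s' hr _ _ _ => ?_)).imp fun s' h => h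
      rw [Expr.eval_reg, hr 11 (by decide) (by decide) (by decide), h11]
      simp [Edge.app, Edge.test]
    · rw [Expr.cost_reg, ← Nat.mul_add]
      exact le_opTime (by norm_num)

theorem accProg_ends {s : State} (hs : Holds n l m p q b v u acc s) {x : ZMod (2 ^ w)}
    (h11 : (s.reg 11 : ZMod (2 ^ w)) = x) (z : ℤ) :
    Ends w S (accProg z) s (opTime n l) fun s' => Holds n l m p q b v u (acc + z * x) s' := by
  have hc := cost_coefExpr z
  refine Ends.le (Ends.assign ?_) (le_trans ?_ (one_le_opTime (c := 8) (by norm_num)))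
  · refine ⟨by simpa using hs.reg0, by simpa using hs.reg1, by simpa using hs.reg2,
      by simpa using hs.reg3, ?_, by simpa using hs.reg5, hs.perm, hs.perm_inv, hs.ident, hs.vec,
      hs.aux⟩
    rw [State.reg_setReg, if_pos rfl, Expr.eval_add, Expr.eval_mul, ZMod.natCast_mod, Nat.cast_add,
      ZMod.natCast_mod, Nat.cast_mul, eval_coefExpr, Expr.eval_reg, Expr.eval_reg, hs.reg4, h11]
  · simp only [Expr.cost_add, Expr.cost_mul, Expr.cost_reg]
    omega

theorem fill_ends (hS : Setting w S n l m p q) {s : State} (hs : Holds n l m p q b v u acc s) :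
    Ends w S (mapProg 4 (.const 1)) s (opTime n l) fun s' =>
      Holds n l m p q b (fun _ => 1) u acc s' :=
  (mapProg_ends hS hs (k := 4) (Or.inl rfl) (e := .const 1) (g := fun _ => 1)
    fun i _ s' _ _ _ _ => by simp).le (le_opTime (by simp))

theorem starStep_ends (hS : Setting w S n l m p q) {s : State} (hs : Holds n l m p q b v u acc s)
    (e : Edge) : Ends w S (starStep e) s (3 * opTime n l) fun s' =>
      Holds n l m p q b (e.app n p fun _ => 1) (fun i => u i * e.app n p (fun _ => 1) i) acc s' := by
  refine Ends.le (Ends.seq ((fill_ends hS hs).imp fun s₁ h₁ => Ends.seq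
    ((edgeProg_ends hS h₁ e).imp fun s₂ h₂ => ?_))) (T := opTime n l + (opTime n l + opTime n l))
    (by omega)
  refine ((mapProg_ends hS h₂ (k := 5) (Or.inr rfl) (e := .reg 9 * .reg 8)
    (g := fun i => u i * e.app n p (fun _ => 1) i) fun i _ s' _ _ h8 h9 => ?_).le
    (le_opTime (by simp))).imp fun s' h => h
  rw [Expr.eval_mul, ZMod.natCast_mod, Nat.cast_mul, Expr.eval_reg, Expr.eval_reg, h8, h9]

/-- The scans carry the indicator of the block of `b` around the cycle: to `c`, to `d` with double
weight inside a block, and to `a`, where only earlier blocks are kept. -/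
theorem coarseBody_ends (hS : Setting w S n l m p q) {s : State} (hs : Holds n l m p q b v u acc s)
    (z : ℤ) : Ends w S (coarseBody z) s (6 * opTime n l) fun s' =>
      ∃ v, Holds n l m p q b v u (acc + (z : ZMod (2 ^ w)) * (coarseSum n p m b : ZMod (2 ^ w))) s' := by
  let U := opTime n l
  have hmask : Ends w S (mapProg 4 (.same (.reg 6 / .reg 3) (.reg 5))) s U fun s' =>
      Holds n l m p q b (fun i => if i / m = b then 1 else 0) u acc s' := by
    refine ((mapProg_ends hS hs (k := 4) (Or.inl rfl) (g := fun i => if i / m = b then 1 else 0)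
      fun i _ s' hr h6 _ _ => ?_).le (le_opTime (by simp))).imp fun s' h => h
    rw [Expr.eval_same, Expr.eval_div, Expr.eval_reg, Expr.eval_reg, Expr.eval_reg, h6,
      hr 3 (by decide) (by decide) (by decide), hs.reg3,
      hr 5 (by decide) (by decide) (by decide), hs.reg5]
    split_ifs <;> simp
  refine Ends.le (T := U + (U + (U + (U + (U + U))))) (Ends.seq (hmask.imp fun s₁ h₁ => Ends.seq
    ((scanY_ends hS h₁).imp fun s₂ h₂ => Ends.seq ((scanX_ends hS h₂ 1).imp fun s₃ h₃ => Ends.seq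
    ((scanY_ends hS h₃).imp fun s₄ h₄ => ?_))))) (by omega)
  refine Ends.seq (((sumProg_ends hS h₄ (g := fun a => if a / m < b then
    Edge.Y.app n p (blockScan m ((1 : ℕ) : ZMod (2 ^ w)) (Edge.Y.app n p fun b' =>
      if b' / m = b then 1 else 0)) a else 0) fun i _ s' hr h6 h8 _ => ?_).le
    (le_opTime (by simp))).imp fun s₅ h₅ =>
    (accProg_ends h₅.1 h₅.2 z).imp fun s₆ h₆ => 
      ⟨Edge.Y.app n p (blockScan m ((1 : ℕ) : ZMod (2 ^ w)) (Edge.Y.app n p fun b' =>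
      if b' / m = b then 1 else 0)), by simpa only [coarseSum, Nat.cast_one] using h₆⟩)
  · rw [Expr.eval_mul, ZMod.natCast_mod, Nat.cast_mul, Expr.eval_less, Expr.eval_div, Expr.eval_reg,
      Expr.eval_reg, Expr.eval_reg, Expr.eval_reg, h6, h8, hr 3 (by decide), h₄.reg3,
      hr 5 (by decide), h₄.reg5]
    split_ifs <;> simp

theorem Holds.setReg_five {s : State} (hs : Holds n l m p q b v u acc s) (b' : ℕ) :
    Holds n l m p q b' v u acc (s.setReg 5 b') :=
  ⟨by simpa using hs.reg0, by simpa using hs.reg1, by simpa using hs.reg2, by simpa using hs.reg3,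
    by simpa using hs.reg4, by simp, hs.perm, hs.perm_inv, hs.ident, hs.vec, hs.aux⟩

/-- The constant 12 counts the vector operations of a star, `1 + 3 * 3 + 1 + 1`. Only the cycle
needs the factor `m + 1`, for its `m` coarse sums of six operations each and the fine sweep. -/
theorem termProg_ends (hS : Setting w S n l m p q) {π : Equiv.Perm (Fin n)}
    (hp : ∀ i : Fin n, p i = π i) {s : State} (hs : Holds n l m p q b v u acc s) (z : ℤ) (T : Term) :
    Ends w S (termProg z T) s (12 * ((m + 1) * opTime n l)) fun s' =>
      ∃ b v u, Holds n l m p q b v u (acc + (z : ZMod (2 ^ w)) * (tupleCount T.test π : ZMod (2 ^ w))) s' := by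
  have hU : opTime n l ≤ (m + 1) * opTime n l := Nat.le_mul_of_pos_left _ (Nat.succ_pos m)
  set U := opTime n l with hUdef
  cases T with
  | path e₁ e₂ e₃ =>
    rw [tupleCount_path e₁ e₂ e₃ π hp]
    refine Ends.le (T := U + (U + (U + (U + (U + U))))) (Ends.seq ((fill_ends hS hs).imp fun s₁ h₁ =>
      Ends.seq ((edgeProg_ends hS h₁ e₃).imp fun s₂ h₂ => Ends.seq ((edgeProg_ends hS h₂ e₂).imp
      fun s₃ h₃ => Ends.seq ((edgeProg_ends hS h₃ e₁).imp fun s₄ h₄ => ?_))))) (by omega)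
    refine Ends.seq (((sumProg_ends hS h₄ (e := .reg 8)
      (g := e₁.app n p (e₂.app n p (e₃.app n p fun _ => 1))) fun i _ s' _ _ h8 _ => h8).le (le_opTime (by simp))).imp
      fun s₅ h₅ => (accProg_ends h₅.1 h₅.2 z).imp fun s₆ h₆ => ⟨_, _, _, h₆⟩)
  | star e₁ e₂ e₃ =>
    rw [tupleCount_star e₁ e₂ e₃ π hp]
    have h0 : Ends w S (mapProg 5 (.const 1)) s U fun s' =>
        Holds n l m p q b v (fun _ => 1) acc s' :=
      ((mapProg_ends hS hs (k := 5) (Or.inr rfl) (e := .const 1) (g := fun _ => 1)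
        fun i _ s' _ _ _ _ => by simp).le (le_opTime (by simp))).imp fun s' h => h
    refine Ends.le (T := U + (3 * U + (3 * U + (3 * U + (U + U))))) (Ends.seq (h0.imp fun s₁ h₁ =>
      Ends.seq ((starStep_ends hS h₁ e₁).imp fun s₂ h₂ => Ends.seq ((starStep_ends hS h₂ e₂).imp
      fun s₃ h₃ => Ends.seq ((starStep_ends hS h₃ e₃).imp fun s₄ h₄ => ?_))))) (by omega)
    refine Ends.seq (((sumProg_ends hS h₄ (e := .reg 9)
      (g := fun i => e₁.app n p (fun _ => 1) i * e₂.app n p (fun _ => 1) i *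
        e₃.app n p (fun _ => 1) i) fun i _ s' _ _ _ h9 => by
        simpa only [one_mul, Expr.eval_reg] using h9).le (le_opTime (by simp))).imp
      fun s₅ h₅ => (accProg_ends h₅.1 h₅.2 z).imp fun s₆ h₆ => ⟨_, _, _, h₆⟩)
  | cyc =>
    rw [tupleCount_cast _ π hp, cycleSum_eq hS.inv hS.n_le_m, mul_add, ← add_assoc]
    let I : ℕ → State → Prop := fun t s' =>
      ∃ v u, Holds n l m p q t v u (acc + (z : ZMod (2 ^ w)) * ∑ β ∈ range t, coarseSum n p m β) s'
    have hloop : Ends w S (.forLoop 5 (.reg 3) (coarseBody z)) s (m * (1 + 6 * U + 8) + (1 + 5))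
        (I m) := by
      refine Ends.forLoop I m (by have := hS.word; omega) ?_ ?_ ?_ ?_
      · rintro t s' ⟨v, u, h⟩
        exact h.reg3
      · exact ⟨v, u, by simpa using hs.setReg_five 0⟩
      · rintro t s' ⟨v, u, h⟩
        exact h.reg5
      · rintro t ht s' ⟨v, u, h⟩
        refine (coarseBody_ends hS h z).imp ?_
        rintro s₁ ⟨v', h'⟩
        refine ⟨h'.reg5, v', u, ?_⟩
        rw [sum_range_succ, mul_add, ← add_assoc]
        exact h'.setReg_five (t + 1)
    refine Ends.le (T := (m * (1 + 6 * U + 8) + (1 + 5)) + ((m + 1) * U + U))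
      (Ends.seq (hloop.imp ?_)) ?_
    · rintro s₁ ⟨v, u, h₁⟩
      refine Ends.seq (((fineProg_ends hS h₁).le ?_).imp fun s₂ h₂ =>
        (accProg_ends h₂.1 h₂.2 z).imp fun s₃ h₃ => ⟨_, _, _, h₃⟩)
      rw [hUdef, opTime, mul_left_comm]
      refine Nat.mul_le_mul_left _ ?_
      have : m * (52 * (l + 1) + 90) ≤ m * (52 * (l + 1) + 120) := Nat.mul_le_mul_left _ (by omega)
      rw [Nat.add_mul]
      omega
    · have h9 : 9 ≤ U := one_le_opTime (by norm_num)
      have h1 : m * (1 + 6 * U + 8) ≤ m * (7 * U) := Nat.mul_le_mul_left _ (by omega)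
      have h2 : m * (7 * U) = 7 * (m * U) := by ring
      have h3 : (m + 1) * U = m * U + U := by ring
      omega

theorem termsProg_ends (hS : Setting w S n l m p q) {π : Equiv.Perm (Fin n)}
    (hp : ∀ i : Fin n, p i = π i) (cs : List (ℤ × Term)) : ∀ {s : State} {b : ℕ}
    {v u : ℕ → ZMod (2 ^ w)} {acc : ZMod (2 ^ w)}, Holds n l m p q b v u acc s →
    Ends w S (termsProg cs) s (cs.length * (12 * ((m + 1) * opTime n l)) + 1) fun s' =>
      ∃ b v u, Holds n l m p q b v u (acc +
        (((cs.map fun c => c.1 * (tupleCount c.2.test π : ℤ)).sum : ℤ) : ZMod (2 ^ w))) s' := by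
  induction cs with
  | nil =>
    intro s b v u acc hs
    exact Ends.le (Ends.skip ⟨b, v, u, by simpa using hs⟩) (by simp)
  | cons c cs ih =>
    intro s b v u acc hs
    refine Ends.le (Ends.seq (T' := cs.length * (12 * ((m + 1) * opTime n l)) + 1)
      ((termProg_ends hS hp hs c.1 c.2).imp ?_)) ?_
    · rintro s₁ ⟨b₁, v₁, u₁, h₁⟩
      refine (ih h₁).imp ?_
      rintro s₂ ⟨b₂, v₂, u₂, h₂⟩
      refine ⟨b₂, v₂, u₂, ?_⟩
      simpa [add_assoc] using h₂
    · rw [List.length_cons, Nat.add_mul cs.length]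
      omega

end

end WordRAM

/-! ### The complete program -/

namespace WordRAM

/-- Compute the sizes, the inverse permutation and the identity. -/
def setupProg : Prog :=
  .seq (.assign 2 (.const 1))
    (.seq (.while ((Expr.reg 2).less (.reg 0)) (.assign 2 (.reg 2 + .reg 2)))
    (.seq (.assign 1 (.reg 2 + .reg 2))
    (.seq (.assign 3 (.const 1))
    (.seq (.while ((Expr.reg 3 * .reg 3).less (.reg 0)) (.assign 3 (.reg 3 + .const 1)))
    (.forLoop 6 (.reg 0)
      (.seq (.load 8 (cell 0 6))
      (.seq (.store (cell 1 8) (.reg 6))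
      (.store (cell 3 6) (.reg 6)))))))))

theorem invPair_input {n : ℕ} (π : Equiv.Perm (Fin n)) :
    InvPair n (input π).mem (input π.symm).mem where
  p_lt i hi := by simp [input, hi]
  q_lt i hi := by simp [input, hi]
  pq i hi := by simp [input, hi]
  qp i hi := by simp [input, hi]

theorem two_pow_clog_le (n : ℕ) : 2 ^ Nat.clog 2 n ≤ 2 * (n + 1) := by
  rcases Nat.lt_or_ge 1 n with h | h
  · have := Nat.pow_pred_clog_lt_self (b := 2) (by norm_num) h
    have hpos := Nat.clog_pos (b := 2) (by norm_num) h
    obtain ⟨k, hk⟩ : ∃ k, Nat.clog 2 n = k + 1 := ⟨Nat.clog 2 n - 1, by omega⟩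
    rw [hk, Nat.pred_succ] at this
    rw [hk, pow_succ]
    omega
  · rw [Nat.clog_of_right_le_one h, pow_zero]
    omega

/-- The block length is the least positive `m` with `n ≤ m * m`; truncated subtraction gives `m = 1`
for `n = 0`. The arrays fit since `2 ^ l ≤ 2 * (n + 1)`. -/
theorem setting_input {n w : ℕ} (π : Equiv.Perm (Fin n)) (hw : 512 * (n + 1) ≤ 2 ^ w) :
    Setting w (24 * (n + 1)) n (Nat.clog 2 n) (Nat.sqrt (n - 1) + 1) (input π).mem
      (input π.symm).mem where
  inv := invPair_input π
  n_le := Nat.le_pow_clog (by norm_num) n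
  le_n := two_pow_clog_le n
  m_pos := Nat.succ_pos _
  n_le_m := by
    have := Nat.lt_succ_sqrt (n - 1)
    simp only [Nat.succ_eq_add_one] at this
    omega
  word := by
    have := two_pow_clog_le n
    have := Nat.sqrt_le_self (n - 1)
    omega
  space := by
    have := two_pow_clog_le n
    omega

theorem setupProg_ends {n w : ℕ} (π : Equiv.Perm (Fin n)) (hw : 512 * (n + 1) ≤ 2 ^ w) :
    Ends w (24 * (n + 1)) setupProg (input π) ((n + 1) * 120) fun s =>
      Holds (w := w) n (Nat.clog 2 n) (Nat.sqrt (n - 1) + 1) (input π).mem (input π.symm).mem 0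
        (fun _ => 0) (fun _ => 0) 0 s := by
  have hS := setting_input π hw
  have hn := hS.n_le
  have hn' := hS.le_n
  have hsp := hS.space
  have hl : Nat.clog 2 n < 2 ^ Nat.clog 2 n := Nat.lt_two_pow_self
  set l := Nat.clog 2 n with hldef
  set K := Nat.sqrt (n - 1) with hKdef
  have hK : K * K ≤ n - 1 := Nat.sqrt_le (n - 1)
  have hKn : K ≤ n - 1 := Nat.sqrt_le_self _
  have hone : 1 % 2 ^ w = 1 := Nat.mod_eq_of_lt (by omega)
  let I₁ : ℕ → State → Prop := fun k s =>
    s.reg 2 = 2 ^ k ∧ (∀ x, x ≠ 2 → s.reg x = (input π).reg x) ∧ s.mem = (input π).mem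
  have h₁ : ∀ s, I₁ 0 s → Ends w (24 * (n + 1))
      (.while ((Expr.reg 2).less (.reg 0)) (.assign 2 (.reg 2 + .reg 2))) s
      (l * (((Expr.reg 2).less (.reg 0)).cost + 1 + 4) + (((Expr.reg 2).less (.reg 0)).cost + 1))
      (I₁ l) := by
    intro s h0
    refine Ends.while I₁ l h0 ?_ ?_
    · rintro k hk s ⟨h2, hr, hm⟩
      have hlt : 2 ^ k < n := (Nat.lt_clog_iff_pow_lt (by norm_num)).1 hk
      constructor
      · rw [Expr.eval_less, Expr.eval_reg, Expr.eval_reg, h2, hr 0 (by decide)]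
        simp [input, hlt]
      · refine Ends.le (Ends.assign ⟨?_, fun x hx => by simp [hx, hr], by simpa using hm⟩) (by simp)
        simp only [State.reg_setReg, if_true, Expr.eval_add, Expr.eval_reg, h2]
        rw [Nat.mod_eq_of_lt (by omega), pow_succ]
        omega
    · rintro s ⟨h2, hr, -⟩
      rw [Expr.eval_less, Expr.eval_reg, Expr.eval_reg, h2, hr 0 (by decide), if_neg]
      simpa [input] using hn
  let R : State → Prop := fun s => s.reg 0 = n ∧ s.reg 1 = 2 * 2 ^ l ∧ s.reg 2 = 2 ^ l ∧
    s.reg 4 = 0 ∧ s.reg 5 = 0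
  let I₂ : ℕ → State → Prop := fun k s => s.reg 3 = k + 1 ∧ R s ∧ s.mem = (input π).mem
  have h₂ : ∀ s, I₂ 0 s → Ends w (24 * (n + 1))
      (.while ((Expr.reg 3 * .reg 3).less (.reg 0)) (.assign 3 (.reg 3 + .const 1))) s
      (K * (((Expr.reg 3 * .reg 3).less (.reg 0)).cost + 1 + 4) +
        (((Expr.reg 3 * .reg 3).less (.reg 0)).cost + 1)) (I₂ K) := by
    intro s h0
    -- The search for `m` squares candidates up to `K + 1`, which must not wrap around.
    have hsq : ∀ k ≤ K, (k + 1) * (k + 1) < 2 ^ w := by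
      intro k hk
      have : (k + 1) * (k + 1) ≤ (K + 1) * (K + 1) := by gcongr
      have : (K + 1) * (K + 1) = K * K + 2 * K + 1 := by ring
      omega
    refine Ends.while I₂ K h0 ?_ ?_
    · rintro k hk s ⟨h3, hr, hm⟩
      constructor
      · simp only [Expr.eval_less, Expr.eval_mul, Expr.eval_reg, h3, hr.1]
        rw [Nat.mod_eq_of_lt (hsq k hk.le), if_pos]
        · exact one_ne_zero
        · have : (k + 1) * (k + 1) ≤ K * K := Nat.mul_le_mul hk hk
          omega
      · refine Ends.le (Ends.assign ⟨?_, by simpa [R] using hr, by simpa using hm⟩) (by simp)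
        simp only [State.reg_setReg, if_true, Expr.eval_add, Expr.eval_reg, Expr.eval_const, h3, hone]
        exact Nat.mod_eq_of_lt (by omega)
    · rintro s ⟨h3, hr, -⟩
      simp only [Expr.eval_less, Expr.eval_mul, Expr.eval_reg, h3, hr.1]
      rw [Nat.mod_eq_of_lt (hsq K le_rfl), if_neg]
      exact not_lt.2 hS.n_le_m
  let I₃ : ℕ → State → Prop := fun t s => s.reg 6 = t ∧ s.reg 3 = K + 1 ∧ R s ∧
    (∀ a, a < 2 * 2 ^ l ∨ 8 * 2 ^ l ≤ a → s.mem a = (input π).mem a) ∧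
    (∀ j < t, s.mem (2 * 2 ^ l + (input π).mem j) = j) ∧ ∀ j < t, s.mem (6 * 2 ^ l + j) = j
  have h₃ : ∀ s, I₃ 0 (s.setReg 6 0) → Ends w (24 * (n + 1)) (.forLoop 6 (.reg 0)
      (.seq (.load 8 (cell 0 6))
      (.seq (.store (cell 1 8) (.reg 6))
      (.store (cell 3 6) (.reg 6))))) s (n * (1 + 20 + 8) + (1 + 5)) (I₃ n) := by
    intro s h0
    refine Ends.forLoop I₃ n (by omega) ?_ h0 ?_ ?_
    · rintro t s ⟨-, -, hr, -⟩
      exact hr.1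
    · rintro t s ⟨h6, -⟩
      exact h6
    · rintro t ht s ⟨h6, h3, hr, hm, hq, hi⟩
      have hpt := hS.inv.p_lt t ht
      have e1 : (cell 0 6).eval w s = t := by
        have := hS.eval_cell hr.2.1 (k := 0) (by norm_num) h6 (by omega)
        omega
      have hpt' : s.mem t = (input π).mem t := hm t (by omega)
      have e2 : ∀ s' : State, s'.reg 1 = 2 * 2 ^ l → s'.reg 8 = (input π).mem t →
          (cell 1 8).eval w s' = 2 * 2 ^ l + (input π).mem t := fun s' a1 a2 =>
        hS.eval_cell (k := 1) a1 (by norm_num) a2 (by omega)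
      have e3 : ∀ s' : State, s'.reg 1 = 2 * 2 ^ l → s'.reg 6 = t →
          (cell 3 6).eval w s' = 6 * 2 ^ l + t := fun s' a1 a2 =>
        hS.eval_cell (k := 3) a1 (by norm_num) a2 (by omega)
      refine Ends.le (Ends.seq (Ends.load (by rw [e1]; omega) (Ends.seq (Ends.store ?_
        (Ends.store ?_ ?_))))) ?_
      · rw [e1, e2 _ (by simpa using hr.2.1) (by simpa using hpt')]
        omega
      · rw [e3 _ (by simpa using hr.2.1) (by simpa using h6)]
        omega
      · rw [e3 _ (by simpa using hr.2.1) (by simpa using h6), e1,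
          e2 _ (by simpa using hr.2.1) (by simpa using hpt')]
        refine ⟨by simpa using h6, by simp, by simpa using h3, by simpa [R] using hr, ?_, ?_, ?_⟩
        · intro a ha
          simp [show a ≠ 6 * 2 ^ l + t by omega, show a ≠ 2 * 2 ^ l + (input π).mem t by omega,
            hm a ha]
        · intro j hj
          have hjn := hS.inv.p_lt j (by omega)
          have : 2 * 2 ^ l + (input π).mem j ≠ 6 * 2 ^ l + t := by omega
          by_cases hjt : j = t
          · subst hjt
            simp [this, h6]
          · have hne : (input π).mem j ≠ (input π).mem t := fun h =>
              hjt (hS.inv.p_inj (by omega) ht h)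
            simp [this, hne, hq j (by omega)]
        · intro j hj
          have : 6 * 2 ^ l + j ≠ 2 * 2 ^ l + (input π).mem t := by omega
          by_cases hjt : j = t
          · simp [hjt, h6]
          · simp [hjt, this, hi j (by omega)]
      · simp
  refine Ends.le (Ends.seq (T' := (l * (3 + 1 + 4) + (3 + 1)) + (4 + (2 +
    ((K * (5 + 1 + 4) + (5 + 1)) + (n * (1 + 20 + 8) + (1 + 5))))))
    (Ends.assign (Ends.seq ((h₁ _ ?_).imp ?_)))) ?_
  · exact ⟨by simp [hone], fun x hx => by simp [hx], rfl⟩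
  · rintro s ⟨g2, gr, gm⟩
    refine Ends.seq (Ends.assign (Ends.seq (Ends.assign (Ends.seq ((h₂ _ ?_).imp ?_)))))
    · refine ⟨by simp [hone], ?_, by simpa using gm⟩
      have : (2 ^ l + 2 ^ l) % 2 ^ w = 2 * 2 ^ l := by
        rw [Nat.mod_eq_of_lt (by omega)]
        omega
      simp [R, g2, gr, input, this]
    · rintro s₂ ⟨k3, kr, km⟩
      refine (h₃ s₂ ?_).imp ?_
      · exact ⟨by simp, by simpa using k3, by simpa [R] using kr, fun a _ => by simp [km],
          by simp, by simp⟩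
      · rintro s₃ ⟨-, f3, ⟨f0, f1, f2, f4, f5⟩, fm, fq, fi⟩
        refine ⟨f0, f1, f2, f3, by simp [f4], f5, fun i hi => fm i (by omega), ?_, fi, ?_, ?_⟩
        · intro i hi
          have := fq _ (hS.inv.q_lt i hi)
          rwa [hS.inv.pq i hi] at this
        -- The cells of the two vectors lie beyond the input and have not been touched, so they
        -- still hold `0`.
        · intro i hi
          rw [fm _ (by omega)]
          simp [input, show ¬ 8 * 2 ^ l + i < n by omega]
        · intro i hi
          rw [fm _ (by omega)]
          simp [input, show ¬ 10 * 2 ^ l + i < n by omega]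
  · simp only [Expr.cost_const]
    omega

/-- The program that evaluates a linear combination of tree and cycle statistics, divided by `12`. -/
def patternProg (cs : List (ℤ × Term)) : Prog :=
  .seq setupProg (.seq (termsProg cs) (.assign 0 ((.reg 4 + .const 0) / .const 12)))

theorem patternProg_ends {n w : ℕ} (π : Equiv.Perm (Fin n)) (hw : 512 * (n + 1) ≤ 2 ^ w)
    (cs : List (ℤ × Term)) (N : ℕ) (hN : 12 * N < 2 ^ w)
    (hcs : (12 * N : ℤ) = (cs.map fun c => c.1 * (tupleCount c.2.test π : ℤ)).sum) :
    Ends w (24 * (n + 1)) (patternProg cs) (input π)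
      ((n + 1) * 120 + (cs.length *
        (12 * ((Nat.sqrt (n - 1) + 1 + 1) * opTime n (Nat.clog 2 n))) + 1 + 6))
      fun s => s.reg 0 = N := by
  refine Ends.seq ((setupProg_ends π hw).imp fun s h => Ends.seq
    ((termsProg_ends (setting_input π hw) (π := π) (fun i => by simp [input]) cs h).imp ?_))
  rintro s' ⟨b, v, u, h'⟩
  refine Ends.le (Ends.assign ?_) le_rfl
  have h4 := h'.reg4
  rw [zero_add, ← hcs] at h4
  have h4' : (s'.reg 4 : ZMod (2 ^ w)) = ((12 * N : ℕ) : ZMod (2 ^ w)) := by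
    rw [h4]
    push_cast
    rfl
  rw [ZMod.natCast_eq_natCast_iff', Nat.mod_eq_of_lt hN] at h4'
  -- Only the residue of register `4` is known. Adding `0` before the division replaces its content
  -- by the representative below `2 ^ w`.
  simp only [State.reg_setReg, if_true, Expr.eval_div, Expr.eval_add, Expr.eval_reg, Expr.eval_const,
    Nat.zero_mod, add_zero, h4']
  rw [Nat.mod_eq_of_lt (by omega : 12 < 2 ^ w)]
  omega

end WordRAM

theorem patternCount_le {k n : ℕ} (σ : Equiv.Perm (Fin k)) (π : Equiv.Perm (Fin n)) :
    patternCount σ π ≤ n ^ k := by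
  have h := Nat.card_le_card_of_injective
    (fun i : {i : Fin k ↪o Fin n // ∀ j j' : Fin k, π (i j) < π (i j') → σ j < σ j'} =>
      (fun j => i.1 j : Fin k → Fin n)) fun a b hab =>
      Subtype.ext (RelEmbedding.ext fun j => congrFun hab j)
  simpa [patternCount] using h

/-- The factor 10 gives `M ^ 10 ≤ 2 ^ w` for a number `M ≥ 2` that exceeds `n`. Nine of the factors
absorb `512`, and six absorb the `12` in front of the fourth power. -/
theorem word_bounds {n w : ℕ} (hw : 10 * (Nat.log 2 n + 1) ≤ w) :
    512 * (n + 1) ≤ 2 ^ w ∧ 12 * n ^ 4 < 2 ^ w := by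
  set M := 2 ^ (Nat.log 2 n + 1) with hM
  have hn : n < M := Nat.lt_pow_succ_log_self (by norm_num) n
  have h2 : 2 ≤ M := Nat.le_self_pow (Nat.succ_ne_zero _) 2
  have h10 : M ^ 10 ≤ 2 ^ w := by
    rw [hM, ← pow_mul, mul_comm]
    exact Nat.pow_le_pow_right (by norm_num) hw
  have h9 : 2 ^ 9 ≤ M ^ 9 := Nat.pow_le_pow_left h2 9
  have h6 : 2 ^ 6 ≤ M ^ 6 := Nat.pow_le_pow_left h2 6
  constructor
  · calc 512 * (n + 1) ≤ M ^ 9 * M := Nat.mul_le_mul h9 hn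
      _ = M ^ 10 := by ring
      _ ≤ 2 ^ w := h10
  · calc 12 * n ^ 4 < 2 ^ 6 * M ^ 4 := by
          have : n ^ 4 ≤ M ^ 4 := Nat.pow_le_pow_left hn.le 4
          have : 0 < M ^ 4 := by positivity
          omega
      _ ≤ M ^ 6 * M ^ 4 := Nat.mul_le_mul_right _ h6
      _ = M ^ 10 := by ring
      _ ≤ 2 ^ w := h10

/-! ### Bounds for the time and the space -/

theorem clog_le_log_succ (n : ℕ) : Nat.clog 2 n ≤ Nat.log 2 n + 1 :=
  Nat.clog_le_of_le_pow (Nat.lt_pow_succ_log_self (by norm_num) n).le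

/-- About √n blocks times O(n log n). For `n ≥ 3` the logarithm is at least 1 and absorbs constants,
and `log 2 > 1 / 2` bounds the binary logarithm by twice the natural one. -/
theorem opTime_bound {n : ℕ} (hn : 3 ≤ n) :
    (((Nat.sqrt (n - 1) + 1 + 1) * WordRAM.opTime n (Nat.clog 2 n) : ℕ) : ℝ) ≤
      2000 * ((n : ℝ) ^ (3 / 2 : ℝ) * Real.log n) := by
  have hn' : (3 : ℝ) ≤ n := by exact_mod_cast hn
  have hn0 : (0 : ℝ) < n := by linarith
  have hlog : 1 ≤ Real.log n := by
    rw [Real.le_log_iff_exp_le hn0]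
    linarith [Real.exp_one_lt_d9]
  have hl2 : (Nat.log 2 n : ℝ) ≤ 2 * Real.log n := by
    have h1 : ((2 : ℝ) ^ Nat.log 2 n) ≤ n := by exact_mod_cast Nat.pow_log_le_self 2 (by omega)
    have h2 := Real.log_le_log (by positivity) h1
    rw [Real.log_pow] at h2
    have h3 : (0 : ℝ) ≤ Nat.log 2 n := Nat.cast_nonneg _
    nlinarith [Real.log_two_gt_d9]
  have hcl : (Nat.clog 2 n : ℝ) ≤ Nat.log 2 n + 1 := by exact_mod_cast clog_le_log_succ n
  have hsq : (Nat.sqrt (n - 1) : ℝ) ≤ Real.sqrt n :=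
    (Nat.cast_le.2 (Nat.sqrt_le_sqrt (Nat.sub_le n 1))).trans Real.nat_sqrt_le_real_sqrt
  have hsq1 : 1 ≤ Real.sqrt n := Real.one_le_sqrt.2 (by linarith)
  have hpow : (n : ℝ) ^ (3 / 2 : ℝ) = n * Real.sqrt n := by
    rw [Real.sqrt_eq_rpow, ← Real.rpow_one_add' hn0.le (by norm_num)]
    norm_num
  rw [hpow, WordRAM.opTime]
  push_cast
  have a : (Nat.sqrt (n - 1) : ℝ) + 1 + 1 ≤ 3 * Real.sqrt n := by linarith
  have b : (n : ℝ) + 1 ≤ 2 * n := by linarith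
  -- The left side is at most `104 * log n + 224`, hence at most `328 * log n`.
  have c : 52 * ((Nat.clog 2 n : ℝ) + 1) + 120 ≤ 330 * Real.log n := by linarith
  calc ((Nat.sqrt (n - 1) : ℝ) + 1 + 1) * ((n + 1) * (52 * ((Nat.clog 2 n : ℝ) + 1) + 120))
      ≤ (3 * Real.sqrt n) * ((2 * n) * (330 * Real.log n)) := by gcongr
    _ = 1980 * (n * Real.sqrt n * Real.log n) := by ring
    _ ≤ 2000 * (n * Real.sqrt n * Real.log n) := by
      have : 0 ≤ n * Real.sqrt n * Real.log n := by positivity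
      linarith

theorem theorem3 (σ : Equiv.Perm (Fin 4)) :
    ∃ T S : ℕ → ℕ,
      SoftO T (fun n : ℕ => (n : ℝ) ^ (3 / 2 : ℝ)) ∧
      SoftO S (fun n : ℕ => (n : ℝ) ^ (3 / 2 : ℝ)) ∧
      WordRAM.Computes (fun (n : ℕ) (π : Equiv.Perm (Fin n)) => patternCount σ π) T S := by
  obtain ⟨cs, hcs⟩ := exists_tupleCount_formula σ
  -- Each term of the combination costs 12 units, and two more cover the setup and the final
  -- division. The space is linear and needs no logarithm; the time needs one.
  refine ⟨fun n => (12 * cs.length + 2) *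
    ((Nat.sqrt (n - 1) + 1 + 1) * WordRAM.opTime n (Nat.clog 2 n)), fun n => 24 * (n + 1),
    ⟨1, ?_⟩, ⟨0, ?_⟩, WordRAM.patternProg cs, 10, by norm_num, ?_⟩
  · refine Asymptotics.IsBigO.of_bound ((12 * cs.length + 2 : ℕ) * 2000) ?_
    filter_upwards [Filter.eventually_ge_atTop 3] with n hn
    have h := opTime_bound hn
    have hn' : (3 : ℝ) ≤ n := by exact_mod_cast hn
    have hlog : 0 ≤ Real.log n := Real.log_nonneg (by linarith)
    rw [Real.norm_of_nonneg (Nat.cast_nonneg _), Real.norm_of_nonneg (by positivity), pow_one,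
      Nat.cast_mul, mul_assoc]
    gcongr
  · refine Asymptotics.IsBigO.of_bound 48 ?_
    filter_upwards [Filter.eventually_ge_atTop 1] with n hn
    have hn' : (1 : ℝ) ≤ n := by exact_mod_cast hn
    have h : (n : ℝ) ≤ (n : ℝ) ^ (3 / 2 : ℝ) := by
      conv_lhs => rw [← Real.rpow_one (n : ℝ)]
      exact Real.rpow_le_rpow_of_exponent_le hn' (by norm_num)
    rw [Real.norm_of_nonneg (Nat.cast_nonneg _), Real.norm_of_nonneg (by positivity), pow_zero,
      mul_one]
    push_cast
    linarith
  · intro n w hw π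
    obtain ⟨h1, h2⟩ := word_bounds hw
    have hN : 12 * patternCount σ π < 2 ^ w :=
      (Nat.mul_le_mul_left _ (patternCount_le σ π)).trans_lt h2
    obtain ⟨t, s, he, ht, hq⟩ := WordRAM.patternProg_ends π h1 cs _ hN (hcs n π)
    refine ⟨t, s, he, ht.trans ?_, hq⟩
    dsimp only
    set U := WordRAM.opTime n (Nat.clog 2 n) with hU
    set X := (Nat.sqrt (n - 1) + 1 + 1) * U with hX
    have hUX : U ≤ X := Nat.le_mul_of_pos_left _ (Nat.succ_pos _)
    have hU1 : (n + 1) * 120 ≤ U := WordRAM.le_opTime (by norm_num)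
    have hU2 : 7 ≤ U := WordRAM.one_le_opTime (by norm_num)
    have : (12 * cs.length + 2) * X = cs.length * (12 * X) + 2 * X := by ring
    omega
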